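/- Let $k$ be an algebraically closed field of characteristic $0$, let $C$ be a smooth curve over $k$ with a distinguished point $0$, and let $t\colon C\to\mathbb{A}^1$ be an étale morphism with $t^{-1}(0)=\{0\}$. Let $\pi\colon X\to C$ be a strict simple degeneration: $X$ is a smooth (quasi-separated) algebraic space over $k$, $\pi$ is flat and is smooth outside the central fibre $X_0=\pi^{-1}(0)$, the fibre $X_0$ has normal crossings, its singular locus is smooth, and all components of $X_0$ are smooth. The dual graph $\Gamma(X_0)$ has the components of $X_0$ as nodes and the components $D$ of the singular locus of $X_0$ as edges, where $[D]$ joins the two components $Y_1\neq Y_2$ of $X_0$ such that $D$ is a component of $Y_1\cap Y_2$. Fix an orientation of $\Gamma(X_0)$ and an integer $n\ge 0$. Put $C[n]=C\times_{\mathbb{A}^1}\mathbb{A}^{n+1}$, formed with $t$ and the multiplication morphism $\mathbb{A}^{n+1}\to\mathbb{A}^1$, and let $G[n]=\{(\sigma_1,\dots,\sigma_{n+1})\in\mathbb{G}_m^{n+1} : \prod_i\sigma_i=1\}$ act on $C[n]$, and on $X\times_C C[n]$, by $t_i\mapsto\sigma_i t_i$. The expanded degeneration $X[n]\to C[n]$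 associated with the orientation is given by a morphism $X[n]\to X\times_C C[n]=X\times_{\mathbb{A}^1}\mathbb{A}^{n+1}$ which is an isomorphism away from the singular locus of $X_0$ and has the following form near each component $D$ of it. Let the arrow $[D]$ point from $[Y_1]$ to $[Y_2]$, and let $U\subset X$ be the complement of all components of $X_0$ other than $Y_1,Y_2$ and of all components of $Y_1\cap Y_2$ other than $D$. Over $U$ the space $X[n]$ is $U[n]$, where $U[0]=U$, and $U[m]$ is the blow-up of $U[m-1]\times_{\mathbb{A}^1}\mathbb{A}^2$ (formed with the last coordinate $t_m$ on $U[m-1]$ and the multiplication $\mathbb{A}^2\to\mathbb{A}^1$) along the strict transform of $(Y_1\cap U)\times V(t_{m+1})\subset U\times_{\mathbb{A}^1}\mathbb{A}^{m+1}$. The space $X[n]$ carries the $G[n]$-action for which $X[n]\to X\times_C C[n]$ is equivariant. Let $X[n]\to C[n]$ and $X[n]'\to C[n]$ be the expanded degenerations associated with the given orientation and with the opposite orientation of $\Gamma(X_0)$. Then there is an isomorphism $\phi\colon X[n]\to X[n]'$ which covers the involution $\rho$ of $C[n]$ induced by $(t_1,t_2,\dots,t_{n+1})\mapsto(t_{n+1},t_n,\dots,t_1)$,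 and which is $G[n]$-equivariant with respect to the corresponding automorphism of $G[n]$, that is, $\phi(\sigma\cdot x)=\bar\sigma\cdot\phi(x)$ with $\bar\sigma=(\sigma_{n+1},\dots,\sigma_1)$ for $\sigma=(\sigma_1,\dots,\sigma_{n+1})\in G[n]$. -/

import Mathlib

open CategoryTheory AlgebraicGeometry Opposite Limits TopologicalSpace

universe u

noncomputable section

namespace ExpDeg

/-! ### Functors of points and algebraic spaces

Spaces are described by their functors of points `Scheme.{u}ᵒᵖ ⥤ Type u`; a scheme `T` is the
functor `yoneda.obj T`, and a `T`-valued point of `F` is an element of `F.obj (op T)`. -/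

/-- The functors of points on schemes. -/
abbrev Space : Type (u + 1) := Scheme.{u}ᵒᵖ ⥤ Type u

/-- A `T`-valued point `x` of `F` is an étale chart if the morphism `T ⟶ F` it defines is
representable and étale. -/
def IsEtaleChart {F : Space.{u}} {T : Scheme.{u}} (x : F.obj (op T)) : Prop :=
  MorphismProperty.presheaf (@Etale) (yonedaEquiv.symm x)

/-- (Quasi-separated) algebraic spaces: étale sheaves with representable quasi-compact diagonal
which admit an étale surjection from a scheme. The diagonal is representable iff every morphism
from a scheme is representable, and it is quasi-compact iff the fibre products over `F` of
affine schemes are quasi-compact. -/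
structure IsAlgebraicSpace (F : Space.{u}) : Prop where
  isSheaf : Presheaf.IsSheaf Scheme.etaleTopology.{u} F
  representable : ∀ (U : Scheme.{u}) (x : F.obj (op U)),
    yoneda.relativelyRepresentable (yonedaEquiv.symm x)
  quasiSeparated : ∀ (U V W : Scheme.{u}) [IsAffine U] [IsAffine V]
    (x : F.obj (op U)) (y : F.obj (op V)) (a : W ⟶ U) (b : W ⟶ V),
    IsPullback (yoneda.map a) (yoneda.map b) (yonedaEquiv.symm x) (yonedaEquiv.symm y) →
      CompactSpace W
  exists_atlas : ∃ (U : Scheme.{u}) (x : F.obj (op U)),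
    IsEtaleChart x ∧ MorphismProperty.presheaf (@Surjective) (yonedaEquiv.symm x)

/-! ### The underlying topological space of an algebraic space -/

/-- A point of a scheme mapping to `F`. -/
abbrev PrePt (F : Space.{u}) : Type (u + 1) := Σ T : Scheme.{u}, F.obj (op T) × T

/-- `b` is a lift of `a` along a morphism over `F`. -/
def PtRel (F : Space.{u}) (a b : PrePt F) : Prop :=
  ∃ g : b.1 ⟶ a.1, F.map g.op a.2.1 = b.2.1 ∧ g b.2.2 = a.2.2

/-- The points `|F|` of `F`: the points of all schemes `T` over `F`, two of them being
identified if they are linked by morphisms over `F`. -/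
def Pts (F : Space.{u}) : Type (u + 1) := Quot (PtRel F)

/-- The map `|T| → |F|` defined by a `T`-valued point. -/
def ptOf {F : Space.{u}} {T : Scheme.{u}} (x : F.obj (op T)) (p : T) : Pts F :=
  Quot.mk _ ⟨T, x, p⟩

/-- A subset of `|F|` is open iff its preimage in every scheme over `F` is open. -/
instance (F : Space.{u}) : TopologicalSpace (Pts F) :=
  ⨆ a : Σ T : Scheme.{u}, F.obj (op T), TopologicalSpace.coinduced (ptOf a.2) inferInstance

theorem ptOf_map {F : Space.{u}} {S T : Scheme.{u}} (g : S ⟶ T) (x : F.obj (op T)) (p : S) :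
    ptOf (F.map g.op x) p = ptOf x (g p) :=
  (Quot.sound ⟨g, rfl, rfl⟩ : (Quot.mk (PtRel F) ⟨T, x, g p⟩ : Pts F) = _).symm

theorem continuous_ptOf {F : Space.{u}} {T : Scheme.{u}} (x : F.obj (op T)) :
    Continuous (ptOf x) :=
  continuous_iff_coinduced_le.2
    (le_iSup (fun a : Σ T : Scheme.{u}, F.obj (op T) =>
      TopologicalSpace.coinduced (ptOf (F := F) a.2) inferInstance) ⟨T, x⟩)

/-- The map `|F| → |F'|` induced by a morphism. -/
def Pts.map {F F' : Space.{u}} (h : F ⟶ F') : Pts F → Pts F' :=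
  Quot.map (fun a => ⟨a.1, h.app _ a.2.1, a.2.2⟩) (by
    rintro ⟨T, x, p⟩ ⟨S, y, q⟩ ⟨g, hg, hp⟩
    exact ⟨g, by simp only at hg ⊢; rw [← hg]; exact (NatTrans.naturality_apply h g.op x).symm, hp⟩)

/-- The morphism `T ⟶ C` induced by `π : F ⟶ C` on a `T`-valued point of `F`. -/
def chartMap {F : Space.{u}} {C : Scheme.{u}} (π : F ⟶ yoneda.obj C) {T : Scheme.{u}}
    (x : F.obj (op T)) : T ⟶ C :=
  π.app _ x

theorem chartMap_map {F : Space.{u}} {C : Scheme.{u}} (π : F ⟶ yoneda.obj C) {S T : Scheme.{u}}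
    (g : S ⟶ T) (x : F.obj (op T)) : chartMap π (F.map g.op x) = g ≫ chartMap π x :=
  NatTrans.naturality_apply π g.op x

/-- The map `|F| → |C|` induced by a morphism from `F` to a scheme `C`. -/
def Pts.toScheme {F : Space.{u}} {C : Scheme.{u}} (π : F ⟶ yoneda.obj C) : Pts F → C :=
  Quot.lift (fun a => chartMap π a.2.1 a.2.2) (by
    rintro ⟨T, x, p⟩ ⟨S, y, q⟩ ⟨g, hg, hp⟩
    dsimp only at hg hp ⊢
    rw [← hg, ← hp, chartMap_map]
    rfl)

/-- The subspace of `F` on a (in practice open) subset `V` of `|F|`. -/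
def subspaceOn {F : Space.{u}} (V : Set (Pts F)) : Subfunctor F where
  obj T := {x | ∀ p : T.unop, ptOf (F := F) (T := T.unop) x p ∈ V}
  map {S T} i x hx p := by
    have := hx (i.unop p)
    rw [← ptOf_map] at this
    exact this

/-- The irreducible components of a closed subset `A`: the maximal irreducible subsets of `A`. -/
def componentsOf {P : Type*} [TopologicalSpace P] (A : Set P) : Set (Set P) :=
  {Z | Maximal (fun W => W ⊆ A ∧ IsIrreducible W) Z}

/-! ### Closed subspaces and blow-ups -/

/-- The ideal sheaf, on the étale chart `x`, of a closed subset `Z ⊆ |F|` with its reduced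
structure. -/
def reducedIdeal {F : Space.{u}} (Z : Closeds (Pts F)) {U : Scheme.{u}} (x : F.obj (op U)) :
    U.IdealSheafData :=
  Scheme.IdealSheafData.vanishingIdeal (Z.preimage (continuous_ptOf x))

/-- The ideal sheaf of an effective Cartier divisor: locally generated by one element which is
not a zero divisor. -/
def IsCartier {P : Scheme.{u}} (I : P.IdealSheafData) : Prop :=
  ∀ p : P, ∃ V : P.affineOpens, p ∈ V.1 ∧
    ∃ s ∈ nonZeroDivisors Γ(P, V.1), I.ideal V = Ideal.span {s}

/-- The preimage in `T` of the reduced closed subspace `Z` of `F`, under the morphism `T ⟶ F`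
given by `x`, is an effective Cartier divisor. This is tested étale locally on `T`, where the
morphism factors through étale charts of `F`. -/
def PreimageCartier {F : Space.{u}} (Z : Closeds (Pts F)) {T : Scheme.{u}} (x : F.obj (op T)) :
    Prop :=
  ∀ (P U : Scheme.{u}) (g : P ⟶ T) (e : F.obj (op U)) (q : P ⟶ U), Etale g → IsEtaleChart e →
    F.map q.op e = F.map g.op x → IsCartier ((reducedIdeal Z e).comap q)

/-- `b : B ⟶ A` is the blow-up of the algebraic space `A` along the reduced closed subspace `Z`:
the preimage of `Z` in `B` is an effective Cartier divisor, and `b` is universal with this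
property. -/
structure IsBlowup {A B : Space.{u}} (b : B ⟶ A) (Z : Closeds (Pts A)) : Prop where
  isAlgebraicSpace : IsAlgebraicSpace B
  preimageCartier : ∀ (U : Scheme.{u}) (e : B.obj (op U)), IsEtaleChart e →
    PreimageCartier Z (b.app _ e)
  existsUnique_lift : ∀ (T : Scheme.{u}) (x : A.obj (op T)), PreimageCartier Z x →
    ∃! y : B.obj (op T), b.app _ y = x

/-! ### Affine spaces, and the products `X ×_{𝔸¹} 𝔸ⁿ⁺¹` -/

/-- The affine line as a functor: `𝔸¹(T) = Γ(T, 𝒪_T)`. Morphisms `F ⟶ A1` are the regular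
functions on `F`. -/
abbrev A1 : Space.{u} := Scheme.Γ ⋙ forget CommRingCat.{u}

/-- Pullback of global functions. -/
abbrev pullFn {S T : Scheme.{u}} (g : S ⟶ T) : Γ(T, ⊤) →+* Γ(S, ⊤) := g.appTop.hom

theorem pullFn_id (T : Scheme.{u}) (s : Γ(T, ⊤)) : pullFn (𝟙 T) s = s := by
  simp [pullFn]

theorem pullFn_comp {R S T : Scheme.{u}} (h : R ⟶ S) (g : S ⟶ T) (s : Γ(T, ⊤)) :
    pullFn (h ≫ g) s = pullFn h (pullFn g s) :=
  rfl

/-- The value of a regular function on a `T`-valued point. -/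
def fnAt {F : Space.{u}} (h : F ⟶ A1) {T : Scheme.{u}} (x : F.obj (op T)) : Γ(T, ⊤) :=
  h.app (op T) x

theorem fnAt_map {F : Space.{u}} (h : F ⟶ A1) {S T : Scheme.{u}} (g : S ⟶ T)
    (x : F.obj (op T)) : fnAt h (F.map g.op x) = pullFn g (fnAt h x) :=
  NatTrans.naturality_apply h g.op x

/-- The regular function on the functor of points of `C` defined by `t ∈ Γ(C, 𝒪_C)`. -/
def fnOf {C : Scheme.{u}} (t : Γ(C, ⊤)) : yoneda.obj C ⟶ A1 :=
  yonedaEquiv.symm (show (A1.{u}).obj (op C) from t)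

/-- The zero locus of a regular function. -/
def zeros {F : Space.{u}} (h : F ⟶ A1) : Set (Pts F) :=
  {q | Quot.lift (fun a : PrePt F => a.2.2 ∉ a.1.basicOpen (fnAt h a.2.1)) (by
    rintro ⟨T, x, p⟩ ⟨S, y, q⟩ ⟨g, hg, hp⟩
    dsimp only at hg hp ⊢
    rw [← hg, fnAt_map, ← hp]
    have := Scheme.preimage_basicOpen_top g (fnAt h x)
    rw [← this]
    rfl) q}

/-- The `T`-valued points of `X ×_{𝔸¹} 𝔸ⁿ⁺¹`, formed with a regular function `f : X ⟶ 𝔸¹` and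
the multiplication morphism `𝔸ⁿ⁺¹ ⟶ 𝔸¹`: pairs `(x, (t₁, …, tₙ₊₁))` with `f x = t₁ ⋯ tₙ₊₁`. -/
@[ext]
structure FibPt (X : Space.{u}) (f : X ⟶ A1) (n : ℕ) (T : Scheme.{u}) : Type u where
  pt : X.obj (op T)
  coord : Fin (n + 1) → Γ(T, ⊤)
  eq : fnAt f pt = ∏ i, coord i

/-- The fibre product `X ×_{𝔸¹} 𝔸ⁿ⁺¹`. -/
def fib (X : Space.{u}) (f : X ⟶ A1) (n : ℕ) : Space.{u} where
  obj T := FibPt X f n T.unop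
  map {T S} g := ↾fun p => ⟨X.map g p.pt, fun i => pullFn g.unop (p.coord i), by
    have h := fnAt_map f g.unop p.pt
    rw [p.eq, map_prod] at h
    exact h⟩
  map_id T := by
    refine ConcreteCategory.hom_ext _ _ fun p => ?_
    refine FibPt.ext ?_ (funext fun i => ?_) <;> simp [pullFn_id]
  map_comp g h := by
    refine ConcreteCategory.hom_ext _ _ fun p => ?_
    refine FibPt.ext ?_ (funext fun i => ?_) <;> simp [pullFn_comp]

/-- The first projection `X ×_{𝔸¹} 𝔸ⁿ⁺¹ ⟶ X`. -/
def fib.fst {X : Space.{u}} (f : X ⟶ A1) (n : ℕ) : fib X f n ⟶ X where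
  app _ := ↾fun p => p.pt
  naturality _ _ _ := rfl

/-- The coordinate functions on `X ×_{𝔸¹} 𝔸ⁿ⁺¹`. -/
def fib.coord {X : Space.{u}} (f : X ⟶ A1) (n : ℕ) (i : Fin (n + 1)) : fib X f n ⟶ A1 where
  app T := ↾fun p => (show (A1.{u}).obj T from p.coord i)
  naturality _ _ _ := rfl

/-- Functoriality of `X ×_{𝔸¹} 𝔸ⁿ⁺¹` in the space `X` over `𝔸¹`. -/
def fib.map {X Y : Space.{u}} (h : X ⟶ Y) (f : Y ⟶ A1) (n : ℕ) : fib X (h ≫ f) n ⟶ fib Y f n where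
  app T := ↾fun p => ⟨h.app T p.pt, p.coord, p.eq⟩
  naturality S T g := by
    refine ConcreteCategory.hom_ext _ _ fun p => ?_
    exact FibPt.ext (NatTrans.naturality_apply h g p.pt :) rfl

/-- The `T`-valued points of `B ×_{𝔸¹} 𝔸²`, formed with a regular function `g : B ⟶ 𝔸¹` and the
multiplication morphism `𝔸² ⟶ 𝔸¹`. -/
@[ext]
structure ProdA2Pt (B : Space.{u}) (g : B ⟶ A1) (T : Scheme.{u}) : Type u where
  pt : B.obj (op T)
  fst : Γ(T, ⊤)
  snd : Γ(T, ⊤)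
  eq : fnAt g pt = fst * snd

/-- The fibre product `B ×_{𝔸¹} 𝔸²`. -/
def prodA2 (B : Space.{u}) (g : B ⟶ A1) : Space.{u} where
  obj T := ProdA2Pt B g T.unop
  map {T S} k := ↾fun p => ⟨B.map k p.pt, pullFn k.unop p.fst, pullFn k.unop p.snd, by
    have h := fnAt_map g k.unop p.pt
    rw [p.eq, map_mul] at h
    exact h⟩
  map_id T := by
    refine ConcreteCategory.hom_ext _ _ fun p => ?_
    refine ProdA2Pt.ext ?_ ?_ ?_ <;> simp [pullFn_id]
  map_comp g h := by
    refine ConcreteCategory.hom_ext _ _ fun p => ?_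
    refine ProdA2Pt.ext ?_ ?_ ?_ <;> simp [pullFn_comp]

/-- The second coordinate of `𝔸²`, as a function on `B ×_{𝔸¹} 𝔸²`. -/
def prodA2.snd {B : Space.{u}} (g : B ⟶ A1) : prodA2 B g ⟶ A1 where
  app T := ↾fun p => (show (A1.{u}).obj T from p.snd)
  naturality _ _ _ := rfl

/-- A morphism `r : B ⟶ X ×_{𝔸¹} 𝔸ⁿ⁺¹` induces a morphism from `B ×_{𝔸¹} 𝔸²`, formed with
the last coordinate, to `X ×_{𝔸¹} 𝔸ⁿ⁺²`: the coordinate `tₙ₊₁` is replaced by the two coordinates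
of `𝔸²`, whose product it is. -/
def prodA2.toFib {X B : Space.{u}} {f : X ⟶ A1} {n : ℕ} (r : B ⟶ fib X f n) :
    prodA2 B (r ≫ fib.coord f n (Fin.last n)) ⟶ fib X f (n + 1) where
  app T := ↾fun p => ⟨(r.app T p.pt).pt,
    Fin.snoc (α := fun _ => Γ(T.unop, ⊤))
      (Fin.snoc (α := fun _ => Γ(T.unop, ⊤)) (Fin.init (r.app T p.pt).coord) p.fst) p.snd, by
    have h1 := (r.app T p.pt).eq
    have h2 : (r.app T p.pt).coord (Fin.last n) = p.fst * p.snd := p.eq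
    rw [Fin.prod_univ_castSucc, h2] at h1
    rw [Fin.prod_univ_castSucc, Fin.prod_univ_castSucc]
    simp only [Fin.snoc_castSucc, Fin.snoc_last]
    rw [mul_assoc]
    exact h1⟩
  naturality S T g := by
    refine ConcreteCategory.hom_ext _ _ fun p => ?_
    have h := NatTrans.naturality_apply r g p.pt
    refine FibPt.ext (congrArg FibPt.pt h :) (funext fun i => ?_)
    change Fin.snoc (α := fun _ => Γ(T.unop, ⊤)) (Fin.snoc (α := fun _ => Γ(T.unop, ⊤))
        (Fin.init (r.app T (B.map g p.pt)).coord) (pullFn g.unop p.fst)) (pullFn g.unop p.snd) i =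
      pullFn g.unop (Fin.snoc (α := fun _ => Γ(S.unop, ⊤)) (Fin.snoc (α := fun _ => Γ(S.unop, ⊤))
        (Fin.init (r.app S p.pt).coord) p.fst) p.snd i)
    refine Fin.lastCases ?_ (fun i => ?_) i
    · simp
    · refine Fin.lastCases ?_ (fun i => ?_) i
      · simp
      · simp only [Fin.snoc_castSucc]
        exact congrArg (fun z => FibPt.coord z i.castSucc) h

/-! ### Strict simple degenerations -/

/-- `f` is smooth in a neighbourhood of the point `x`. -/
def SmoothAt {X Y : Scheme.{u}} (f : X ⟶ Y) (x : X) : Prop :=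
  ∃ V : X.Opens, x ∈ V ∧ Smooth (V.ι ≫ f)

section Degeneration

variable (k : Type u) [Field k] {C : Scheme.{u}} [C.Over (Spec (.of k))] (c₀ : C)
  {X : Space.{u}} (π : X ⟶ yoneda.obj C)

/-- The structure morphism of a chart over the ground field. -/
def chartStr {U : Scheme.{u}} (x : X.obj (op U)) : U ⟶ Spec (.of k) :=
  chartMap π x ≫ (C ↘ Spec (.of k))

/-- The ideal sheaf of the central fibre `X₀ = π⁻¹(c₀)` on a chart, the closed point `c₀` being
regarded as a reduced closed subscheme of `C`. -/
def centralIdeal {U : Scheme.{u}} (x : X.obj (op U)) : U.IdealSheafData :=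
  (Scheme.IdealSheafData.vanishingIdeal (Closeds.closure {c₀})).comap (chartMap π x)

/-- The underlying set of the central fibre. -/
def centralFibre : Set (Pts X) := {q | Pts.toScheme π q = c₀}

/-- The singular locus of the central fibre: the points at which, in an étale chart, the central
fibre is not smooth over the ground field. -/
def singularLocus : Set (Pts X) :=
  {q | ∃ (U : Scheme.{u}) (x : X.obj (op U)) (z : (centralIdeal c₀ π x).subscheme),
    IsEtaleChart x ∧ ptOf x ((centralIdeal c₀ π x).subschemeι z) = q ∧
    ¬ SmoothAt ((centralIdeal c₀ π x).subschemeι ≫ chartStr k π x) z}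

/-- The closed subset `Z` with its reduced structure is smooth over the ground field. -/
def IsSmoothReduced (Z : Closeds (Pts X)) : Prop :=
  ∀ (U : Scheme.{u}) (x : X.obj (op U)), IsEtaleChart x →
    Smooth ((reducedIdeal Z x).subschemeι ≫ chartStr k π x)

/-- The central fibre has normal crossings: every point of it lies in an étale chart with étale
coordinates `(xᵢ)` such that the central fibre is `∏_{i ∈ s} xᵢ = 0` for some set `s` of indices. -/
def HasNormalCrossings : Prop :=
  ∀ q ∈ centralFibre c₀ π, ∃ (U : Scheme.{u}) (e : X.obj (op U)) (p : U),
    IsEtaleChart e ∧ ptOf e p = q ∧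
    ∃ (ι : Type u) (_ : Finite ι) (x : ι → Γ(U, ⊤)) (s : Finset ι),
      Etale (AffineSpace.homOfVector (chartStr k π e) x) ∧
      centralIdeal c₀ π e = Scheme.IdealSheafData.ofIdealTop (Ideal.span {∏ i ∈ s, x i})

/-- `π : X ⟶ C` is a strict simple degeneration: `X` is a smooth algebraic space, `π` is flat,
and smooth outside the central fibre; the central fibre has normal crossings, its singular locus
is smooth, and all its components are smooth. -/
structure IsStrictSimpleDegeneration : Prop where
  isAlgebraicSpace : IsAlgebraicSpace X
  smooth : ∀ (U : Scheme.{u}) (x : X.obj (op U)), IsEtaleChart x → Smooth (chartStr k π x)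
  flat : ∀ (U : Scheme.{u}) (x : X.obj (op U)), IsEtaleChart x → Flat (chartMap π x)
  smooth_away : ∀ (U : Scheme.{u}) (x : X.obj (op U)), IsEtaleChart x →
    ∀ p : U, chartMap π x p ≠ c₀ → SmoothAt (chartMap π x) p
  normalCrossings : HasNormalCrossings k c₀ π
  smooth_singularLocus : IsSmoothReduced k π (Closeds.closure (singularLocus k c₀ π))
  smooth_components : ∀ Y ∈ componentsOf (centralFibre c₀ π),
    IsSmoothReduced k π (Closeds.closure Y)

/-- The nodes of the dual graph: the components of the central fibre. -/
abbrev Node : Type (u + 1) := componentsOf (centralFibre c₀ π)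

/-- The edges of the dual graph: the components of the singular locus of the central fibre. -/
abbrev Edge : Type (u + 1) := componentsOf (singularLocus k c₀ π)

/-- An orientation of the dual graph: the edge `[D]` joins the two components `Y₁ ≠ Y₂` such that
`D` is a component of `Y₁ ∩ Y₂`, and an orientation tells which of them is the source, and which
is the target. -/
structure Orientation where
  src : Edge k c₀ π → Node c₀ π
  tgt : Edge k c₀ π → Node c₀ π
  src_ne_tgt : ∀ D, src D ≠ tgt D
  mem_components : ∀ D, D.1 ∈ componentsOf ((src D).1 ∩ (tgt D).1)

variable {k c₀ π}

/-- The opposite orientation: all arrows are reversed. -/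
def Orientation.reverse (o : Orientation k c₀ π) : Orientation k c₀ π where
  src := o.tgt
  tgt := o.src
  src_ne_tgt D := (o.src_ne_tgt D).symm
  mem_components D := by rw [Set.inter_comm]; exact o.mem_components D

/-- The open neighbourhood of `D` whose complement is the union of all components of the central
fibre except the end points `Y₁`, `Y₂` of `[D]`, and all components of `Y₁ ∩ Y₂` except `D`. -/
def Orientation.nbhd (o : Orientation k c₀ π) (D : Edge k c₀ π) : Set (Pts X) :=
  {q | (∀ Y : Node c₀ π, Y ≠ o.src D → Y ≠ o.tgt D → q ∉ Y.1) ∧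
    ∀ Z ∈ componentsOf ((o.src D).1 ∩ (o.tgt D).1), Z ≠ D.1 → q ∉ Z}

end Degeneration

/-! ### Expanded degenerations -/

/-- The recursion in the basic case. Given `f : X ⟶ 𝔸¹` whose zero fibre has two components
with intersection `D`, the first of which is `Y`, this says that `r : B ⟶ X ×_{𝔸¹} 𝔸ⁿ⁺¹` is the
iterated blow-up `X[n]`: `X[0] = X`, and `X[n + 1]` is the blow-up of `X[n] ×_{𝔸¹} 𝔸²` along the
strict transform of `Y × V(tₙ₊₂)`. As `X[n] ×_{𝔸¹} 𝔸² ⟶ X ×_{𝔸¹} 𝔸ⁿ⁺²` is an isomorphism away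
from `D`, the strict transform is the closure of the preimage of `(Y ∖ D) × V(tₙ₊₂)`. -/
def IsIteratedBlowup {X : Space.{u}} (f : X ⟶ A1) (Y D : Set (Pts X)) :
    (n : ℕ) → (B : Space.{u}) → (B ⟶ fib X f n) → Prop
  | 0, _, r => IsIso r
  | n + 1, B, r => ∃ (B' : Space.{u}) (r' : B' ⟶ fib X f n),
      IsAlgebraicSpace B' ∧ IsIteratedBlowup f Y D n B' r' ∧
      ∃ b : B ⟶ prodA2 B' (r' ≫ fib.coord f n (Fin.last n)),
        IsBlowup b (Closeds.closure
          (Pts.map (prodA2.toFib r' ≫ fib.fst f (n + 1)) ⁻¹' (Y \ D) ∩ zeros (prodA2.snd _))) ∧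
        b ≫ prodA2.toFib r' = r

/-- The restriction of `r : B ⟶ X ×_{𝔸¹} 𝔸ⁿ⁺¹` over a subset `V` of `|X|`. -/
def restrictOver {X B : Space.{u}} {f : X ⟶ A1} {n : ℕ} (r : B ⟶ fib X f n) (V : Set (Pts X)) :
    (subspaceOn (Pts.map (r ≫ fib.fst f n) ⁻¹' V)).toFunctor ⟶
      fib (subspaceOn V).toFunctor ((subspaceOn V).ι ≫ f) n where
  app T := ↾fun b => ⟨⟨(r.app T b.1).pt, b.2⟩, (r.app T b.1).coord, (r.app T b.1).eq⟩
  naturality S T g := by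
    refine ConcreteCategory.hom_ext _ _ fun b => ?_
    have h := NatTrans.naturality_apply r g b.1
    exact FibPt.ext (Subtype.ext (congrArg FibPt.pt h :)) (congrArg FibPt.coord h :)

/-- The `T`-valued points of the torus `G[n]`: tuples `(σ₁, …, σₙ₊₁)` of units with product `1`. -/
def torus (n : ℕ) (T : Scheme.{u}) : Subgroup (Fin (n + 1) → Γ(T, ⊤)ˣ) where
  carrier := {σ | ∏ i, σ i = 1}
  mul_mem' {a b} ha hb := by
    simp only [Set.mem_ofPred_eq] at ha hb ⊢
    simp [Finset.prod_mul_distrib, ha, hb]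
  one_mem' := by simp
  inv_mem' {a} ha := by
    simp only [Set.mem_ofPred_eq] at ha ⊢
    simp [ha]

/-- Pullback of points of the torus. -/
def torus.map {n : ℕ} {S T : Scheme.{u}} (g : S ⟶ T) (σ : torus n T) : torus n S :=
  ⟨fun i => Units.map (pullFn g).toMonoidHom (σ.1 i), by
    have h : ∏ i, σ.1 i = 1 := σ.2
    change ∏ i, Units.map (pullFn g).toMonoidHom (σ.1 i) = 1
    rw [← map_prod, h, map_one]⟩

/-- The automorphism `(σ₁, …, σₙ₊₁) ↦ (σₙ₊₁, …, σ₁)` of the torus. -/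
def torus.reverse {n : ℕ} {T : Scheme.{u}} (σ : torus n T) : torus n T :=
  ⟨fun i => σ.1 i.rev, by
    have h : ∏ i, σ.1 i = 1 := σ.2
    change ∏ i, σ.1 (Fin.revPerm i) = 1
    rw [Equiv.prod_comp Fin.revPerm σ.1, h]⟩

/-- The natural action of the torus on `X ×_{𝔸¹} 𝔸ⁿ⁺¹`, trivial on `X`. -/
def fib.smul {X : Space.{u}} {f : X ⟶ A1} {n : ℕ} {T : Scheme.{u}} (σ : torus n T)
    (p : (fib X f n).obj (op T)) : (fib X f n).obj (op T) :=
  ⟨p.pt, fun i => (σ.1 i : Γ(T, ⊤)) * p.coord i, by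
    have h : ∏ i, σ.1 i = 1 := σ.2
    have h' : ∏ i, (σ.1 i : Γ(T, ⊤)) = 1 := by rw [← Units.coe_prod, h, Units.val_one]
    change fnAt f p.pt = ∏ i, (σ.1 i : Γ(T, ⊤)) * p.coord i
    rw [Finset.prod_mul_distrib, h', one_mul]
    exact p.eq⟩

/-- The involution of `X ×_{𝔸¹} 𝔸ⁿ⁺¹` which reverses the coordinates `(t₁, …, tₙ₊₁)`. -/
def fib.reverse (X : Space.{u}) (f : X ⟶ A1) (n : ℕ) : fib X f n ⟶ fib X f n where
  app T := ↾fun p => ⟨p.pt, fun i => p.coord i.rev, by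
    have h := p.eq
    rw [← Equiv.prod_comp Fin.revPerm] at h
    exact h⟩
  naturality _ _ _ := rfl

/-- An action of the torus `G[n]` on `B`, that is, compatible actions on `T`-valued points. -/
structure TorusAction (n : ℕ) (B : Space.{u}) where
  act : ∀ {T : Scheme.{u}}, torus n T → B.obj (op T) → B.obj (op T)
  one_act : ∀ {T : Scheme.{u}} (b : B.obj (op T)), act 1 b = b
  mul_act : ∀ {T : Scheme.{u}} (σ τ : torus n T) (b : B.obj (op T)),
    act (σ * τ) b = act σ (act τ b)
  map_act : ∀ {S T : Scheme.{u}} (g : S ⟶ T) (σ : torus n T) (b : B.obj (op T)),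
    B.map g.op (act σ b) = act (torus.map g σ) (B.map g.op b)

/-- The base `C[n] = C ×_{𝔸¹} 𝔸ⁿ⁺¹`. -/
abbrev base {C : Scheme.{u}} (t : Γ(C, ⊤)) (n : ℕ) : Space.{u} := fib (yoneda.obj C) (fnOf t) n

/-- The expanded degeneration `X[n]` associated with an orientation of the dual graph: an
algebraic space with a morphism to `X ×_C C[n] = X ×_{𝔸¹} 𝔸ⁿ⁺¹` which, on the neighbourhood
of each component `D` of the singular locus of the central fibre, is the iterated blow-up of the
basic case, `Y` being the source of the arrow `[D]`, and which is an isomorphism away from the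
singular locus of the central fibre; together with the action of `G[n]` for which this morphism
is equivariant. These data are unique up to unique isomorphism. -/
structure ExpandedDegeneration {k : Type u} [Field k] {C : Scheme.{u}} [C.Over (Spec (.of k))]
    {c₀ : C} {X : Space.{u}} {π : X ⟶ yoneda.obj C} (t : Γ(C, ⊤)) (o : Orientation k c₀ π)
    (n : ℕ) where
  space : Space.{u}
  res : space ⟶ fib X (π ≫ fnOf t) n
  isAlgebraicSpace : IsAlgebraicSpace space
  isIteratedBlowup : ∀ D : Edge k c₀ π,
    IsIteratedBlowup ((subspaceOn (o.nbhd D)).ι ≫ π ≫ fnOf t)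
      (Pts.map (subspaceOn (o.nbhd D)).ι ⁻¹' (o.src D).1)
      (Pts.map (subspaceOn (o.nbhd D)).ι ⁻¹' D.1) n _ (restrictOver res (o.nbhd D))
  isIso_away : IsIso (restrictOver res (singularLocus k c₀ π)ᶜ)
  action : TorusAction n space
  res_act : ∀ {T : Scheme.{u}} (σ : torus n T) (b : space.obj (op T)),
    res.app _ (action.act σ b) = fib.smul σ (res.app _ b)

/-- The structure morphism `X[n] ⟶ C[n]`. -/
def ExpandedDegeneration.toBase {k : Type u} [Field k] {C : Scheme.{u}} [C.Over (Spec (.of k))]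
    {c₀ : C} {X : Space.{u}} {π : X ⟶ yoneda.obj C} {t : Γ(C, ⊤)} {o : Orientation k c₀ π}
    {n : ℕ} (E : ExpandedDegeneration t o n) : E.space ⟶ base t n :=
  E.res ≫ fib.map π (fnOf t) n

end ExpDeg

end

open ExpDeg

/-! ### Smooth and étale algebras over reduced rings and normal domains. -/

section

open TensorProduct

/-! Near a component `D` of the singular locus, `t ∘ π` is a product `x y`, where `x` and `y` are
reduced equations of the source and the target of the arrow. There `X[n]` is described by `n + 1`
local models. With the coordinates numbered from `0` to `n`, the `k`-th one is given by the
equations `x = a ∏_{i > k} t_i`, `y = b ∏_{i < k} t_i`, `t_k = a b`. Interchanging `x` with `y` and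
`a` with `b` while reversing the order of the `t_i` turns the `k`-th system into the `(n - k)`-th
one (`ModelEqns.reverse`). Reversing an arrow interchanges `x` and `y`, so it has the same effect as
reversing the coordinates.

That the models describe the iterated blow-up is proved by induction on the level
(`HasModels.step`). Splitting the last coordinate as `t_n = u v` leaves the charts `k < n`
unchanged, and the blow-up of `(x, v)` replaces the last chart by two. The induction carries two
facts along: the coordinates `t_i` are regular, and `(x, t_n)` is a radical ideal modulo which `y`
is regular. The second fact identifies the centre, a closure, with the subscheme `x = v = 0`.

The factorization `x y` comes from the normal crossings condition. Smoothness of the singular locus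
excludes triple points (`CrossingChart.noTriple`), so the neighbourhoods of the components `D` are
open and cover the singular locus. Away from the singular locus one of `x`, `y` may be taken to be a
unit, and both expanded degenerations fit the models there too (`exists_hasModels`).

The local isomorphisms glue because a section of `X[n]` whose coordinates are regular is determined
by its image in `X ×_{𝔸¹} 𝔸ⁿ⁺¹` (`OppositeModels.ext`), and étale charts have regular coordinates
(`OppositeModels.isRegularFn_coord`). So lifts of the coordinate reversal are unique on étale charts
and define a morphism; the one built in the other direction is its inverse. Equivariance follows
from the same uniqueness, after writing a point of the torus and a point of `X[n]` as pullbacks from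
a scheme flat over an étale chart.

The next lemma holds because modulo each prime of `R` a nonconstant polynomial is transcendental, so
the higher coefficients of `p` lie in every prime. -/

theorem Polynomial.eq_C_of_isIntegral {R : Type*} [CommRing R] [IsReduced R] {p : Polynomial R}
    (hp : IsIntegral R p) : p = Polynomial.C (p.coeff 0) := by
  ext n
  rcases n with _ | n
  · simp
  rw [Polynomial.coeff_C_succ]
  refine (IsReduced.eq_zero _ ((mem_nilradical).1 ?_))
  rw [nilradical_eq_sInf]
  refine Ideal.mem_sInf.2 fun {q} hq => ?_
  have : q.IsPrime := hq
  rw [← Ideal.Quotient.eq_zero_iff_mem]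
  have h1 : IsIntegral (R ⧸ q) (p.map (Ideal.Quotient.mk q)) :=
    hp.map_of_comp_eq (Ideal.Quotient.mk q) (Polynomial.mapRingHom (Ideal.Quotient.mk q)) (by
      ext; simp)
  have h2 : (p.map (Ideal.Quotient.mk q)).natDegree = 0 := by
    by_contra h
    refine Polynomial.transcendental _ h (mem_nonZeroDivisors_of_ne_zero ?_) h1.isAlgebraic
    intro h0
    simp [Polynomial.leadingCoeff_eq_zero.1 h0] at h
  have h3 := Polynomial.coeff_eq_zero_of_natDegree_lt (p := p.map (Ideal.Quotient.mk q))
    (n := n + 1) (by omega)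
  simpa using h3

/-- A nilpotent `s` makes `s X` integral over `S`. Integral closure commutes with smooth base
change, and the integral closure of the reduced ring `R` in `R[X]` consists of constants, so the
linear coefficient `s` of `s X` vanishes. -/
theorem Algebra.Smooth.isReduced_of_isReduced (R S : Type*) [CommRing R] [CommRing S]
    [Algebra R S] [Algebra.Smooth R S] [IsReduced R] : IsReduced S := by
  refine ⟨fun s hs => ?_⟩
  have h1 : IsIntegral S (s ⊗ₜ[R] (Polynomial.X : Polynomial R)) := by
    obtain ⟨n, hn⟩ := hs
    refine ⟨Polynomial.X ^ (n + 1), Polynomial.monic_X_pow _, ?_⟩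
    simp [Algebra.TensorProduct.tmul_pow, pow_succ, hn]
  obtain ⟨z, hz⟩ := (TensorProduct.toIntegralClosure_bijective_of_smooth (R := R) (S := S)
    (B := Polynomial R)).2 ⟨_, h1⟩
  have hz' : Algebra.TensorProduct.map (.id S S) (integralClosure R (Polynomial R)).val z =
      s ⊗ₜ[R] (Polynomial.X : Polynomial R) := congrArg Subtype.val hz
  have key : ∀ z : S ⊗[R] integralClosure R (Polynomial R),
      ((polyEquivTensor R S).symm (Algebra.TensorProduct.map (.id S S)
        (integralClosure R (Polynomial R)).val z)).coeff 1 = 0 := by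
    intro z
    induction z with
    | zero => simp
    | add x y hx hy => simp [hx, hy]
    | tmul x y =>
      have := Polynomial.eq_C_of_isIntegral y.2
      simp only [Algebra.TensorProduct.map_tmul, AlgHom.coe_id, id_eq, Subalgebra.coe_val]
      rw [this, polyEquivTensor_symm_apply_tmul_eq_smul]
      simp
  have := key z
  rw [hz', polyEquivTensor_symm_apply_tmul_eq_smul] at this
  simpa using this

theorem Ideal.IsRadical.map_of_smooth {R S : Type*} [CommRing R] [CommRing S]
    [Algebra R S] [Algebra.Smooth R S] {I : Ideal R} (hI : I.IsRadical) :
    (I.map (algebraMap R S)).IsRadical := by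
  have : IsReduced (R ⧸ I) := (Ideal.isRadical_iff_quotient_reduced I).1 hI
  rw [Ideal.isRadical_iff_quotient_reduced]
  have h : IsReduced ((R ⧸ I) ⊗[R] S) := Algebra.Smooth.isReduced_of_isReduced (R ⧸ I) _
  have e := (Algebra.TensorProduct.quotIdealMapEquivQuotTensor S I)
  exact isReduced_of_injective e e.injective

/-- A local ring of an étale algebra over a normal domain is a domain. -/
theorem Algebra.Etale.exists_notMem_mul_eq_zero {R S : Type u} [CommRing R] [CommRing S]
    [Algebra R S] [Algebra.Etale R S] [IsDomain R] [IsIntegrallyClosed R] (p : Ideal S) [p.IsPrime]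
    {a b : S} (hab : a * b = 0) : ∃ s ∉ p, s * a = 0 ∨ s * b = 0 := by
  let K := FractionRing R
  have hS : IsReduced (K ⊗[R] S) := Algebra.Smooth.isReduced_of_isReduced K _
  have : IsReduced (S ⊗[R] K) := isReduced_of_injective _ (Algebra.TensorProduct.comm R S K).injective
  have : Module.Finite K (K ⊗[R] S) := Algebra.FormallyUnramified.finite_of_free K _
  have : IsArtinianRing (K ⊗[R] S) := IsArtinianRing.of_finite K _
  have hinj : Function.Injective (algebraMap S (S ⊗[R] K)) := by
    have := Module.Flat.lTensor_preserves_injective_linearMap (M := S)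
      (Algebra.linearMap R K) (IsFractionRing.injective R K)
    intro x y hxy
    have h2 := @this (x ⊗ₜ 1) (y ⊗ₜ 1) (by
      rw [LinearMap.lTensor_tmul, LinearMap.lTensor_tmul, Algebra.linearMap_apply, map_one]
      exact hxy)
    simpa using congrArg (_root_.TensorProduct.rid R S) h2
  -- `S ⊗ K` is finite and reduced over the field `K`, hence a product of fields, so every element
  -- is a multiple of its square.
  have hreg : ∀ a : S ⊗[R] K, ∃ c, a = a * a * c := by
    intro a
    let e := (Algebra.TensorProduct.comm R S K).toRingEquiv.trans
      (IsArtinianRing.equivPi (K ⊗[R] S)).toRingEquiv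
    let (m : MaximalSpectrum (K ⊗[R] S)) : Field ((K ⊗[R] S) ⧸ m.asIdeal) := Ideal.Quotient.field _
    refine ⟨e.symm (fun m => (e a m)⁻¹), e.injective ?_⟩
    rw [map_mul, map_mul, e.apply_symm_apply]
    funext m
    simp only [Pi.mul_apply]
    rw [mul_assoc]
    by_cases h : e a m = 0
    · rw [h]; simp
    · rw [mul_inv_cancel₀ h, mul_one]
  obtain ⟨c, hc⟩ := hreg (algebraMap S _ a)
  -- `e` is the idempotent generating the ideal of `a`. It is integral over `S`, and since `R` is
  -- integrally closed in `K`, smooth base change for integral closures shows that it comes from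
  -- `S`.
  set e := algebraMap S _ a * c with he
  have hee : e * e = e := by rw [he]; linear_combination - c * hc
  have hint : IsIntegral S e := ⟨Polynomial.X ^ 2 - Polynomial.X, by monicity!, by
    simp [pow_two, hee]⟩
  obtain ⟨z, hz⟩ := (TensorProduct.toIntegralClosure_bijective_of_smooth (R := R) (S := S)
    (B := K)).2 ⟨_, hint⟩
  have hz' : Algebra.TensorProduct.map (.id S S) (integralClosure R K).val z = e :=
    congrArg Subtype.val hz
  have key : ∀ z : S ⊗[R] integralClosure R K, ∃ s : S,
      Algebra.TensorProduct.map (.id S S) (integralClosure R K).val z = algebraMap S _ s := by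
    intro z
    induction z with
    | zero => exact ⟨0, by simp⟩
    | add x y hx hy =>
      obtain ⟨s, hs⟩ := hx
      obtain ⟨t, ht⟩ := hy
      exact ⟨s + t, by simp [hs, ht, TensorProduct.add_tmul]⟩
    | tmul x y =>
      obtain ⟨r, hr⟩ := IsIntegrallyClosed.isIntegral_iff.1 y.2
      refine ⟨r • x, ?_⟩
      rw [Algebra.TensorProduct.algebraMap_apply, Algebra.TensorProduct.map_tmul]
      change x ⊗ₜ[R] (y : K) = (r • x) ⊗ₜ[R] (1 : K)
      rw [TensorProduct.smul_tmul, ← hr]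
      exact congrArg _ (Algebra.algebraMap_eq_smul_one r)
  obtain ⟨s, hs⟩ := key z
  rw [hz'] at hs
  have h1 : s * b = 0 := hinj (by
    rw [map_mul, ← hs, he, map_zero, mul_right_comm, ← map_mul, hab]; simp)
  have h2 : (1 - s) * a = 0 := hinj (by
    rw [map_mul, map_sub, ← hs, he, map_zero, map_one]; linear_combination hc)
  by_cases hsp : s ∈ p
  · refine ⟨1 - s, fun h => ?_, Or.inl h2⟩
    exact (Ideal.ne_top_iff_one p).1 (Ideal.IsPrime.ne_top ‹_›) (by simpa using add_mem h hsp)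
  · exact ⟨s, hsp, Or.inr h1⟩

end

/-! ### Splitting one element into a product of two: regular elements and radical ideals. -/

noncomputable section

open TensorProduct


/-! ### The ring `A[u, v] / (u v - c)` -/

/-- The ring `A[u, v] / (u v - c)`. -/
def SplitRing (A : Type u) [CommRing A] (c : A) : Type u :=
  Polynomial (Polynomial A) ⧸ Ideal.span {Polynomial.C Polynomial.X * Polynomial.X -
    Polynomial.C (Polynomial.C c)}

instance (A : Type u) [CommRing A] (c : A) : CommRing (SplitRing A c) :=
  Ideal.Quotient.commRing _

namespace SplitRing

open Polynomial

variable {A : Type u} [CommRing A] (c : A)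

/-- The projection from the polynomial ring. -/
def mk : Polynomial (Polynomial A) →+* SplitRing A c := Ideal.Quotient.mk _

theorem mk_surjective : Function.Surjective (mk c) := Ideal.Quotient.mk_surjective

theorem mk_eq_zero {p : Polynomial (Polynomial A)} :
    mk c p = 0 ↔ C X * X - C (C c) ∣ p := by
  rw [← Ideal.mem_span_singleton]
  exact Ideal.Quotient.eq_zero_iff_mem

/-- The inclusion of the coefficients. -/
def incl : A →+* SplitRing A c := (mk c).comp (C.comp C)

/-- The first coordinate. -/
def fst : SplitRing A c := mk c (C X)

/-- The second coordinate. -/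
def snd : SplitRing A c := mk c X

theorem fst_mul_snd : fst c * snd c = incl c c := by
  rw [← sub_eq_zero, fst, snd, incl, RingHom.comp_apply, ← map_mul, ← map_sub, mk_eq_zero]
  rfl

variable {c}

section lift

variable {B : Type*} [CommRing B] (f : A →+* B) (u v : B) (h : u * v = f c)

/-- The universal property. -/
def lift : SplitRing A c →+* B :=
  Ideal.Quotient.lift _ (eval₂RingHom (eval₂RingHom f u) v) (by
    intro p hp
    obtain ⟨q, rfl⟩ := Ideal.mem_span_singleton.1 hp
    simp [h])

theorem lift_mk (p : A[X][X]) :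
    lift f u v h (mk c p) = eval₂ (eval₂RingHom f u) v p := rfl

@[simp] theorem lift_incl (a : A) : lift f u v h (incl c a) = f a := by
  simp [incl, lift_mk]

@[simp] theorem lift_fst : lift f u v h (fst c) = u := by
  simp [fst, lift_mk]

@[simp] theorem lift_snd : lift f u v h (snd c) = v := by
  simp [snd, lift_mk]

end lift

theorem hom_ext {B : Type*} [CommRing B] {f g : SplitRing A c →+* B}
    (h : ∀ a, f (incl c a) = g (incl c a)) (hu : f (fst c) = g (fst c))
    (hv : f (snd c) = g (snd c)) : f = g := by
  refine Ideal.Quotient.ringHom_ext (Polynomial.ringHom_ext' (Polynomial.ringHom_ext' ?_ ?_) ?_)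
  · exact RingHom.ext h
  · exact hu
  · exact hv

/-- Interchanging the coordinates. -/
def swap : SplitRing A c →+* SplitRing A c :=
  lift (incl c) (snd c) (fst c) (by rw [mul_comm, fst_mul_snd])

theorem swap_swap (g : SplitRing A c) : swap (swap g) = g := by
  have : (swap (c := c)).comp swap = RingHom.id _ := hom_ext (by simp [swap]) (by simp [swap])
    (by simp [swap])
  exact congrArg (fun f => f g) this

/-- If `v g = (u v - c) h` in `A[u][v]`, comparing constant terms in `v` gives `c h(0) = 0`. So `v`
divides `h` and can be cancelled. -/
theorem snd_mem_nonZeroDivisors (hc : c ∈ nonZeroDivisors A) :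
    snd c ∈ nonZeroDivisors (SplitRing A c) := by
  rw [mem_nonZeroDivisors_iff_right]
  intro g hg
  obtain ⟨g, rfl⟩ := mk_surjective c g
  rw [snd, ← map_mul, mk_eq_zero] at hg
  obtain ⟨h, hh⟩ := hg
  have h0 := congrArg (fun p => coeff p 0) hh
  simp only [mul_coeff_zero, coeff_sub, coeff_X_zero, mul_zero, coeff_C_zero, zero_sub] at h0
  have h0' : C c * coeff h 0 = 0 := by
    simpa using h0.symm
  have h1 : coeff h 0 = 0 := by
    ext i
    have := congrArg (fun p => coeff p i) h0'
    simp only [coeff_C_mul, coeff_zero] at this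
    rw [mul_comm] at this
    exact (mem_nonZeroDivisors_iff_right.1 hc) _ this
  obtain ⟨h', rfl⟩ := X_dvd_iff.2 h1
  rw [mk_eq_zero]
  refine ⟨h', ?_⟩
  have : X * g = X * ((C X * X - C (C c)) * h') := by rw [mul_comm, hh]; ring
  exact (isRegular_X.left this :)

theorem fst_mem_nonZeroDivisors (hc : c ∈ nonZeroDivisors A) :
    fst c ∈ nonZeroDivisors (SplitRing A c) := by
  rw [mem_nonZeroDivisors_iff_right]
  intro g hg
  have h1 : swap g * snd c = 0 := by
    have := congrArg swap hg
    rw [map_mul, map_zero] at this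
    simpa [swap] using this
  have h2 := mem_nonZeroDivisors_iff_right.1 (snd_mem_nonZeroDivisors hc) _ h1
  rw [← swap_swap g, h2, map_zero]

/-- The polynomials in the second coordinate. -/
def poly : A[X] →+* SplitRing A c := eval₂RingHom (incl c) (snd c)

/-- The map `u ↦ c T⁻¹`, `v ↦ T` to Laurent polynomials restricts to the inclusion on `A[v]`,
whatever `c` is. -/
theorem poly_eq_zero {p : A[X]} (hp : poly (c := c) p = 0) : p = 0 := by
  let ψ : SplitRing A c →+* LaurentPolynomial A :=
    lift LaurentPolynomial.C (LaurentPolynomial.C c * LaurentPolynomial.T (-1))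
      (LaurentPolynomial.T 1) (by rw [mul_assoc, ← LaurentPolynomial.T_add]; simp)
  have h : ψ.comp poly = (toLaurent : A[X] →+* _) := by
    refine Polynomial.ringHom_ext' ?_ ?_
    · ext a : 1
      simp [ψ, poly, toLaurent_C]
    · simp [ψ, poly, toLaurent_X]
  have h2 := congrArg (fun f => f p) h
  simp only [RingHom.comp_apply, hp, map_zero] at h2
  exact toLaurent_injective (by rw [← h2, map_zero])

theorem induction_on {P : SplitRing A c → Prop} (g : SplitRing A c)
    (h0 : ∀ a, P (incl c a)) (hadd : ∀ a b, P a → P b → P (a + b))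
    (hu : ∀ g, P g → P (fst c * g)) (hv : ∀ g, P g → P (snd c * g)) : P g := by
  obtain ⟨g, rfl⟩ := mk_surjective c g
  have hadd' : ∀ p q : A[X][X], P (mk c p) → P (mk c q) →
      P (mk c (p + q)) := fun p q hp hq => by rw [map_add]; exact hadd _ _ hp hq
  induction g using Polynomial.induction_on with
  | C p =>
    induction p using Polynomial.induction_on with
    | C a => exact h0 a
    | add p q hp hq => rw [C_add]; exact hadd' _ _ hp hq
    | monomial n a h =>
      have : (C (C a * X ^ (n + 1)) : A[X][X]) = C X * C (C a * X ^ n) := by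
        rw [← C_mul]; ring_nf
      rw [this, map_mul]
      exact hu _ h
  | add p q hp hq => exact hadd' _ _ hp hq
  | monomial n a h =>
    have : (C a * X ^ (n + 1) : A[X][X]) = X * (C a * X ^ n) := by ring
    rw [this, map_mul]
    exact hv _ h

/-- Once `v` is inverted, `u = c / v` is redundant. For regular `v` this reduces questions about
zero divisors and nilpotents to `A[v]`. -/
theorem exists_pow_mul_eq_poly (g : SplitRing A c) : ∃ (N : ℕ) (p : A[X]),
    snd c ^ N * g = poly p := by
  induction g using induction_on with
  | h0 a => exact ⟨0, C a, by simp [poly]⟩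
  | hadd a b ha hb =>
    obtain ⟨N, p, hp⟩ := ha
    obtain ⟨M, q, hq⟩ := hb
    refine ⟨N + M, X ^ M * p + X ^ N * q, ?_⟩
    rw [map_add, map_mul, map_mul, ← hp, ← hq]
    simp only [poly, coe_eval₂RingHom, eval₂_X_pow]
    ring
  | hu g h =>
    obtain ⟨N, p, hp⟩ := h
    refine ⟨N + 1, C c * p, ?_⟩
    rw [map_mul, ← hp]
    simp only [poly, coe_eval₂RingHom, eval₂_C, ← fst_mul_snd]
    ring
  | hv g h =>
    obtain ⟨N, p, hp⟩ := h
    refine ⟨N, X * p, ?_⟩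
    rw [map_mul, ← hp]
    simp only [poly, coe_eval₂RingHom, eval₂_X]
    ring

theorem eq_zero_of_pow_mul (hc : c ∈ nonZeroDivisors A) {g : SplitRing A c} {N : ℕ}
    (h : snd c ^ N * g = 0) : g = 0 := by
  rw [mul_comm] at h
  exact mem_nonZeroDivisors_iff_right.1 (pow_mem (snd_mem_nonZeroDivisors hc) N) _ h

theorem incl_mem_nonZeroDivisors (hc : c ∈ nonZeroDivisors A) {d : A}
    (hd : d ∈ nonZeroDivisors A) : incl c d ∈ nonZeroDivisors (SplitRing A c) := by
  rw [mem_nonZeroDivisors_iff_right]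
  intro g hg
  obtain ⟨N, p, hp⟩ := exists_pow_mul_eq_poly g
  have h1 : poly (c := c) (C d * p) = 0 := by
    rw [map_mul, ← hp]
    have : poly (C d) = incl c d := by simp [poly]
    rw [this]
    linear_combination snd c ^ N * hg
  have h2 := poly_eq_zero h1
  refine eq_zero_of_pow_mul (N := N) hc ?_
  rw [hp]
  suffices p = 0 by rw [this, map_zero]
  ext i
  have := congrArg (fun p => coeff p i) h2
  simp only [coeff_C_mul, coeff_zero] at this
  rw [mul_comm] at this
  exact (mem_nonZeroDivisors_iff_right.1 hd) _ this

theorem isReduced (hc : c ∈ nonZeroDivisors A) [IsReduced A] : IsReduced (SplitRing A c) := by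
  refine ⟨fun g ⟨m, hm⟩ => ?_⟩
  obtain ⟨N, p, hp⟩ := exists_pow_mul_eq_poly g
  refine eq_zero_of_pow_mul (N := N) hc ?_
  rw [hp]
  have : IsReduced A[X] := ⟨fun p hp => by
    ext i
    exact ((Polynomial.isNilpotent_iff.1 hp) i).eq_zero⟩
  have h1 : p ^ m = 0 := poly_eq_zero (c := c) (by rw [map_pow, ← hp, mul_pow, hm, mul_zero])
  rw [eq_zero_of_pow_eq_zero h1, map_zero]

end SplitRing

/-- `I` is a radical ideal and `y` is not a zero divisor modulo `I`. -/
def Ideal.RadicalRegular {A : Type*} [CommRing A] (I : Ideal A) (y : A) : Prop :=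
  I.IsRadical ∧ ∀ g, y * g ∈ I → g ∈ I

namespace SplitRing

open Polynomial

variable {A : Type u} [CommRing A] {c : A}

/-- `A[u, v] / (u v - c, J, v) = (A / J)[u]` if `c ∈ J`. -/
theorem radicalRegular_sup_snd {J : Ideal A} (hc : c ∈ J) {y : A} (hJ : J.RadicalRegular y) :
    (J.map (incl c) ⊔ Ideal.span {snd c}).RadicalRegular (incl c y) := by
  have : IsReduced (A ⧸ J) := (Ideal.isRadical_iff_quotient_reduced J).1 hJ.1
  have : IsReduced (A ⧸ J)[X] := ⟨fun p hp => by
    ext i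
    exact ((Polynomial.isNilpotent_iff.1 hp) i).eq_zero⟩
  let ψ : SplitRing A c →+* (A ⧸ J)[X] := lift (C.comp (Ideal.Quotient.mk J)) X 0 (by
    simp [Ideal.Quotient.eq_zero_iff_mem.2 hc])
  have hψ : RingHom.ker ψ = J.map (incl c) ⊔ Ideal.span {snd c} := by
    apply le_antisymm
    · intro g hg
      -- Modulo `v` every element is a polynomial in `u`.
      have key : ∃ p : A[X], g - eval₂ (incl c) (fst c) p ∈ Ideal.span {snd c} := by
        clear hg
        induction g using induction_on with
        | h0 a => exact ⟨C a, by simp⟩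
        | hadd a b ha hb =>
          obtain ⟨p, hp⟩ := ha
          obtain ⟨q, hq⟩ := hb
          refine ⟨p + q, ?_⟩
          rw [eval₂_add, add_sub_add_comm]
          exact add_mem hp hq
        | hu g h =>
          obtain ⟨p, hp⟩ := h
          refine ⟨X * p, ?_⟩
          rw [eval₂_mul, eval₂_X, ← mul_sub]
          exact Ideal.mul_mem_left _ _ hp
        | hv g h => exact ⟨0, by simpa using Ideal.mul_mem_right _ _ (Ideal.mem_span_singleton_self _)⟩
      obtain ⟨p, hp⟩ := key
      obtain ⟨q, hq⟩ := Ideal.mem_span_singleton.1 hp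
      have h1 : ψ (eval₂ (incl c) (fst c) p) = 0 := by
        have := congrArg ψ hq
        rw [map_sub, hg, map_mul] at this
        simpa [ψ] using this
      have h2 : p.map (Ideal.Quotient.mk J) = 0 := by
        rw [← h1, hom_eval₂]
        have e1 : ψ.comp (incl c) = C.comp (Ideal.Quotient.mk J) := by ext; simp [ψ]
        rw [e1, show ψ (fst c) = X by simp [ψ]]
        rfl
      have h3 : eval₂ (incl c) (fst c) p ∈ J.map (incl c) := by
        rw [eval₂_eq_sum, Polynomial.sum]
        refine sum_mem fun i _ => Ideal.mul_mem_right _ _ (Ideal.mem_map_of_mem _ ?_)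
        rw [← Ideal.Quotient.eq_zero_iff_mem, ← coeff_map, h2, coeff_zero]
      rw [← sub_add_cancel g (eval₂ (incl c) (fst c) p), add_comm]
      exact add_mem (Ideal.mem_sup_left h3) (Ideal.mem_sup_right hp)
    · refine sup_le (Ideal.map_le_iff_le_comap.2 fun a ha => ?_) ?_
      · simp [RingHom.mem_ker, ψ, Ideal.Quotient.eq_zero_iff_mem.2 ha]
      · rw [Ideal.span_singleton_le_iff_mem]
        simp [RingHom.mem_ker, ψ]
  rw [← hψ]
  refine ⟨?_, fun g hg => ?_⟩
  · rw [RingHom.ker_eq_comap_bot]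
    refine Ideal.IsRadical.comap _ ?_
    rw [Ideal.isRadical_iff_quotient_reduced]
    exact isReduced_of_injective (RingEquiv.quotientBot _) (RingEquiv.quotientBot _).injective
  · rw [RingHom.mem_ker, map_mul] at hg
    rw [RingHom.mem_ker]
    have e : ψ (incl c y) = C (Ideal.Quotient.mk J y) := by simp [ψ]
    rw [e] at hg
    ext i
    have := congrArg (fun p => coeff p i) hg
    simp only [coeff_C_mul, coeff_zero] at this
    obtain ⟨z, hz⟩ := Ideal.Quotient.mk_surjective (coeff (ψ g) i)
    rw [← hz, ← map_mul, Ideal.Quotient.eq_zero_iff_mem] at this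
    rw [← hz, coeff_zero, Ideal.Quotient.eq_zero_iff_mem]
    exact hJ.2 _ this

/-- The quotient by `J` is the ring of the same form over `A / J`, where the image of `c` is still
regular. Reducedness and regularity of `y` are inherited from `A / J`. -/
theorem radicalRegular_map {J : Ideal A} {y : A} (hJ : J.RadicalRegular y)
    (hc : ∀ g, c * g ∈ J → g ∈ J) : (J.map (incl c)).RadicalRegular (incl c y) := by
  have : IsReduced (A ⧸ J) := (Ideal.isRadical_iff_quotient_reduced J).1 hJ.1
  have hreg : ∀ d : A, (∀ g, d * g ∈ J → g ∈ J) →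
      Ideal.Quotient.mk J d ∈ nonZeroDivisors (A ⧸ J) := by
    intro d hd
    rw [mem_nonZeroDivisors_iff_right]
    intro g hg
    obtain ⟨g, rfl⟩ := Ideal.Quotient.mk_surjective g
    rw [mul_comm, ← map_mul, Ideal.Quotient.eq_zero_iff_mem] at hg
    exact Ideal.Quotient.eq_zero_iff_mem.2 (hd _ hg)
  let c' := Ideal.Quotient.mk J c
  let ψ : SplitRing A c →+* SplitRing (A ⧸ J) c' :=
    lift ((incl c').comp (Ideal.Quotient.mk J)) (fst c') (snd c') (fst_mul_snd c')
  let χ : SplitRing (A ⧸ J) c' →+* SplitRing A c ⧸ J.map (incl c) :=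
    lift (Ideal.Quotient.lift J ((Ideal.Quotient.mk (J.map (incl c))).comp (incl c)) (fun a ha =>
      Ideal.Quotient.eq_zero_iff_mem.2 (Ideal.mem_map_of_mem _ ha)))
      (Ideal.Quotient.mk _ (fst c)) (Ideal.Quotient.mk _ (snd c)) (by
        rw [← map_mul, fst_mul_snd]; rfl)
  have hχ : χ.comp ψ = Ideal.Quotient.mk _ :=
    hom_ext (by simp [χ, ψ]) (by simp [χ, ψ]) (by simp [χ, ψ])
  have hψ : RingHom.ker ψ = J.map (incl c) := by
    apply le_antisymm
    · intro g hg
      rw [← Ideal.Quotient.eq_zero_iff_mem, ← hχ, RingHom.comp_apply, hg, map_zero]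
    · refine Ideal.map_le_iff_le_comap.2 fun a ha => ?_
      simp [RingHom.mem_ker, ψ, Ideal.Quotient.eq_zero_iff_mem.2 ha]
  have : IsReduced (SplitRing (A ⧸ J) c') := isReduced (hreg c hc)
  rw [← hψ]
  refine ⟨?_, fun g hg => ?_⟩
  · rw [RingHom.ker_eq_comap_bot]
    refine Ideal.IsRadical.comap _ ?_
    rw [Ideal.isRadical_iff_quotient_reduced]
    exact isReduced_of_injective (RingEquiv.quotientBot _) (RingEquiv.quotientBot _).injective
  · rw [RingHom.mem_ker, map_mul, mul_comm] at hg
    have e : ψ (incl c y) = incl c' (Ideal.Quotient.mk J y) := by simp [ψ]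
    rw [e] at hg
    exact mem_nonZeroDivisors_iff_right.1 (incl_mem_nonZeroDivisors (hreg c hc) (hreg y hJ.2)) _ hg

end SplitRing

end

/-! ### Equations of the charts and the rings representing them. -/

noncomputable section

/-- Replace the last coordinate by two coordinates. -/
def splitLast {S : Type*} {n : ℕ} (t : Fin (n + 1) → S) (u v : S) : Fin (n + 2) → S :=
  Fin.snoc (α := fun _ => S) (Fin.snoc (α := fun _ => S) (Fin.init t) u) v

@[simp] theorem splitLast_last {S : Type*} {n : ℕ} (t : Fin (n + 1) → S) (u v : S) :
    splitLast t u v (Fin.last _) = v := by simp [splitLast]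

@[simp] theorem splitLast_castSucc_last {S : Type*} {n : ℕ} (t : Fin (n + 1) → S) (u v : S) :
    splitLast t u v (Fin.last n).castSucc = u := by simp [splitLast]

@[simp] theorem splitLast_castSucc_castSucc {S : Type*} {n : ℕ} (t : Fin (n + 1) → S) (u v : S)
    (i : Fin n) : splitLast t u v i.castSucc.castSucc = t i.castSucc := by
  simp [splitLast, Fin.init]

theorem forall_fin_add_two {n : ℕ} {P : Fin (n + 2) → Prop} (h1 : P (Fin.last _))
    (h2 : P (Fin.last n).castSucc) (h3 : ∀ i : Fin n, P i.castSucc.castSucc) : ∀ i, P i :=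
  Fin.lastCases h1 (Fin.lastCases h2 h3)

theorem map_splitLast {S S' : Type*} [CommRing S] [CommRing S'] {n : ℕ} (f : S →+* S') (t : Fin (n + 1) → S) (u v : S)
    (i : Fin (n + 2)) :
    f (splitLast t u v i) = splitLast (fun i => f (t i)) (f u) (f v) i := by
  revert i
  exact forall_fin_add_two (by simp) (by simp) (by simp)

/-- The equations of the `k`-th chart of the expanded degeneration. -/
structure ModelEqns {O : Type*} [CommRing O] {n : ℕ} (x y : O) (k : ℕ) (t : Fin (n + 1) → O)
    (a b : O) : Prop where
  left : x = a * ∏ i : Fin (n + 1), if k < i.val then t i else 1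
  right : y = b * ∏ i : Fin (n + 1), if i.val < k then t i else 1
  mid : ∀ i : Fin (n + 1), i.val = k → t i = a * b

namespace ModelEqns

variable {O : Type*} [CommRing O] {n : ℕ} {x y a b : O} {k : ℕ}

theorem map {O' : Type*} [CommRing O'] (f : O →+* O') {t : Fin (n + 1) → O}
    (h : ModelEqns x y k t a b) : ModelEqns (f x) (f y) k (fun i => f (t i)) (f a) (f b) where
  left := by rw [h.left, map_mul, map_prod]; simp [apply_ite f]
  right := by rw [h.right, map_mul, map_prod]; simp [apply_ite f]
  mid i hi := by rw [h.mid i hi, map_mul]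

theorem mul_eq {t : Fin (n + 1) → O} (hk : k ≤ n) (h : ModelEqns x y k t a b) :
    x * y = ∏ i, t i := by
  have e : ∀ i : Fin (n + 1), t i = (if k < i.val then t i else 1) *
      (if i.val < k then t i else 1) * (if i = ⟨k, by omega⟩ then t i else 1) := by
    intro i
    rcases lt_trichotomy i.val k with h | h | h
    · simp [h, h.not_gt, Fin.ext_iff, h.ne]
    · simp [h, Fin.ext_iff]
    · simp [h, h.not_gt, Fin.ext_iff, h.ne']
  rw [Finset.prod_congr rfl fun i _ => e i, Finset.prod_mul_distrib, Finset.prod_mul_distrib,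
    Finset.prod_ite_eq', if_pos (Finset.mem_univ _), h.mid ⟨k, by omega⟩ rfl]
  conv_lhs => rw [h.left, h.right]
  ring

/-- This symmetry is the whole reason for the theorem: the two products exchange their roles, and
index `k` becomes `n - k`. -/
theorem reverse {t : Fin (n + 1) → O} (hk : k ≤ n) (h : ModelEqns x y k t a b) :
    ModelEqns y x (n - k) (fun i => t i.rev) b a where
  left := by
    rw [h.right, ← Equiv.prod_comp Fin.revPerm]
    congr 1
    refine Finset.prod_congr rfl fun i _ => ?_
    have := i.isLt
    simp only [Fin.revPerm_apply, Fin.val_rev]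
    refine if_congr ?_ rfl rfl
    omega
  right := by
    rw [h.left, ← Equiv.prod_comp Fin.revPerm]
    congr 1
    refine Finset.prod_congr rfl fun i _ => ?_
    have := i.isLt
    simp only [Fin.revPerm_apply, Fin.val_rev]
    refine if_congr ?_ rfl rfl
    omega
  mid i hi := by
    rw [h.mid i.rev (by rw [Fin.val_rev]; omega), mul_comm]

/-- For `k < n` the last coordinate enters only through the product in the equation of `x`, so
replacing it by two factors changes nothing. -/
theorem splitLast_iff_of_lt {t : Fin (n + 1) → O} {u v : O} (huv : u * v = t (Fin.last n))
    (hk : k < n) : ModelEqns x y k (splitLast t u v) a b ↔ ModelEqns x y k t a b := by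
  have e1 : (∏ i : Fin (n + 2), if k < i.val then splitLast t u v i else 1) =
      ∏ i : Fin (n + 1), if k < i.val then t i else 1 := by
    rw [Fin.prod_univ_castSucc, Fin.prod_univ_castSucc, Fin.prod_univ_castSucc]
    simp [hk, hk.trans (Nat.lt_succ_self n), mul_assoc, huv]
  have e2 : (∏ i : Fin (n + 2), if i.val < k then splitLast t u v i else 1) =
      ∏ i : Fin (n + 1), if i.val < k then t i else 1 := by
    rw [Fin.prod_univ_castSucc, Fin.prod_univ_castSucc, Fin.prod_univ_castSucc]
    simp [hk.not_gt, (hk.trans (Nat.lt_succ_self n)).not_gt]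
  constructor
  · rintro ⟨h1, h2, h3⟩
    refine ⟨by rw [h1, e1], by rw [h2, e2], fun i hi => ?_⟩
    have := h3 i.castSucc (by simpa using hi)
    revert this hi
    refine Fin.lastCases (fun hi => ?_) (fun i _ h => ?_) i
    · simp at hi; omega
    · simpa using h
  · rintro ⟨h1, h2, h3⟩
    refine ⟨by rw [e1, h1], by rw [e2, h2], forall_fin_add_two ?_ ?_ fun i hi => ?_⟩
    · intro h; simp at h; omega
    · intro h; simp at h; omega
    · rw [splitLast_castSucc_castSucc]
      exact h3 _ (by simpa using hi)

/-- On the last chart `t_n = a b`. In this half of its blow-up the old `a` becomes divisible by `v`.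
-/
theorem splitLast_low_iff {t : Fin (n + 1) → O} {u v : O} (huv : u * v = t (Fin.last n)) :
    ModelEqns x y n (splitLast t u v) a b ↔ u = a * b ∧ ModelEqns x y n t (a * v) b := by
  have e1 : (∏ i : Fin (n + 2), if n < i.val then splitLast t u v i else 1) = v := by
    rw [Fin.prod_univ_castSucc, Fin.prod_univ_castSucc]
    simp [fun i : Fin n => i.isLt.not_gt]
  have e1' : (∏ i : Fin (n + 1), if n < i.val then t i else 1) = 1 := by
    refine Finset.prod_eq_one fun i _ => if_neg ?_
    have := i.isLt
    omega
  have e2 : (∏ i : Fin (n + 2), if i.val < n then splitLast t u v i else 1) =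
      ∏ i : Fin (n + 1), if i.val < n then t i else 1 := by
    rw [Fin.prod_univ_castSucc, Fin.prod_univ_castSucc, Fin.prod_univ_castSucc]
    simp
  constructor
  · rintro ⟨h1, h2, h3⟩
    have h4 : u = a * b := by simpa using h3 (Fin.last n).castSucc (by simp)
    refine ⟨h4, by rw [h1, e1, e1', mul_one], by rw [h2, e2], fun i hi => ?_⟩
    obtain rfl : i = Fin.last n := Fin.ext hi
    rw [← huv, h4]; ring
  · rintro ⟨h4, h1, h2, h3⟩
    refine ⟨by rw [e1, h1, e1', mul_one], by rw [e2, h2], forall_fin_add_two ?_ ?_ fun i hi => ?_⟩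
    · intro h; simp at h
    · intro h; simpa using h4
    · have := i.isLt; simp at hi; omega

/-- In the other half it is the old `b` that becomes divisible, by `u`. -/
theorem splitLast_high_iff {t : Fin (n + 1) → O} {u v : O} (huv : u * v = t (Fin.last n)) :
    ModelEqns x y (n + 1) (splitLast t u v) a b ↔ v = a * b ∧ ModelEqns x y n t a (u * b) := by
  have e1 : (∏ i : Fin (n + 2), if n + 1 < i.val then splitLast t u v i else 1) = 1 := by
    refine Finset.prod_eq_one fun i _ => if_neg ?_
    have := i.isLt
    omega
  have e1' : (∏ i : Fin (n + 1), if n < i.val then t i else 1) = 1 := by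
    refine Finset.prod_eq_one fun i _ => if_neg ?_
    have := i.isLt
    omega
  have e2 : (∏ i : Fin (n + 2), if i.val < n + 1 then splitLast t u v i else 1) =
      (∏ i : Fin (n + 1), if i.val < n then t i else 1) * u := by
    rw [Fin.prod_univ_castSucc, Fin.prod_univ_castSucc, Fin.prod_univ_castSucc]
    simp [fun i : Fin n => i.isLt.trans (Nat.lt_succ_self n)]
  constructor
  · rintro ⟨h1, h2, h3⟩
    have h4 : v = a * b := by simpa using h3 (Fin.last (n + 1)) (by simp)
    refine ⟨h4, by rw [h1, e1, e1'], by rw [h2, e2]; ring, fun i hi => ?_⟩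
    obtain rfl : i = Fin.last n := Fin.ext hi
    rw [← huv, h4]; ring
  · rintro ⟨h4, h1, h2, h3⟩
    refine ⟨by rw [e1, h1, e1'], by rw [e2, h2]; ring, forall_fin_add_two ?_ ?_ fun i hi => ?_⟩
    · intro h; simpa using h4
    · intro h; simp at h
    · have := i.isLt; simp at hi; omega

end ModelEqns

/-- The ring `S`, with coordinates `t`, `a`, `b`, is the coordinate ring of the `k`-th chart of the
expanded degeneration of `x y`. -/
structure IsModel {R S : Type u} [CommRing R] [CommRing S] (x y : R) (n k : ℕ) (str : R →+* S)
    (t : Fin (n + 1) → S) (a b : S) : Prop where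
  le : k ≤ n
  eqns : ModelEqns (str x) (str y) k t a b
  t_mem : ∀ i, t i ∈ nonZeroDivisors S
  radicalRegular : (Ideal.span {str x, t (Fin.last n)}).RadicalRegular (str y)
  exists_hom : ∀ {O : Type u} [CommRing O] (f : R →+* O) (t' : Fin (n + 1) → O) (a' b' : O),
    ModelEqns (f x) (f y) k t' a' b' → ∃ g : S →+* O, (∀ r, g (str r) = f r) ∧
      (∀ i, g (t i) = t' i) ∧ g a = a' ∧ g b = b'

/-- The pair `(x, v)` generates a locally principal ideal for one of the two obvious reasons, with
a generator which is not a zero divisor. -/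
def CartierPair {O : Type*} [CommRing O] (x v : O) : Prop :=
  (v ∈ nonZeroDivisors O ∧ v ∣ x) ∨ (x ∈ nonZeroDivisors O ∧ x ∣ v)

theorem exists_eq_splitLast {O : Type*} [CommRing O] {n : ℕ} (t : Fin (n + 2) → O) :
    ∃ s : Fin (n + 1) → O, t (Fin.last n).castSucc * t (Fin.last _) = s (Fin.last n) ∧
      t = splitLast s (t (Fin.last n).castSucc) (t (Fin.last _)) := by
  refine ⟨Fin.snoc (α := fun _ => O) (Fin.init (Fin.init t))
        (t (Fin.last n).castSucc * t (Fin.last _)), by simp, ?_⟩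
  refine funext (forall_fin_add_two ?_ ?_ ?_) <;> simp [Fin.init]

/-- The ideal generated by a local equation and the last coordinate, after adjoining a
factorization of the last coordinate. -/
theorem radicalRegular_split {A : Type*} [CommRing A] {x y c d : A} (hc : c ∈ Ideal.span {x, d})
    (hd : ∃ e, d = c * e)
    (h : (Ideal.span {x, d}).RadicalRegular y) :
    (Ideal.span {SplitRing.incl c x, SplitRing.snd c}).RadicalRegular (SplitRing.incl c y) := by
  convert SplitRing.radicalRegular_sup_snd hc h using 1
  simp only [Ideal.map_span, Set.image_pair]
  rw [← Ideal.span_union]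
  apply le_antisymm
  · refine Ideal.span_mono ?_
    rintro z (rfl | rfl) <;> simp
  · rw [Ideal.span_le]
    rintro z ((rfl | rfl) | rfl)
    · exact Ideal.subset_span (by simp)
    · obtain ⟨e, rfl⟩ := hd
      rw [map_mul, ← SplitRing.fst_mul_snd]
      exact Ideal.mul_mem_right _ _ (Ideal.mul_mem_left _ _ (Ideal.subset_span (by simp)))
    · exact Ideal.subset_span (by simp)

namespace IsModel

variable {R S : Type u} [CommRing R] [CommRing S] {x y : R} {n k : ℕ} {str : R →+* S}
  {t : Fin (n + 1) → S} {a b : S}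

/-- At level zero nothing is blown up: the chart is `R` with `a = x` and `b = y`, and `(x, x y) =
(x)`. -/
theorem zero (hxy : x * y ∈ nonZeroDivisors R) (hx : (Ideal.span {x}).RadicalRegular y) :
    IsModel x y 0 0 (RingHom.id R) (fun _ => x * y) x y where
  le := le_rfl
  eqns := ⟨by simp, by simp, by simp⟩
  t_mem _ := hxy
  radicalRegular := by
    convert hx using 1
    swap
    · rfl
    apply le_antisymm
    · rw [Ideal.span_le]
      rintro z (rfl | rfl)
      · exact Ideal.mem_span_singleton_self _
      · exact Ideal.mul_mem_right _ _ (Ideal.mem_span_singleton_self _)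
    · exact Ideal.span_mono (by simp)
  exists_hom f t' a b h := by
    have h1 : f x = a := by simpa using h.left
    have h2 : f y = b := by simpa using h.right
    refine ⟨f, fun r => rfl, fun i => ?_, h1, h2⟩
    rw [h.mid i (by omega), map_mul, h1, h2]

theorem str_eq (h : IsModel x y n n str t a b) : str x = a := by
  rw [h.eqns.left, Finset.prod_eq_one, mul_one]
  exact fun i _ => if_neg (by have := i.isLt; omega)

theorem last_eq (h : IsModel x y n n str t a b) : t (Fin.last n) = a * b :=
  h.eqns.mid (Fin.last n) rfl

theorem a_mem (h : IsModel x y n n str t a b) : a ∈ nonZeroDivisors S := by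
  have := h.t_mem (Fin.last n)
  rw [h.last_eq, mul_mem_nonZeroDivisors] at this
  exact this.1

theorem b_mem (h : IsModel x y n n str t a b) : b ∈ nonZeroDivisors S := by
  have := h.t_mem (Fin.last n)
  rw [h.last_eq, mul_mem_nonZeroDivisors] at this
  exact this.2

theorem last_dvd (h : IsModel x y n k str t a b) (hk : k < n) : t (Fin.last n) ∣ str x := by
  rw [h.eqns.left, Fin.prod_univ_castSucc]
  exact Dvd.dvd.mul_left (Dvd.dvd.mul_left (by simp [hk]) _) _

/-- The refinement of a chart which is not the last one. -/
theorem stepMid (h : IsModel x y n k str t a b) (hk : k < n) :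
    IsModel x y (n + 1) k ((SplitRing.incl (t (Fin.last n))).comp str)
      (splitLast (fun i => SplitRing.incl (t (Fin.last n)) (t i)) (SplitRing.fst _)
        (SplitRing.snd _)) (SplitRing.incl _ a) (SplitRing.incl _ b) where
  le := by omega
  eqns := by
    refine (ModelEqns.splitLast_iff_of_lt ?_ hk).2 (h.eqns.map (SplitRing.incl (t (Fin.last n))))
    exact SplitRing.fst_mul_snd (t (Fin.last n))
  t_mem := by
    have hc := h.t_mem (Fin.last n)
    refine forall_fin_add_two ?_ ?_ fun i => ?_
    · simpa using SplitRing.snd_mem_nonZeroDivisors hc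
    · simpa using SplitRing.fst_mem_nonZeroDivisors hc
    · simpa using SplitRing.incl_mem_nonZeroDivisors hc (h.t_mem _)
  radicalRegular := by
    simpa using radicalRegular_split (Ideal.subset_span (by simp)) ⟨1, by simp⟩ h.radicalRegular
  exists_hom f t' a' b' h' := by
    obtain ⟨s, huv, hs⟩ := exists_eq_splitLast t'
    rw [hs] at h' ⊢
    rw [ModelEqns.splitLast_iff_of_lt huv hk] at h'
    obtain ⟨g, h1, h2, h3, h4⟩ := h.exists_hom f _ _ _ h'
    refine ⟨SplitRing.lift g _ _ (huv.trans (h2 _).symm), fun r => ?_, fun i => ?_, ?_, ?_⟩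
    · simp [h1]
    · rw [map_splitLast]
      simp [h2]
    · simp [h3]
    · simp [h4]

/-- The first refinement of the last chart. -/
theorem stepLow (h : IsModel x y n n str t a b) :
    IsModel x y (n + 1) n ((SplitRing.incl a).comp str)
      (splitLast (fun i => SplitRing.incl a (t i)) (SplitRing.fst _ * SplitRing.incl _ b)
        (SplitRing.snd _))
      (SplitRing.fst _) (SplitRing.incl _ b) where
  le := by omega
  eqns := by
    refine (ModelEqns.splitLast_low_iff ?_).2 ⟨rfl, ?_⟩
    · rw [h.last_eq, map_mul, ← SplitRing.fst_mul_snd]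
      ring
    · rw [SplitRing.fst_mul_snd]
      exact h.eqns.map (SplitRing.incl a)
  t_mem := by
    refine forall_fin_add_two ?_ ?_ fun i => ?_
    · simpa using SplitRing.snd_mem_nonZeroDivisors h.a_mem
    · rw [splitLast_castSucc_last]
      exact mul_mem (SplitRing.fst_mem_nonZeroDivisors h.a_mem)
        (SplitRing.incl_mem_nonZeroDivisors h.a_mem h.b_mem)
    · simpa using SplitRing.incl_mem_nonZeroDivisors h.a_mem (h.t_mem _)
  -- The element being split is `a = x`; it lies in `(x, t_n)` and divides `t_n = a b`.
  radicalRegular := by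
    simpa using radicalRegular_split (c := a) (Ideal.subset_span (by simp [h.str_eq]))
      ⟨b, h.last_eq⟩ h.radicalRegular
  exists_hom f t' a' b' h' := by
    obtain ⟨s, huv, hs⟩ := exists_eq_splitLast t'
    rw [hs] at h' ⊢
    rw [ModelEqns.splitLast_low_iff huv] at h'
    obtain ⟨g, h1, h2, h3, h4⟩ := h.exists_hom f _ _ _ h'.2
    refine ⟨SplitRing.lift g _ _ h3.symm, fun r => ?_, fun i => ?_, ?_, ?_⟩
    · simp [h1]
    · rw [map_splitLast]
      simp [h2, h4, h'.1]
    · simp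
    · simp [h4]

/-- The second refinement of the last chart. -/
theorem stepHigh (h : IsModel x y n n str t a b) :
    IsModel x y (n + 1) (n + 1) ((SplitRing.incl b).comp str)
      (splitLast (fun i => SplitRing.incl b (t i)) (SplitRing.fst _)
        (SplitRing.incl _ a * SplitRing.snd _))
      (SplitRing.incl _ a) (SplitRing.snd _) where
  le := le_rfl
  eqns := by
    refine (ModelEqns.splitLast_high_iff ?_).2 ⟨rfl, ?_⟩
    · rw [h.last_eq, map_mul, ← SplitRing.fst_mul_snd]
      ring
    · rw [SplitRing.fst_mul_snd]
      exact h.eqns.map (SplitRing.incl b)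
  t_mem := by
    refine forall_fin_add_two ?_ ?_ fun i => ?_
    · rw [splitLast_last]
      exact mul_mem (SplitRing.incl_mem_nonZeroDivisors h.b_mem h.a_mem)
        (SplitRing.snd_mem_nonZeroDivisors h.b_mem)
    · simpa using SplitRing.fst_mem_nonZeroDivisors h.b_mem
    · simpa using SplitRing.incl_mem_nonZeroDivisors h.b_mem (h.t_mem _)
  radicalRegular := by
    -- `b` is regular modulo `(x, t_n)` because `y` is a multiple of it. Both `t_n = a b` and the
    -- new last coordinate `a v` are multiples of `x = a`, so the old and the new ideal are
    -- generated by `x`.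
    have := SplitRing.radicalRegular_map (c := b) h.radicalRegular (by
      intro g hg
      refine h.radicalRegular.2 g ?_
      rw [h.eqns.right, mul_right_comm]
      exact Ideal.mul_mem_right _ _ hg)
    convert this using 1
    swap
    · rfl
    simp only [splitLast_last, Ideal.map_span, Set.image_pair, RingHom.comp_apply]
    apply le_antisymm
    · rw [Ideal.span_le]
      rintro z (rfl | rfl)
      · exact Ideal.subset_span (by simp)
      · rw [← h.str_eq]
        exact Ideal.mul_mem_right _ _ (Ideal.subset_span (by simp))
    · rw [Ideal.span_le]
      rintro z (rfl | rfl)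
      · exact Ideal.subset_span (by simp)
      · rw [h.last_eq, ← h.str_eq, map_mul]
        exact Ideal.mul_mem_right _ _ (Ideal.subset_span (by simp))
  exists_hom f t' a' b' h' := by
    obtain ⟨s, huv, hs⟩ := exists_eq_splitLast t'
    rw [hs] at h' ⊢
    rw [ModelEqns.splitLast_high_iff huv] at h'
    obtain ⟨g, h1, h2, h3, h4⟩ := h.exists_hom f _ _ _ h'.2
    refine ⟨SplitRing.lift g _ _ h4.symm, fun r => ?_, fun i => ?_, ?_, ?_⟩
    · simp [h1]
    · rw [map_splitLast]
      simp [h2, h3, h'.1]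
    · simp [h3]
    · simp

/-- Charts `k < n` persist from level `n` to level `n + 1`; the last one is replaced by two,
numbered `n` and `n + 1`. -/
theorem exists_model (hxy : x * y ∈ nonZeroDivisors R) (hx : (Ideal.span {x}).RadicalRegular y) :
    ∀ (n k : ℕ), k ≤ n → ∃ (S : Type u) (_ : CommRing S) (str : R →+* S) (t : Fin (n + 1) → S)
      (a b : S), IsModel x y n k str t a b := by
  intro n
  induction n with
  | zero =>
    rintro k hk
    obtain rfl : k = 0 := by omega
    exact ⟨_, _, _, _, _, _, zero hxy hx⟩
  | succ n ih =>
    intro k hk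
    rcases lt_trichotomy k n with h | rfl | h
    · obtain ⟨_, _, _, _, _, _, hS⟩ := ih k h.le
      exact ⟨_, _, _, _, _, _, hS.stepMid h⟩
    · obtain ⟨_, _, _, _, _, _, hS⟩ := ih k le_rfl
      exact ⟨_, _, _, _, _, _, hS.stepLow⟩
    · obtain rfl : k = n + 1 := by omega
      obtain ⟨_, _, _, _, _, _, hS⟩ := ih n le_rfl
      exact ⟨_, _, _, _, _, _, hS.stepHigh⟩

/-- The last coordinate divides `x` on all charts but the last, where `x = a` divides it. -/
theorem cartierPair {t : Fin (n + 2) → S} (h : IsModel x y (n + 1) k str t a b) :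
    CartierPair (str x) (t (Fin.last _)) := by
  rcases h.le.lt_or_eq with hk | rfl
  · exact Or.inl ⟨h.t_mem _, h.last_dvd hk⟩
  · exact Or.inr ⟨h.str_eq ▸ h.a_mem, h.str_eq ▸ ⟨b, h.last_eq⟩⟩

/-- Every chart of level `n + 1` lies over a chart of level `n`. -/
theorem exists_refinement {t : Fin (n + 2) → S} (h : IsModel x y (n + 1) k str t a b)
    (hxy : x * y ∈ nonZeroDivisors R) (hx : (Ideal.span {x}).RadicalRegular y) :
    ∃ (j : ℕ) (S₀ : Type u) (_ : CommRing S₀) (str₀ : R →+* S₀) (t₀ : Fin (n + 1) → S₀)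
      (a₀ b₀ : S₀) (g : S₀ →+* S), IsModel x y n j str₀ t₀ a₀ b₀ ∧ (∀ r, g (str₀ r) = str r) ∧
      t (Fin.last n).castSucc * t (Fin.last _) = g (t₀ (Fin.last n)) ∧
      t = splitLast (fun i => g (t₀ i)) (t (Fin.last n).castSucc) (t (Fin.last _)) := by
  obtain ⟨s, huv, hs⟩ := exists_eq_splitLast t
  have he := h.eqns
  rw [hs] at he
  -- The equations of level `n + 1` imply those of some chart of level `n`, whose universal property
  -- then provides the map.
  suffices ∃ j, j ≤ n ∧ ∃ a' b', ModelEqns (str x) (str y) j s a' b' by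
    obtain ⟨j, hj, a', b', h'⟩ := this
    obtain ⟨S₀, _, str₀, t₀, a₀, b₀, h₀⟩ := exists_model hxy hx n j hj
    obtain ⟨g, h1, h2, -⟩ := h₀.exists_hom str _ _ _ h'
    refine ⟨j, S₀, _, str₀, t₀, a₀, b₀, g, h₀, h1, by rw [h2, huv], ?_⟩
    rw [funext h2]
    exact hs
  rcases lt_trichotomy k n with hk | rfl | hk
  · exact ⟨k, hk.le, _, _, (ModelEqns.splitLast_iff_of_lt huv hk).1 he⟩
  · exact ⟨k, le_rfl, _, _, ((ModelEqns.splitLast_low_iff huv).1 he).2⟩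
  · obtain rfl : k = n + 1 := by have := h.le; omega
    exact ⟨n, le_rfl, _, _, ((ModelEqns.splitLast_high_iff huv).1 he).2⟩

/-- A point of a chart of level `n`, with a factorization of the last coordinate, comes from a
chart of level `n + 1` if the ideal of the centre of the blow-up becomes principal for an obvious
reason. -/
theorem exists_factorization (h : IsModel x y n k str t a b) {O : Type u} [CommRing O]
    (g : S →+* O) (u v : O) (huv : u * v = g (t (Fin.last n)))
    (hv : CartierPair (g (str x)) v) :
    ∃ (j : ℕ) (S' : Type u) (_ : CommRing S') (str' : R →+* S') (t' : Fin (n + 2) → S')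
      (a' b' : S') (ι : S →+* S') (u' v' : S') (g' : S' →+* O), IsModel x y (n + 1) j str' t' a' b' ∧
      t' = splitLast (fun i => ι (t i)) u' v' ∧ u' * v' = ι (t (Fin.last n)) ∧
      (∀ r, ι (str r) = str' r) ∧ (∀ s, g' (ι s) = g s) ∧ g' u' = u ∧ g' v' = v := by
  rcases h.le.lt_or_eq with hk | rfl
  · exact ⟨k, _, _, _, _, _, _, _, _, _, SplitRing.lift g u v huv, h.stepMid hk, rfl,
      SplitRing.fst_mul_snd _, by simp, by simp, by simp, by simp⟩
  have hl := h.last_eq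
  rw [h.str_eq] at hv
  rw [hl, map_mul] at huv
  -- On the last chart `x = a` and `u v = a b`. If `a = v a'`, cancelling `v` gives `u = a' b`, the
  -- first refinement; if `v = a c`, cancelling `a` gives `b = u c`, the second.
  rcases hv with ⟨h1, a', h2⟩ | ⟨h1, c, h2⟩
  · refine ⟨k, _, _, _, _, _, _, _, _, _, SplitRing.lift g a' v (by rw [h2, mul_comm]), h.stepLow,
      rfl, ?_, by simp, by simp, ?_, by simp⟩
    · rw [hl, map_mul, ← SplitRing.fst_mul_snd]; ring
    · simp only [map_mul, SplitRing.lift_fst, SplitRing.lift_incl]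
      refine (mul_cancel_right_mem_nonZeroDivisors h1).1 ?_
      rw [huv, h2]; ring
  · refine ⟨k + 1, _, _, _, _, _, _, _, _, _, SplitRing.lift g u c ?_, h.stepHigh,
      rfl, ?_, fun r => ?_, fun s => ?_, ?_, ?_⟩
    · refine (mul_cancel_left_mem_nonZeroDivisors h1).1 ?_
      rw [← huv, h2]; ring
    · rw [hl, map_mul, ← SplitRing.fst_mul_snd]; ring
    · simp
    · simp
    · simp
    · simp [h2]

end IsModel

end

/-! ### Descent of ideals and regular elements along flat ring maps. -/

noncomputable section

/-- Membership in an ideal may be tested after a flat extension, up to a denominator. -/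
theorem Ideal.exists_notMem_mul_mem_of_flat {R R' : Type*} [CommRing R] [CommRing R'] {φ : R →+* R'}
    (hφ : φ.Flat) {K : Ideal R} {a : R} (q : Ideal R') [q.IsPrime] {c : R'} (hc : c ∉ q)
    (ha : c * φ a ∈ K.map φ) :
    ∃ s ∉ q.comap φ, s * a ∈ K := by
  have hl := hφ.localRingHom (P := q) (Q := q.comap φ) rfl
  set ψ := Localization.localRingHom (q.comap φ) q φ rfl with hψ
  have : IsLocalHom ψ := Localization.isLocalHom_localRingHom _ _ _ _
  algebraize [ψ]
  have : Module.FaithfullyFlat (Localization.AtPrime (q.comap φ)) (Localization.AtPrime q) :=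
    Module.FaithfullyFlat.of_flat_of_isLocalHom
  have h1 : algebraMap R (Localization.AtPrime (q.comap φ)) a ∈ K.map (algebraMap R _) := by
    rw [← Ideal.comap_map_eq_self_of_faithfullyFlat (B := Localization.AtPrime q)
      (K.map (algebraMap R _)), Ideal.mem_comap, Ideal.map_map]
    have e : (algebraMap (Localization.AtPrime (q.comap φ)) (Localization.AtPrime q)).comp
        (algebraMap R _) = (algebraMap R' _).comp φ := by
      ext x
      exact Localization.localRingHom_to_map _ _ _ rfl x
    rw [e, ← Ideal.map_map]
    change ψ _ ∈ _
    rw [hψ, Localization.localRingHom_to_map]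
    have hu : IsUnit (algebraMap R' (Localization.AtPrime q) c) :=
      IsLocalization.map_units _ (⟨c, hc⟩ : q.primeCompl)
    rw [← Ideal.unit_mul_mem_iff_mem _ hu, ← map_mul]
    exact Ideal.mem_map_of_mem _ ha
  rw [IsLocalization.algebraMap_mem_map_algebraMap_iff (q.comap φ).primeCompl] at h1
  obtain ⟨m, hm, h⟩ := h1
  exact ⟨m, hm, h⟩

/-- The elements multiplying `a` into `K` form an ideal, and `g` lies in every prime containing it.
-/
theorem Ideal.exists_pow_mul_mem {R : Type*} [CommRing R] {K : Ideal R} {a g : R}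
    (h : ∀ (q : Ideal R) [q.IsPrime], g ∉ q → ∃ s ∉ q, s * a ∈ K) : ∃ N : ℕ, g ^ N * a ∈ K := by
  have : g ∈ Ideal.radical (Submodule.comap (LinearMap.mulRight R a) K) := by
    rw [Ideal.radical_eq_sInf, Ideal.mem_sInf]
    rintro q ⟨h1, h2⟩
    by_contra hg
    obtain ⟨s, hs, hsa⟩ := h q hg
    exact hs (h1 hsa)
  exact this

theorem Ideal.mem_of_forall_prime {R : Type*} [CommRing R] {K : Ideal R} {a : R}
    (h : ∀ (q : Ideal R) [q.IsPrime], ∃ s ∉ q, s * a ∈ K) : a ∈ K := by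
  obtain ⟨N, hN⟩ := Ideal.exists_pow_mul_mem (g := (1 : R)) fun q _ _ => h q
  simpa using hN

theorem RingHom.Flat.map_mem_nonZeroDivisors {R R' : Type*} [CommRing R] [CommRing R']
    {φ : R →+* R'} (hφ : φ.Flat) {r : R} (hr : r ∈ nonZeroDivisors R) :
    φ r ∈ nonZeroDivisors R' := by
  algebraize [φ]
  have := Module.Flat.isSMulRegular_of_nonZeroDivisors (M := R') hr
  rw [mem_nonZeroDivisors_iff_right]
  intro x hx
  refine this ?_
  simpa [Algebra.smul_def, RingHom.algebraMap_toAlgebra, mul_comm] using hx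

/-- Descent of principal ideals generated by a regular element along étale ring maps. -/
theorem Ideal.exists_principal_of_flat {R R' : Type*} [CommRing R] [CommRing R'] {φ : R →+* R'}
    (hφ : φ.Flat) (hfp : φ.FinitePresentation) {I : Ideal R} {s : R'} (hs : I.map φ = Ideal.span {s})
    (hs' : s ∈ nonZeroDivisors R') (q : Ideal R') [q.IsPrime] :
    ∃ i ∈ I, ∃ g ∉ q.comap φ, (∀ a ∈ I, ∃ N : ℕ, g ^ N * a ∈ Ideal.span {i}) ∧
      ∀ a, a * i = 0 → ∃ N : ℕ, g ^ N * a = 0 := by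
  -- Otherwise `φ` maps all of `I` into `s q`, hence `s ∈ s q`, and cancelling the regular element
  -- `s` gives `1 ∈ q`.
  obtain ⟨i, hi, c, hc, hic⟩ : ∃ i ∈ I, ∃ c ∉ q, φ i = s * c := by
    by_contra! h
    have h1 : ∀ i ∈ I, φ i ∈ Ideal.span {s} * q := by
      intro i hi
      have : φ i ∈ Ideal.span {s} := hs ▸ Ideal.mem_map_of_mem φ hi
      obtain ⟨c, hc⟩ := Ideal.mem_span_singleton'.1 this
      refine hc ▸ mul_comm s c ▸ Ideal.mul_mem_mul (Ideal.mem_span_singleton_self s) ?_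
      by_contra hcq
      exact h i hi c hcq (by rw [← hc, mul_comm])
    have h2 : s ∈ Ideal.span {s} * q :=
      (show I.map φ ≤ Ideal.span {s} * q from Ideal.map_le_iff_le_comap.2 h1) (hs ▸ Ideal.mem_span_singleton_self s)
    obtain ⟨c, hc, hcs⟩ := Ideal.mem_span_singleton_mul.1 h2
    have : (1 - c) * s = 0 := by rw [sub_mul, one_mul, mul_comm, hcs, sub_self]
    have := (mem_nonZeroDivisors_iff_right.1 hs') _ this
    rw [sub_eq_zero] at this
    exact Ideal.IsPrime.ne_top ‹_› ((Ideal.eq_top_iff_one q).2 (this ▸ hc))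
  algebraize [φ]
  have : Algebra.FinitePresentation R R' := hfp
  -- Flat maps of finite presentation are open, so `g` can be chosen such that every prime not
  -- containing `g` lifts to a prime not containing `c`.
  have hopen := PrimeSpectrum.isOpenMap_comap_of_hasGoingDown_of_finitePresentation (R := R) (S := R')
  obtain ⟨_, ⟨_, ⟨g, rfl⟩, rfl⟩, hgq, hg⟩ := (PrimeSpectrum.isBasis_basic_opens (R := R)).exists_subset_of_mem_open
    (show PrimeSpectrum.comap φ ⟨q, ‹_›⟩ ∈ PrimeSpectrum.comap φ '' (PrimeSpectrum.basicOpen c) from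
      ⟨_, (show ⟨q, ‹_›⟩ ∈ (PrimeSpectrum.basicOpen c : Set (PrimeSpectrum R')) from hc), rfl⟩)
    (hopen _ (PrimeSpectrum.basicOpen c).2)
  have key : ∀ (K : Ideal R) (a : R), (∃ m : ℕ, c ^ m * φ a ∈ K.map φ) → ∃ N : ℕ, g ^ N * a ∈ K := by
    rintro K a ⟨m, hm⟩
    refine Ideal.exists_pow_mul_mem fun p hp hgp => ?_
    obtain ⟨q', hq', hq'p⟩ := hg (show (⟨p, hp⟩ : PrimeSpectrum R) ∈ _ from hgp)
    have hcomap : q'.asIdeal.comap φ = p := congrArg PrimeSpectrum.asIdeal hq'p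
    obtain ⟨t, ht, h⟩ := Ideal.exists_notMem_mul_mem_of_flat hφ q'.asIdeal (c := c ^ m)
      (fun h => hq' (q'.2.mem_of_pow_mem _ h)) hm
    exact ⟨t, hcomap ▸ ht, h⟩
  refine ⟨i, hi, g, hgq, fun a ha => key _ _ ⟨1, ?_⟩, fun a ha => ?_⟩
  · have : φ a ∈ Ideal.span {s} := hs ▸ Ideal.mem_map_of_mem φ ha
    obtain ⟨d, hd⟩ := Ideal.mem_span_singleton'.1 this
    rw [Ideal.map_span, Set.image_singleton, hic, ← hd, Ideal.mem_span_singleton']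
    exact ⟨d, by ring⟩
  · refine (key ⊥ a ⟨1, ?_⟩).imp fun N h => by simpa using h
    have h1 : (c * φ a) * s = 0 := by
      rw [mul_comm c, mul_assoc, mul_comm c, ← hic, ← map_mul, ha, map_zero]
    simpa using (mem_nonZeroDivisors_iff_right.1 hs') _ h1

theorem Ideal.map_eq_span_of_pow_mul_mem {R S : Type*} [CommRing R] [CommRing S] [Algebra R S]
    (g : R) [IsLocalization.Away g S] {I : Ideal R} {i : R} (hi : i ∈ I)
    (h : ∀ a ∈ I, ∃ N : ℕ, g ^ N * a ∈ Ideal.span {i}) :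
    I.map (algebraMap R S) = Ideal.span {algebraMap R S i} := by
  apply le_antisymm
  · rw [Ideal.map_le_iff_le_comap]
    intro a ha
    obtain ⟨N, hN⟩ := h a ha
    have h6 := Ideal.mem_map_of_mem (algebraMap R S) hN
    rwa [map_mul, map_pow, Ideal.unit_mul_mem_iff_mem _
      ((IsLocalization.Away.algebraMap_isUnit g).pow N), Ideal.map_span, Set.image_singleton] at h6
  · rw [Ideal.span_singleton_le_iff_mem]
    exact Ideal.mem_map_of_mem _ hi

theorem IsLocalization.Away.mem_nonZeroDivisors {R S : Type*} [CommRing R] [CommRing S]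
    [Algebra R S] (g : R) [IsLocalization.Away g S] {i : R}
    (h : ∀ a, a * i = 0 → ∃ N : ℕ, g ^ N * a = 0) : algebraMap R S i ∈ nonZeroDivisors S := by
  rw [mem_nonZeroDivisors_iff_right]
  intro a ha
  obtain ⟨⟨b, t⟩, hb⟩ := IsLocalization.surj (Submonoid.powers g) a
  dsimp only at hb
  have h6 : algebraMap R S (b * i) = 0 := by
    rw [map_mul, ← hb, mul_right_comm, ha, zero_mul]
  rw [IsLocalization.map_eq_zero_iff (Submonoid.powers g)] at h6
  obtain ⟨⟨_, M, rfl⟩, hM⟩ := h6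
  obtain ⟨N', hN'⟩ := h (g ^ M * b) (by rw [mul_assoc]; exact hM)
  have h7 : algebraMap R S b = 0 := by
    rw [IsLocalization.map_eq_zero_iff (Submonoid.powers g)]
    exact ⟨⟨g ^ (N' + M), _, rfl⟩, by rw [← hN']; simp only [pow_add, mul_assoc]⟩
  rw [h7] at hb
  exact (IsLocalization.map_units _ t).mul_left_eq_zero.1 hb

end

/-! ### Pullback of ideal sheaves computed on affine opens. -/

noncomputable section

namespace AlgebraicGeometry.Scheme.IdealSheafData

/-- Pullback of ideal sheaves is left adjoint to pushforward, as extension of ideals is to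
contraction. On affine schemes the right adjoints agree, hence so do the left ones. -/
theorem ideal_comap_top {X Y : Scheme.{u}} [IsAffine X] [IsAffine Y] (J : Y.IdealSheafData)
    (f : X ⟶ Y) : (J.comap f).ideal ⟨⊤, isAffineOpen_top X⟩ =
      (J.ideal ⟨⊤, isAffineOpen_top Y⟩).map f.appTop.hom := by
  have key (K : X.IdealSheafData) : J.comap f ≤ K ↔
      (J.ideal ⟨⊤, isAffineOpen_top Y⟩).map f.appTop.hom ≤ K.ideal ⟨⊤, isAffineOpen_top X⟩ := by
    rw [← le_map_iff_comap_le, Ideal.map_le_iff_le_comap]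
    have := ideal_map_of_isAffineHom K f ⟨⊤, isAffineOpen_top Y⟩
    constructor
    · intro h
      exact (h _).trans this.le
    · intro h
      exact le_of_isAffine (h.trans this.ge)
  have key' (I : Ideal Γ(X, ⊤)) : (equivOfIsAffine (X := X)).symm I ≤ J.comap f ↔
    I ≤ (J.comap f).ideal ⟨⊤, isAffineOpen_top X⟩ := by
    rw [← equivOfIsAffine_apply]
    exact OrderIso.symm_apply_le (equivOfIsAffine (X := X)).toOrderIso
  apply le_antisymm
  · have := (key (equivOfIsAffine.symm ((J.ideal ⟨⊤, isAffineOpen_top Y⟩).map f.appTop.hom))).2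
      (by rw [← equivOfIsAffine_apply]; simp)
    rw [← equivOfIsAffine_apply]
    exact (OrderIso.le_symm_apply (equivOfIsAffine (X := X)).toOrderIso).1 this
  · exact (key _).1 le_rfl

theorem ideal_comap_ι {X : Scheme.{u}} (J : X.IdealSheafData) (U : X.affineOpens)
    (h : IsAffineOpen (⊤ : U.1.toScheme.Opens)) :
    (J.comap U.1.ι).ideal ⟨⊤, h⟩ = (J.ideal U).map (U.1.ι.appLE U.1 ⊤ (by simp)).hom := by
  rw [ideal_comap_of_isOpenImmersion, Scheme.Opens.ι_appIso, Scheme.Opens.ι_appLE,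
    ← J.map_ideal' (V := U) (eqToHom (by simp))]
  exact Ideal.comap_id _

theorem ideal_comap_top_of_le {X Y : Scheme.{u}} [IsAffine X] (J : Y.IdealSheafData)
    (f : X ⟶ Y) (U : Y.affineOpens) (hU : ⊤ ≤ f ⁻¹ᵁ U.1) :
    (J.comap f).ideal ⟨⊤, isAffineOpen_top X⟩ = (J.ideal U).map (f.appLE U.1 ⊤ hU).hom := by
  have : IsAffine U.1.toScheme := U.2
  have hr : Set.range f ⊆ Set.range U.1.ι := by
    rw [Scheme.Opens.range_ι]
    rintro _ ⟨x, rfl⟩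
    exact hU (show x ∈ (⊤ : X.Opens) from trivial)
  have h1 : IsOpenImmersion.lift U.1.ι f hr ≫ U.1.ι = f := IsOpenImmersion.lift_fac _ _ _
  generalize IsOpenImmersion.lift U.1.ι f hr = g at h1
  subst h1
  rw [comap_comp, ideal_comap_top, ideal_comap_ι, Ideal.map_map, ← CommRingCat.hom_comp]
  congr 2
  rw [← Scheme.Hom.appLE_comp_appLE g U.1.ι U.1 ⊤ ⊤ (by simp) (by simp)]
  congr 1
  exact ((Category.comp_id _).symm.trans (congrArg _ (X.presheaf.map_id _).symm))

theorem ideal_comap_of_le {X Y : Scheme.{u}} (J : Y.IdealSheafData)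
    (f : X ⟶ Y) (V : X.affineOpens) (U : Y.affineOpens) (hU : V.1 ≤ f ⁻¹ᵁ U.1) :
    (J.comap f).ideal V = (J.ideal U).map (f.appLE U.1 V.1 hU).hom := by
  have : IsAffine V.1.toScheme := V.2
  have h1 := ideal_comap_ι (J.comap f) V (isAffineOpen_top _)
  have hle : ⊤ ≤ (V.1.ι ≫ f) ⁻¹ᵁ U.1 := by
    rintro x -
    exact hU x.2
  rw [← comap_comp, ideal_comap_top_of_le J (V.1.ι ≫ f) U hle,
    ← Scheme.Hom.appLE_comp_appLE V.1.ι f U.1 V.1 ⊤ hU (by simp), CommRingCat.hom_comp,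
    ← Ideal.map_map] at h1
  have hle' : ⊤ ≤ V.1.ι ⁻¹ᵁ V.1 := by simp
  have : IsIso (V.1.ι.appLE V.1 ⊤ hle') := by
    rw [Scheme.Opens.ι_appLE]
    exact (X.presheaf.mapIso (eqToIso V.1.ι_image_top).op).isIso_hom
  have hb := ConcreteCategory.bijective_of_isIso (V.1.ι.appLE V.1 ⊤ hle')
  have := congrArg (Ideal.comap (V.1.ι.appLE V.1 ⊤ hle').hom) h1
  rw [Ideal.comap_map_of_bijective _ hb, Ideal.comap_map_of_bijective _ hb] at this
  exact this.symm

theorem exists_affine_le {X Y : Scheme.{u}} (f : X ⟶ Y) (p : X) {W : Y.Opens} (hW : f p ∈ W)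
    {W' : X.Opens} (hW' : p ∈ W') :
    ∃ (V : X.affineOpens) (U : Y.affineOpens), p ∈ V.1 ∧ V.1 ≤ W' ∧ U.1 ≤ W ∧ V.1 ≤ f ⁻¹ᵁ U.1 := by
  obtain ⟨_, ⟨U, hU, rfl⟩, hpU, hUW⟩ :=
    Y.isBasis_affineOpens.exists_subset_of_mem_open hW W.2
  obtain ⟨_, ⟨V, hV, rfl⟩, hpV, hVW⟩ :=
    X.isBasis_affineOpens.exists_subset_of_mem_open (show p ∈ W' ⊓ f ⁻¹ᵁ U from ⟨hW', hpU⟩)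
      (W' ⊓ f ⁻¹ᵁ U).2
  exact ⟨⟨V, hV⟩, ⟨U, hU⟩, hpV, fun x hx => (hVW hx).1, hUW, fun x hx => (hVW hx).2⟩

theorem le_of_exists_affine {X : Scheme.{u}} {I J : X.IdealSheafData}
    (h : ∀ p : X, ∃ V : X.affineOpens, p ∈ V.1 ∧ I.ideal V ≤ J.ideal V) : I ≤ J := by
  choose V hV hle using h
  exact le_of_iSup_eq_top V (top_le_iff.1 fun p _ => Opens.mem_iSup.2 ⟨p, hV p⟩) hle

theorem ofIdealTop_le {X : Scheme.{u}} {I : Ideal Γ(X, ⊤)} {J : X.IdealSheafData} :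
    ofIdealTop I ≤ J ↔ ∀ V : X.affineOpens,
      I ≤ (J.ideal V).comap (X.presheaf.map (homOfLE le_top).op).hom := by
  simp only [le_def, ofIdealTop_ideal, Ideal.map_le_iff_le_comap]

theorem comap_ofIdealTop {X Y : Scheme.{u}} (I : Ideal Γ(Y, ⊤)) (f : X ⟶ Y) :
    (ofIdealTop I).comap f = ofIdealTop (I.map f.appTop.hom) := by
  have (p : X) : ∃ V : X.affineOpens, p ∈ V.1 ∧
      ((ofIdealTop I).comap f).ideal V = (ofIdealTop (I.map f.appTop.hom)).ideal V := by
    obtain ⟨V, U, hp, -, -, h⟩ := exists_affine_le f p (W := ⊤) trivial (W' := ⊤) trivial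
    refine ⟨V, hp, ?_⟩
    rw [ideal_comap_of_le _ f V U h, ofIdealTop_ideal, ofIdealTop_ideal, Ideal.map_map,
      Ideal.map_map, ← CommRingCat.hom_comp, ← CommRingCat.hom_comp]
    congr 2
    exact (Scheme.Hom.map_appLE f h _).trans rfl
  choose V hV h using this
  exact ext_of_iSup_eq_top V (top_le_iff.1 fun p _ => Opens.mem_iSup.2 ⟨p, hV p⟩) h

/-- Pulling back the reduced ideal of a closed subset to an étale scheme. -/
theorem comap_vanishingIdeal {X Y : Scheme.{u}} (Z : Closeds Y) (f : X ⟶ Y) [Etale f] :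
    (vanishingIdeal Z).comap f = vanishingIdeal (Z.preimage f.continuous) := by
  have h1 : ((vanishingIdeal Z).comap f).support = Z.preimage f.continuous := by
    rw [support_comap]
    congr 1
  rw [← h1, vanishingIdeal_support]
  refine le_antisymm (le_radical _) (le_of_exists_affine fun p => ?_)
  obtain ⟨V, U, hp, -, -, h⟩ := exists_affine_le f p (W := ⊤) trivial (W' := ⊤) trivial
  refine ⟨V, hp, ?_⟩
  have het : RingHom.Etale (f.appLE U.1 V.1 h).hom :=
    HasRingHomProperty.appLE @Etale f ‹_› U V h
  algebraize [(f.appLE U.1 V.1 h).hom]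
  have hrad : ((vanishingIdeal Z).ideal U).IsRadical := by
    have : vanishingIdeal Z = (vanishingIdeal Z).radical := by
      rw [← vanishingIdeal_support]
      congr 1
    rw [this]
    exact Ideal.radical_isRadical _
  -- Radical ideals stay radical under étale maps. This makes reduced structures on closed subsets
  -- compatible between étale charts.
  have := Ideal.IsRadical.map_of_smooth (S := Γ(X, V.1)) hrad
  rw [radical_ideal, ideal_comap_of_le _ f V U h]
  exact this.radical.le

end AlgebraicGeometry.Scheme.IdealSheafData

end

/-! ### Étale-local properties of ideal sheaves and functions. -/

noncomputable section

namespace ExpDeg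

open Scheme.IdealSheafData

theorem flat_appLE {X Y : Scheme.{u}} (f : X ⟶ Y) [Flat f] (U : Y.affineOpens) (V : X.affineOpens)
    (h : V.1 ≤ f ⁻¹ᵁ U.1) : (f.appLE U.1 V.1 h).hom.Flat :=
  HasRingHomProperty.appLE @Flat f ‹_› U V h

/-- At each prime the inclusion is tested after a flat local map, which is faithfully flat, to a
local ring of an étale scheme. -/
theorem ideal_le_of_etale_local {X : Scheme.{u}} {I J : X.IdealSheafData}
    (h : ∀ p : X, ∃ (T : Scheme.{u}) (f : T ⟶ X) (q : T), Etale f ∧ f q = p ∧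
      I.comap f ≤ J.comap f) : I ≤ J := by
  intro U a ha
  refine Ideal.mem_of_forall_prime fun 𝔮 _ => ?_
  have hpU : U.2.fromSpec ⟨𝔮, ‹_›⟩ ∈ U.1 := by
    have : U.2.fromSpec ⟨𝔮, ‹_›⟩ ∈ Set.range U.2.fromSpec := ⟨_, rfl⟩
    rwa [U.2.range_fromSpec] at this
  obtain ⟨T, f, q, hf, hq, hle⟩ := h (U.2.fromSpec ⟨𝔮, ‹_›⟩)
  obtain ⟨_, ⟨V, hV, rfl⟩, hqV, hVU⟩ :=
    T.isBasis_affineOpens.exists_subset_of_mem_open (show f q ∈ U.1 by rw [hq]; exact hpU)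
      (f ⁻¹ᵁ U.1).2
  have h1 := hle ⟨V, hV⟩
  rw [ideal_comap_of_le I f ⟨V, hV⟩ U hVU, ideal_comap_of_le J f ⟨V, hV⟩ U hVU] at h1
  obtain ⟨s, hs, hsa⟩ := Ideal.exists_notMem_mul_mem_of_flat (flat_appLE f U ⟨V, hV⟩ hVU)
    (hV.primeIdealOf ⟨q, hqV⟩).asIdeal (c := 1) (K := J.ideal U) (a := a)
    (fun h => Ideal.IsPrime.ne_top inferInstance ((Ideal.eq_top_iff_one _).2 h))
    (by rw [one_mul]; exact h1 (Ideal.mem_map_of_mem _ ha))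
  refine ⟨s, ?_, hsa⟩
  have h2 := IsAffineOpen.comap_primeIdealOf_appLE U.1 U.2 V hV hVU hqV
  have h3 : U.2.primeIdealOf ⟨f q, hVU hqV⟩ = ⟨𝔮, ‹_›⟩ := by
    have := U.2.isOpenImmersion_fromSpec
    apply U.2.fromSpec.isOpenEmbedding.injective
    rw [U.2.fromSpec_primeIdealOf]
    exact hq
  rw [h3] at h2
  have h5 : (hV.primeIdealOf ⟨q, hqV⟩).asIdeal.comap (f.appLE U.1 V hVU).hom = 𝔮 :=
    congrArg PrimeSpectrum.asIdeal h2
  exact fun hs' => hs (h5.ge hs')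

theorem ideal_eq_of_etale_local {X : Scheme.{u}} {I J : X.IdealSheafData}
    (h : ∀ p : X, ∃ (T : Scheme.{u}) (f : T ⟶ X) (q : T), Etale f ∧ f q = p ∧
      I.comap f = J.comap f) : I = J :=
  le_antisymm
    (ideal_le_of_etale_local fun p => by obtain ⟨T, f, q, h1, h2, h3⟩ := h p; exact ⟨T, f, q, h1, h2, h3.le⟩)
    (ideal_le_of_etale_local fun p => by obtain ⟨T, f, q, h1, h2, h3⟩ := h p; exact ⟨T, f, q, h1, h2, h3.ge⟩)

/-- Being an effective Cartier divisor is étale local. -/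
theorem isCartier_of_etale_local {X : Scheme.{u}} {J : X.IdealSheafData}
    (h : ∀ p : X, ∃ (T : Scheme.{u}) (f : T ⟶ X) (q : T), Etale f ∧ f q = p ∧
      IsCartier (J.comap f)) : IsCartier J := by
  intro p
  obtain ⟨T, f, q, hf, rfl, hJ⟩ := h p
  obtain ⟨V₀, hqV₀, s, hs, hJs⟩ := hJ q
  obtain ⟨V, U, hqV, hVV₀, -, hVU⟩ := exists_affine_le f q (W := ⊤) trivial hqV₀
  have hsV : (J.comap f).ideal V = Ideal.span {T.presheaf.map (homOfLE hVV₀).op s} := by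
    rw [← map_ideal (U := V) (V := V₀) _ hVV₀, hJs, Ideal.map_span, Set.image_singleton]
    rfl
  have hs' : T.presheaf.map (homOfLE hVV₀).op s ∈ nonZeroDivisors Γ(T, V.1) := by
    have := (flat_appLE (𝟙 T) V₀ V hVV₀).map_mem_nonZeroDivisors hs
    rwa [show (𝟙 T : T ⟶ T).appLE V₀.1 V.1 hVV₀ = T.presheaf.map (homOfLE hVV₀).op from
      Category.id_comp _] at this
  rw [ideal_comap_of_le J f V U hVU] at hsV
  have hfp : (f.appLE U.1 V.1 hVU).hom.FinitePresentation :=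
    HasRingHomProperty.appLE @LocallyOfFinitePresentation f inferInstance U V hVU
  obtain ⟨i, hi, g, hg, h1, h2⟩ := Ideal.exists_principal_of_flat (flat_appLE f U V hVU) hfp hsV hs'
    (V.2.primeIdealOf ⟨q, hqV⟩).asIdeal
  have h3 := IsAffineOpen.comap_primeIdealOf_appLE U.1 U.2 V.1 V.2 hVU hqV
  have hpg : f q ∈ X.basicOpen g := by
    have h4 : g ∉ (U.2.primeIdealOf ⟨f q, hVU hqV⟩).asIdeal := h3 ▸ hg
    have h5 : U.2.primeIdealOf ⟨f q, hVU hqV⟩ ∈ U.2.fromSpec ⁻¹ᵁ X.basicOpen g := by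
      rw [U.2.fromSpec_preimage_basicOpen]
      exact h4
    have h6 : U.2.fromSpec (U.2.primeIdealOf ⟨f q, hVU hqV⟩) ∈ X.basicOpen g := h5
    rwa [U.2.fromSpec_primeIdealOf] at h6
  have hloc := U.2.isLocalization_basicOpen g
  have h7 : algebraMap Γ(X, U.1) Γ(X, X.basicOpen g) i ∈ nonZeroDivisors Γ(X, X.basicOpen g) :=
    IsLocalization.Away.mem_nonZeroDivisors g h2
  have h8 : (J.ideal U).map (algebraMap Γ(X, U.1) Γ(X, X.basicOpen g)) =
      Ideal.span {algebraMap Γ(X, U.1) Γ(X, X.basicOpen g) i} :=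
    Ideal.map_eq_span_of_pow_mul_mem g hi h1
  exact ⟨X.affineBasicOpen g, hpg, _, h7, (J.map_ideal_basicOpen U g).symm.trans h8⟩

theorem isCartier_ofIdealTop {T : Scheme.{u}} [IsAffine T] {c : Γ(T, ⊤)}
    (hc : c ∈ nonZeroDivisors Γ(T, ⊤)) : IsCartier (ofIdealTop (Ideal.span {c})) := by
  intro p
  refine ⟨⟨⊤, isAffineOpen_top T⟩, trivial, c, hc, ?_⟩
  simp

/-- A function whose germs are not zero divisors. -/
def IsRegularFn {T : Scheme.{u}} (s : Γ(T, ⊤)) : Prop :=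
  ∀ p : T, T.presheaf.germ ⊤ p trivial s ∈ nonZeroDivisors (T.presheaf.stalk p)

theorem stalkMap_germ {S T : Scheme.{u}} (f : S ⟶ T) (p : S) (s : Γ(T, ⊤)) :
    f.stalkMap p (T.presheaf.germ ⊤ (f p) trivial s) =
      S.presheaf.germ ⊤ p trivial (pullFn f s) :=
  Scheme.Hom.germ_stalkMap_apply f ⊤ p trivial s

theorem IsRegularFn.pullFn {S T : Scheme.{u}} (f : S ⟶ T) [Flat f] {s : Γ(T, ⊤)}
    (h : IsRegularFn s) : IsRegularFn (pullFn f s) := fun p => by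
  rw [← stalkMap_germ]
  exact (Flat.stalkMap f p).map_mem_nonZeroDivisors (h (f p))

theorem stalkMap_injective {S T : Scheme.{u}} (f : S ⟶ T) [Flat f] (p : S) :
    Function.Injective (f.stalkMap p).hom := by
  algebraize [(f.stalkMap p).hom]
  have : Module.FaithfullyFlat (T.presheaf.stalk (f p)) (S.presheaf.stalk p) :=
    @Module.FaithfullyFlat.of_flat_of_isLocalHom _ _ _ _ _ _ _
      (Flat.stalkMap f p) (f.toLRSHom.prop p)
  exact ‹RingHom.FaithfullyFlat _›.injective

/-- Flatness of the composite makes the stalk map of `b` injective, although `b` itself need not be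
flat. In the application `b` is a base change of a model chart, which is not known to be étale over
the blow-up. -/
theorem isRegularFn_of_flat_comp {T : Scheme.{u}} {s : Γ(T, ⊤)}
    (h : ∀ p : T, ∃ (S P : Scheme.{u}) (a : S ⟶ P) (b : P ⟶ T) (q : S), Flat (a ≫ b) ∧
      b (a q) = p ∧ IsRegularFn (ExpDeg.pullFn b s)) : IsRegularFn s := by
  intro p
  obtain ⟨S, P, a, b, q, hf, rfl, hs⟩ := h p
  have h1 : Function.Injective (b.stalkMap (a q)).hom := by
    have := stalkMap_injective (a ≫ b) q
    rw [Scheme.Hom.stalkMap_comp] at this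
    exact Function.Injective.of_comp (f := (a.stalkMap q).hom) this
  have h2 := hs (a q)
  rw [← stalkMap_germ] at h2
  rw [mem_nonZeroDivisors_iff_right] at h2 ⊢
  intro x hx
  refine h1 ((h2 _ ?_).trans (map_zero _).symm)
  have := congrArg (b.stalkMap (a q)).hom hx
  rwa [map_mul, map_zero] at this

theorem eq_of_flat_local {T : Scheme.{u}} {s t : Γ(T, ⊤)}
    (h : ∀ p : T, ∃ (S : Scheme.{u}) (f : S ⟶ T) (q : S), Flat f ∧
      f q = p ∧ ExpDeg.pullFn f s = ExpDeg.pullFn f t) : s = t := by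
  refine TopCat.Presheaf.section_ext T.sheaf ⊤ s t fun p _ => ?_
  obtain ⟨S, f, q, hf, rfl, hst⟩ := h p
  refine stalkMap_injective f q ?_
  exact (stalkMap_germ f q s).trans ((congrArg _ hst).trans (stalkMap_germ f q t).symm)

theorem IsRegularFn.mem_nonZeroDivisors {T : Scheme.{u}} {s : Γ(T, ⊤)} (h : IsRegularFn s) :
    s ∈ nonZeroDivisors Γ(T, ⊤) := by
  rw [mem_nonZeroDivisors_iff_right]
  intro x hx
  refine TopCat.Presheaf.section_ext T.sheaf ⊤ x 0 fun p _ => ?_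
  refine ((mem_nonZeroDivisors_iff_right.1 (h p)) _ ?_).trans (map_zero _).symm
  exact (map_mul _ _ _).symm.trans ((congrArg _ hx).trans (map_zero _))

theorem isRegularFn_of_mem {T : Scheme.{u}} [IsAffine T] {s : Γ(T, ⊤)}
    (h : s ∈ nonZeroDivisors Γ(T, ⊤)) : IsRegularFn s := by
  intro p
  have := (isAffineOpen_top T).isLocalization_stalk ⟨p, trivial⟩
  let := TopCat.Presheaf.algebra_section_stalk T.presheaf (U := ⊤) ⟨p, trivial⟩
  have hfl : (algebraMap Γ(T, ⊤) (T.presheaf.stalk p)).Flat := by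
    rw [RingHom.flat_algebraMap_iff]
    exact IsLocalization.flat _ ((isAffineOpen_top T).primeIdealOf ⟨p, trivial⟩).asIdeal.primeCompl
  exact hfl.map_mem_nonZeroDivisors h

theorem IsRegularFn.mul {T : Scheme.{u}} {s t : Γ(T, ⊤)} (hs : IsRegularFn s)
    (ht : IsRegularFn t) : IsRegularFn (s * t) := fun p => by
  rw [map_mul]
  exact mul_mem (hs p) (ht p)

theorem IsRegularFn.of_dvd {T : Scheme.{u}} {s t : Γ(T, ⊤)} (hs : IsRegularFn s)
    (ht : t ∣ s) : IsRegularFn t := fun p => by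
  obtain ⟨c, rfl⟩ := ht
  have := hs p
  rw [map_mul, mul_mem_nonZeroDivisors] at this
  exact this.1

end ExpDeg

end

/-! ### Gluing over étale covers, points of spaces, and étale charts. -/

noncomputable section

namespace ExpDeg

open Scheme.IdealSheafData

section Sheaf

theorem mem_etaleTopology_of_local {T : Scheme.{u}} {S : Sieve T}
    (h : ∀ p : T, ∃ (T' : Scheme.{u}) (f : T' ⟶ T) (q : T'), Etale f ∧ f q = p ∧ S f) :
    S ∈ Scheme.etaleTopology.{u} T := by
  choose T' f q hf hq hS using h
  let 𝒰 : Scheme.Cover.{u} (Scheme.precoverage @Etale) T :=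
    Scheme.Cover.mkOfCovers T T' f (fun p => ⟨p, q p, hq p⟩) hf
  refine Scheme.mem_grothendieckTopology_iff.2 ⟨𝒰, ?_⟩
  rintro _ _ ⟨i⟩
  exact hS i

variable {E F : Space.{u}}

theorem eq_of_etale_local (hF : Presheaf.IsSheaf Scheme.etaleTopology.{u} F) {T : Scheme.{u}}
    {x y : F.obj (op T)}
    (h : ∀ p : T, ∃ (T' : Scheme.{u}) (f : T' ⟶ T) (q : T'), Etale f ∧ f q = p ∧
      F.map f.op x = F.map f.op y) : x = y := by
  rw [isSheaf_iff_isSheaf_of_type] at hF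
  let S : Sieve T :=
    { arrows := fun T' f => F.map f.op x = F.map f.op y
      downward_closed := fun {A B f} hf g => by
        change F.map f.op x = F.map f.op y at hf
        rw [op_comp, F.map_comp_apply, hf, ← F.map_comp_apply] }
  have hS := hF S (mem_etaleTopology_of_local h)
  exact hS.isSeparatedFor.ext fun T' f hf => hf

/-- `L` plays the role of the graph of the morphism to be built: it is functorial, single-valued and
local, and its étale local solutions glue by the sheaf property. -/
theorem exists_natTrans (hF : Presheaf.IsSheaf Scheme.etaleTopology.{u} F)
    (L : ∀ {T : Scheme.{u}}, E.obj (op T) → F.obj (op T) → Prop)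
    (hmap : ∀ {S T : Scheme.{u}} (g : S ⟶ T) (x : E.obj (op T)) (y : F.obj (op T)), L x y →
      L (E.map g.op x) (F.map g.op y))
    (huniq : ∀ {T : Scheme.{u}} (x : E.obj (op T)) (y y' : F.obj (op T)), L x y → L x y' → y = y')
    (hloc : ∀ {T : Scheme.{u}} (x : E.obj (op T)) (y : F.obj (op T)),
      (∀ p : T, ∃ (T' : Scheme.{u}) (f : T' ⟶ T) (q : T'), Etale f ∧ f q = p ∧
        L (E.map f.op x) (F.map f.op y)) → L x y)
    (hex : ∀ {T : Scheme.{u}} (x : E.obj (op T)) (p : T),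
      ∃ (T' : Scheme.{u}) (f : T' ⟶ T) (q : T'), Etale f ∧ f q = p ∧ ∃ y, L (E.map f.op x) y) :
    ∃ φ : E ⟶ F, ∀ {T : Scheme.{u}} (x : E.obj (op T)), L x (φ.app _ x) := by
  have key : ∀ {T : Scheme.{u}} (x : E.obj (op T)), ∃ y, L x y := by
    intro T x
    rw [isSheaf_iff_isSheaf_of_type] at hF
    let S : Sieve T :=
      { arrows := fun T' f => ∃ y, L (E.map f.op x) y
        downward_closed := fun {A B f} hf g => by
          obtain ⟨y, hy⟩ := hf
          refine ⟨F.map g.op y, ?_⟩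
          rw [op_comp, E.map_comp_apply]
          exact hmap g _ _ hy }
    choose y hy using fun (T' : Scheme.{u}) (f : T' ⟶ T) (hf : S f) => hf
    have hS := hF S (mem_etaleTopology_of_local (hex x))
    have hfam : Presieve.FamilyOfElements.Compatible (P := F) (R := S.arrows)
        (fun T' f hf => y T' f hf) := by
      intro Y₁ Y₂ Z g₁ g₂ f₁ f₂ h₁ h₂ e
      refine huniq (E.map (g₁ ≫ f₁).op x) _ _ ?_ ?_
      · rw [op_comp, E.map_comp_apply]
        exact hmap g₁ _ _ (hy _ _ h₁)
      · rw [e, op_comp, E.map_comp_apply]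
        exact hmap g₂ _ _ (hy _ _ h₂)
    obtain ⟨z, hz, -⟩ := hS _ hfam
    refine ⟨z, hloc x z fun p => ?_⟩
    obtain ⟨T', f, q, h1, h2, h3⟩ := hex x p
    exact ⟨T', f, q, h1, h2, by rw [hz f h3]; exact hy _ _ h3⟩
  choose φ hφ using @key
  refine ⟨{ app := fun T => ↾(fun x => φ (T := T.unop) x), naturality := fun S T g => ?_ }, hφ⟩
  refine ConcreteCategory.hom_ext _ _ fun x => ?_
  exact huniq (T := T.unop) _ _ _ (hφ (T := T.unop) _) (hmap g.unop _ _ (hφ (T := S.unop) x))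

end Sheaf

section Points

variable {F : Space.{u}}

/-- Having a common lift is already transitive, since a fibre product of schemes has a point over
every compatible pair of points. -/
theorem ptOf_eq_iff {T U : Scheme.{u}} {x : F.obj (op T)} {p : T} {y : F.obj (op U)} {q : U} :
    ptOf x p = ptOf y q ↔ ∃ (S : Scheme.{u}) (a : S ⟶ T) (b : S ⟶ U) (s : S),
      F.map a.op x = F.map b.op y ∧ a s = p ∧ b s = q := by
  constructor
  · let R : PrePt F → PrePt F → Prop := fun A B => ∃ (S : Scheme.{u}) (a : S ⟶ A.1) (b : S ⟶ B.1)
      (s : S), F.map a.op A.2.1 = F.map b.op B.2.1 ∧ a s = A.2.2 ∧ b s = B.2.2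
    intro h
    change R ⟨T, x, p⟩ ⟨U, y, q⟩
    refine Relation.EqvGen.recOn (motive := fun A B _ => R A B) (Quot.eqvGen_exact h) ?_ ?_ ?_ ?_
    · rintro A B ⟨g, hg, hp⟩
      exact ⟨B.1, g, 𝟙 _, B.2.2, by simpa using hg, hp, rfl⟩
    · intro A
      exact ⟨A.1, 𝟙 _, 𝟙 _, A.2.2, rfl, rfl, rfl⟩
    · rintro A B - ⟨S, a, b, s, h1, h2, h3⟩
      exact ⟨S, b, a, s, h1.symm, h3, h2⟩
    · rintro A B C - - ⟨S, a, b, s, h1, h2, h3⟩ ⟨S', a', b', s', h1', h2', h3'⟩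
      obtain ⟨z, hz, hz'⟩ := Scheme.Pullback.exists_preimage_pullback s s' (h3.trans h2'.symm)
      refine ⟨pullback b a', pullback.fst b a' ≫ a, pullback.snd b a' ≫ b', z, ?_, ?_, ?_⟩
      · rw [op_comp, F.map_comp_apply, h1, ← F.map_comp_apply, ← op_comp, pullback.condition,
          op_comp, F.map_comp_apply, h1', ← F.map_comp_apply, ← op_comp]
      · simp [hz, h2]
      · simp [hz', h3']
  · rintro ⟨S, a, b, s, h1, rfl, rfl⟩
    rw [← ptOf_map, h1, ptOf_map]

theorem map_yonedaEquiv_symm {T U : Scheme.{u}} (x : F.obj (op T)) (f : U ⟶ T) :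
    yonedaEquiv.symm (F.map f.op x) = yoneda.map f ≫ yonedaEquiv.symm x := by
  apply yonedaEquiv.injective
  rw [Equiv.apply_symm_apply, ← yonedaEquiv_naturality, Equiv.apply_symm_apply]

theorem yoneda_comp_eq_iff {S T U : Scheme.{u}} (x : F.obj (op T)) (y : F.obj (op U)) (f : S ⟶ T)
    (g : S ⟶ U) : yoneda.map f ≫ yonedaEquiv.symm x = yoneda.map g ≫ yonedaEquiv.symm y ↔
      F.map f.op x = F.map g.op y := by
  rw [← map_yonedaEquiv_symm, ← map_yonedaEquiv_symm, Equiv.apply_eq_iff_eq]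

/-- The fibre product of an étale chart with a scheme. -/
theorem IsEtaleChart.exists_pullback {U : Scheme.{u}} {e : F.obj (op U)} (he : IsEtaleChart e)
    {T : Scheme.{u}} (x : F.obj (op T)) :
    ∃ (P : Scheme.{u}) (a : P ⟶ U) (g : P ⟶ T), Etale g ∧ (IsEtaleChart x → Etale a) ∧
      F.map a.op e = F.map g.op x ∧ ∀ (S : Scheme.{u}) (a' : S ⟶ U) (g' : S ⟶ T), F.map a'.op e = F.map g'.op x →
        (∃ l : S ⟶ P, l ≫ a = a' ∧ l ≫ g = g') := by
  have hr := he.rep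
  refine ⟨hr.pullback (yonedaEquiv.symm x), hr.fst' _, hr.snd _, he.property_snd _, fun hx => ?_, ?_, ?_⟩
  · exact hx.property _ _ _ (hr.isPullback' (yonedaEquiv.symm x)).flip
  · rw [← yoneda_comp_eq_iff]
    exact (hr.isPullback' (yonedaEquiv.symm x)).w
  · intro S a' g' h
    rw [← yoneda_comp_eq_iff] at h
    exact ⟨hr.lift' a' g' h, hr.lift'_fst _ _ _, hr.lift'_snd _ _ _⟩

theorem IsEtaleChart.exists_factor {U : Scheme.{u}} {e : F.obj (op U)} (he : IsEtaleChart e)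
    {T : Scheme.{u}} {x : F.obj (op T)} {p : T} {q : U} (h : ptOf e q = ptOf x p) :
    ∃ (P : Scheme.{u}) (a : P ⟶ U) (g : P ⟶ T) (r : P), Etale g ∧ F.map a.op e = F.map g.op x ∧
      a r = q ∧ g r = p := by
  obtain ⟨S, a', g', s, h1, rfl, rfl⟩ := ptOf_eq_iff.1 h
  obtain ⟨P, a, g, hg, -, hag, hl⟩ := he.exists_pullback x
  obtain ⟨l, rfl, rfl⟩ := hl S a' g' h1
  exact ⟨P, a, g, l s, hg, hag, rfl, rfl⟩

theorem IsEtaleChart.map {U V : Scheme.{u}} {e : F.obj (op U)} (he : IsEtaleChart e) (h : V ⟶ U)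
    [Etale h] : IsEtaleChart (F.map h.op e) := by
  unfold IsEtaleChart
  rw [map_yonedaEquiv_symm]
  have h1 : MorphismProperty.IsMultiplicative @Etale.{u} := inferInstance
  have : MorphismProperty.IsStableUnderComposition @Etale.{u} := h1.toIsStableUnderComposition
  have : (MorphismProperty.presheaf @Etale.{u}).IsStableUnderComposition :=
    MorphismProperty.relative_isStableUnderComposition _
  exact MorphismProperty.comp_mem _ _ _ (MorphismProperty.relative_map ‹Etale h›) he

/-- In a scheme over `F`, the preimage of the image of an open set is again the image of an open
set, under the base change of the chart, which is étale and hence open. -/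
theorem IsEtaleChart.isOpenMap {U : Scheme.{u}} {e : F.obj (op U)} (he : IsEtaleChart e) :
    IsOpenMap (ptOf e) := by
  intro V hV
  refine isOpen_iSup_iff.2 fun ⟨T, x⟩ => isOpen_coinduced.2 ?_
  obtain ⟨P, a, g, hg, -, hag, hl⟩ := he.exists_pullback x
  have : ptOf x ⁻¹' (ptOf e '' V) = g '' (a ⁻¹' V) := by
    ext p
    constructor
    · rintro ⟨q, hq, hqp⟩
      obtain ⟨S, a', g', s, h1, rfl, rfl⟩ := ptOf_eq_iff.1 hqp
      obtain ⟨l, rfl, rfl⟩ := hl S a' g' h1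
      exact ⟨l s, hq, rfl⟩
    · rintro ⟨r, hr, rfl⟩
      exact ⟨a r, hr, by rw [← ptOf_map, hag, ptOf_map]⟩
  rw [this]
  exact g.isOpenMap _ (hV.preimage a.continuous)

theorem isOpen_iff_ptOf {V : Set (Pts F)} :
    IsOpen V ↔ ∀ (T : Scheme.{u}) (x : F.obj (op T)), IsOpen (ptOf x ⁻¹' V) := by
  refine isOpen_iSup_iff.trans ⟨fun h T x => ?_, fun h ⟨T, x⟩ => ?_⟩
  · exact isOpen_coinduced.1 (h ⟨T, x⟩)
  · exact isOpen_coinduced.2 (h T x)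

theorem Pts.exists_ptOf (q : Pts F) : ∃ (T : Scheme.{u}) (x : F.obj (op T)) (p : T),
    ptOf x p = q := by
  obtain ⟨⟨T, x, p⟩, rfl⟩ := Quot.exists_rep q
  exact ⟨T, x, p, rfl⟩

theorem Pts.map_ptOf {F' : Space.{u}} (h : F ⟶ F') {T : Scheme.{u}} (x : F.obj (op T)) (p : T) :
    Pts.map h (ptOf x p) = ptOf (h.app _ x) p := rfl

theorem Pts.continuous_map {F' : Space.{u}} (h : F ⟶ F') : Continuous (Pts.map h) := by
  rw [continuous_def]
  intro V hV
  rw [isOpen_iff_ptOf] at hV ⊢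
  intro T x
  exact hV T (h.app _ x)

theorem mem_zeros_ptOf {h : F ⟶ A1} {T : Scheme.{u}} {x : F.obj (op T)} {p : T} :
    ptOf x p ∈ zeros h ↔ p ∉ T.basicOpen (fnAt h x) := Iff.rfl

theorem isClosed_zeros (h : F ⟶ A1) : IsClosed (zeros h) := by
  rw [← isOpen_compl_iff, isOpen_iff_ptOf]
  intro T x
  convert (T.basicOpen (fnAt h x)).2 using 1
  ext p
  exact not_not

/-- Reduced ideals of closed subsets on compatible étale charts. -/
theorem reducedIdeal_map {Z : Closeds (Pts F)} {U V : Scheme.{u}} (e : F.obj (op U)) (h : V ⟶ U)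
    [Etale h] : reducedIdeal Z (F.map h.op e) = (reducedIdeal Z e).comap h := by
  rw [reducedIdeal, reducedIdeal, comap_vanishingIdeal]
  congr 1
  ext p
  exact (congrArg (· ∈ Z) (ptOf_map h e p)).to_iff

/-- Both sides come from the fibre product of the two charts, which is étale over each of them. -/
theorem reducedIdeal_comap_eq {Z : Closeds (Pts F)} {U V T : Scheme.{u}} {e : F.obj (op U)}
    {e' : F.obj (op V)} (he : IsEtaleChart e) (he' : IsEtaleChart e') (a : T ⟶ U) (b : T ⟶ V)
    (h : F.map a.op e = F.map b.op e') :
    (reducedIdeal Z e).comap a = (reducedIdeal Z e').comap b := by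
  obtain ⟨P, a', g, hg, ha, hag, hl⟩ := he.exists_pullback e'
  have := ha he'
  obtain ⟨m, rfl, rfl⟩ := hl T a b h
  rw [comap_comp, comap_comp, ← reducedIdeal_map e a', ← reducedIdeal_map e' g, hag]

end Points

section SpecHom

/-- The functions on `T` defined by a morphism to the spectrum of `S`. -/
def specFn {T : Scheme.{u}} {S : Type u} [CommRing S] (j : T ⟶ Spec (.of S)) : S →+* Γ(T, ⊤) :=
  (pullFn j).comp (Scheme.ΓSpecIso (.of S)).inv.hom

/-- The morphism to the spectrum of `S` defined by functions on `T`. -/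
def specHom {T : Scheme.{u}} {S : Type u} [CommRing S] (g : S →+* Γ(T, ⊤)) : T ⟶ Spec (.of S) :=
  T.toSpecΓ ≫ Spec.map (CommRingCat.ofHom g)

variable {T T' : Scheme.{u}} {S S' : Type u} [CommRing S] [CommRing S']

theorem specFn_comp (h : T' ⟶ T) (j : T ⟶ Spec (.of S)) (s : S) :
    specFn (h ≫ j) s = pullFn h (specFn j s) := rfl

@[simp] theorem specFn_specHom (g : S →+* Γ(T, ⊤)) : specFn (specHom g) = g := by
  have : (Scheme.ΓSpecIso (.of S)).inv ≫ (specHom g).appTop = CommRingCat.ofHom g := by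
    rw [specHom, Scheme.Hom.comp_appTop, ← Category.assoc, ← Scheme.ΓSpecIso_inv_naturality,
      Category.assoc, Scheme.toSpecΓ_appTop, Iso.inv_hom_id, Category.comp_id]
  exact congrArg CommRingCat.Hom.hom this

@[simp] theorem specHom_specFn (j : T ⟶ Spec (.of S)) : specHom (specFn j) = j := by
  have : CommRingCat.ofHom (specFn j) = (Scheme.ΓSpecIso (.of S)).inv ≫ j.appTop := rfl
  rw [specHom, this, Spec.map_comp, ← Category.assoc, ← Scheme.toSpecΓ_naturality, Category.assoc]
  simp

theorem specFn_injective {j j' : T ⟶ Spec (.of S)} (h : specFn j = specFn j') : j = j' := by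
  rw [← specHom_specFn j, h, specHom_specFn]

theorem specFn_comp_map (j : T ⟶ Spec (.of S)) (φ : S' →+* S) (s : S') :
    specFn (j ≫ Spec.map (CommRingCat.ofHom φ)) s = specFn j (φ s) := by
  have h := Scheme.ΓSpecIso_inv_naturality (CommRingCat.ofHom φ)
  have := congrArg (fun f => f.hom s) h
  exact congrArg (pullFn j) this.symm

theorem specFn_id_mem {s : S} (hs : s ∈ nonZeroDivisors S) :
    specFn (𝟙 (Spec (.of S))) s ∈ nonZeroDivisors Γ(Spec (.of S), ⊤) := by
  have hb : Function.Bijective (specFn (𝟙 (Spec (.of S)))) := by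
    convert ConcreteCategory.bijective_of_isIso (Scheme.ΓSpecIso (.of S)).inv using 1
    ext s
    exact pullFn_id _ _
  rw [mem_nonZeroDivisors_iff_right] at hs ⊢
  intro x hx
  obtain ⟨y, rfl⟩ := hb.2 x
  rw [← map_mul, map_eq_zero_iff _ hb.1] at hx
  rw [hs y hx, map_zero]

theorem isRegularFn_specFn_id {s : S} (hs : s ∈ nonZeroDivisors S) :
    IsRegularFn (specFn (𝟙 (Spec (.of S))) s) :=
  isRegularFn_of_mem (specFn_id_mem hs)

theorem mem_basicOpen_specFn (j : T ⟶ Spec (.of S)) (s : S) (p : T) :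
    p ∈ T.basicOpen (specFn j s) ↔ s ∉ (j p).asIdeal := by
  have h : T.basicOpen (specFn j s) = j ⁻¹ᵁ (Spec (.of S)).basicOpen
      ((Scheme.ΓSpecIso (.of S)).inv s) :=
    (Scheme.preimage_basicOpen_top j _).symm
  rw [h, basicOpen_eq_of_affine]
  rfl

end SpecHom

section ProdA2

variable {B : Space.{u}}

/-- The projection `B ×_{𝔸¹} 𝔸² ⟶ B`. -/
def prodA2.pt (g : B ⟶ A1) : prodA2 B g ⟶ B where
  app _ := ↾fun p => p.pt
  naturality _ _ _ := rfl

theorem map_prodA2_mk {g : B ⟶ A1} {T T' : Scheme.{u}} (h : T' ⟶ T) (z : (prodA2 B g).obj (op T)) :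
    (prodA2 B g).map h.op z = ⟨B.map h.op z.pt, pullFn h z.fst, pullFn h z.snd, by
      rw [fnAt_map, z.eq, map_mul]⟩ := rfl

/-- Étale charts of `B ×_{𝔸¹} 𝔸²`. -/
theorem isEtaleChart_prodA2 {g : B ⟶ A1} {W : Scheme.{u}} {e : B.obj (op W)} (he : IsEtaleChart e)
    {P : Scheme.{u}} (z : (prodA2 B g).obj (op P)) (a : P ⟶ W) (ha : B.map a.op e = z.pt)
    (huniq : ∀ (T : Scheme.{u}) (b c : T ⟶ P), b ≫ a = c ≫ a → pullFn b z.fst = pullFn c z.fst →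
      pullFn b z.snd = pullFn c z.snd → b = c)
    (hex : ∀ {T : Scheme.{u}} (b : T ⟶ W) (u v : Γ(T, ⊤)), pullFn b (fnAt g e) = u * v →
      ∃ c : T ⟶ P, c ≫ a = b ∧ pullFn c z.fst = u ∧ pullFn c z.snd = v) : IsEtaleChart z := by
  have h1 : MorphismProperty.IsStableUnderBaseChange (MorphismProperty.presheaf @Etale.{u}) :=
    MorphismProperty.relative_isStableUnderBaseChange _
  -- The two conditions on `P` say that `z` is the base change of the étale chart `e` along the
  -- projection to `B`.
  have key : IsPullback (yonedaEquiv.symm z) (yoneda.map a) (prodA2.pt g) (yonedaEquiv.symm e) := by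
    refine IsPullback.of_forall_isPullback_app fun T => ?_
    rw [Types.isPullback_iff]
    refine ⟨?_, ?_, ?_⟩
    · ext b
      change ((prodA2 B g).map b.op z).pt = B.map (b ≫ a).op e
      rw [op_comp, B.map_comp_apply, ha]
      rfl
    · rintro b c ⟨hbc, hbc'⟩
      change (prodA2 B g).map b.op z = (prodA2 B g).map c.op z at hbc
      exact huniq T.unop b c hbc' (congrArg ProdA2Pt.fst hbc) (congrArg ProdA2Pt.snd hbc)
    · intro y b hb
      change y.pt = B.map (show T.unop ⟶ W from b).op e at hb
      obtain ⟨c, hc1, hc2, hc3⟩ := hex (T := T.unop) b y.fst y.snd (by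
        rw [← fnAt_map, ← hb, y.eq])
      refine ⟨c, ?_, hc1⟩
      change (prodA2 B g).map c.op z = y
      refine ProdA2Pt.ext ?_ hc2 hc3
      change B.map c.op z.pt = _
      rw [← ha, ← B.map_comp_apply, ← op_comp, hc1, hb]
  exact h1.of_isPullback key.flip he

/-- Over an affine chart `W` the fibre product is the spectrum of `A[u, v] / (u v - c)`, with `A`
the functions on `W` and `c` the value of `g`. It therefore catches every point lying over `W`. -/
theorem exists_chart_prodA2 {g : B ⟶ A1} {W : Scheme.{u}} {e : B.obj (op W)} (he : IsEtaleChart e)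
    [IsAffine W] : ∃ (P : Scheme.{u}) (z : (prodA2 B g).obj (op P)), IsEtaleChart z ∧
      ∀ {T : Scheme.{u}} (y : (prodA2 B g).obj (op T)) (b : T ⟶ W), B.map b.op e = y.pt →
        ∃ c : T ⟶ P, (prodA2 B g).map c.op z = y := by
  let Q := SplitRing Γ(W, ⊤) (fnAt g e)
  let P : Scheme.{u} := Spec (.of Q)
  have hW {T : Scheme.{u}} {b c : T ⟶ W} (h : ∀ s, pullFn b s = pullFn c s) : b = c := by
    refine ext_of_isAffine ?_
    ext s
    exact h s
  let a : P ⟶ W := Spec.map (CommRingCat.ofHom (SplitRing.incl (fnAt g e))) ≫ W.isoSpec.inv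
  have ha {T : Scheme.{u}} (c : T ⟶ P) (s : Γ(W, ⊤)) :
      pullFn (c ≫ a) s = specFn c (SplitRing.incl _ s) := by
    have h1 : s = pullFn W.toSpecΓ ((Scheme.ΓSpecIso _).inv s) := by
      change s = W.toSpecΓ.appTop _
      rw [Scheme.toSpecΓ_appTop, ← ConcreteCategory.comp_apply, Iso.inv_hom_id]
      rfl
    have h2 : a ≫ W.toSpecΓ = Spec.map (CommRingCat.ofHom (SplitRing.incl (fnAt g e))) := by
      rw [Category.assoc, ← Scheme.isoSpec_hom, Iso.inv_hom_id, Category.comp_id]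
    rw [← specFn_comp_map, ← h2, ← Category.assoc]
    conv_lhs => rw [h1]
    rfl
  let z : (prodA2 B g).obj (op P) := ⟨B.map a.op e, specFn (𝟙 P) (SplitRing.fst _),
    specFn (𝟙 P) (SplitRing.snd _), by
      rw [fnAt_map, ← map_mul, SplitRing.fst_mul_snd, ← ha, Category.id_comp]⟩
  have hex {T : Scheme.{u}} (b : T ⟶ W) (u v : Γ(T, ⊤)) (huv : pullFn b (fnAt g e) = u * v) :
      ∃ c : T ⟶ P, c ≫ a = b ∧ pullFn c z.fst = u ∧ pullFn c z.snd = v := by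
    refine ⟨specHom (SplitRing.lift (pullFn b) u v huv.symm), hW fun s => ?_, ?_, ?_⟩
    · rw [ha, specFn_specHom, SplitRing.lift_incl]
    · rw [← specFn_comp, Category.comp_id, specFn_specHom, SplitRing.lift_fst]
    · rw [← specFn_comp, Category.comp_id, specFn_specHom, SplitRing.lift_snd]
  refine ⟨P, z, isEtaleChart_prodA2 he z a rfl ?_ hex, ?_⟩
  · intro T b c h1 h2 h3
    refine specFn_injective (SplitRing.hom_ext ?_ ?_ ?_)
    · intro s
      rw [← ha, h1, ha]
    · exact h2
    · exact h3
  · intro T y b hb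
    obtain ⟨c, h1, h2, h3⟩ := hex b y.fst y.snd (by rw [← fnAt_map, hb, y.eq])
    refine ⟨c, ProdA2Pt.ext ?_ h2 h3⟩
    change B.map c.op (B.map a.op e) = _
    rw [← B.map_comp_apply, ← op_comp, h1, hb]

end ProdA2

end ExpDeg

end

/-! ### Affine charts of algebraic spaces, and ideals generated by two functions. -/

noncomputable section

namespace ExpDeg

open Scheme.IdealSheafData

section Charts

variable {F : Space.{u}}

/-- Étale locally, points of an algebraic space factor through affine étale charts. -/
theorem IsAlgebraicSpace.exists_chart (hF : IsAlgebraicSpace F) {T : Scheme.{u}} (x : F.obj (op T))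
    (p : T) : ∃ (T' : Scheme.{u}) (h : T' ⟶ T) (q : T') (U : Scheme.{u}) (e : F.obj (op U))
      (c : T' ⟶ U), Etale h ∧ h q = p ∧ IsAffine U ∧ IsEtaleChart e ∧
        F.map c.op e = F.map h.op x := by
  obtain ⟨U, e, he, hs⟩ := hF.exists_atlas
  let P := he.rep.pullback (yonedaEquiv.symm x)
  let a : P ⟶ U := he.rep.fst' _
  let g : P ⟶ T := he.rep.snd _
  have hg : Etale g := he.property_snd _
  have hgs : Surjective g := hs.property_snd _
  have hag : F.map a.op e = F.map g.op x := by
    rw [← yoneda_comp_eq_iff]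
    exact (he.rep.isPullback' (yonedaEquiv.symm x)).w
  obtain ⟨r, rfl⟩ := g.surjective p
  obtain ⟨_, ⟨(V : U.Opens), hV, rfl⟩, hrV, -⟩ := U.isBasis_affineOpens.exists_subset_of_mem_open
    (Set.mem_univ (a r)) isOpen_univ
  obtain ⟨z, hz, -⟩ := Scheme.Pullback.exists_preimage_pullback (f := a) (g := V.ι) r
    (⟨a r, hrV⟩ : V) rfl
  refine ⟨pullback a V.ι, pullback.fst _ _ ≫ g, z, V.toScheme, F.map V.ι.op e,
    pullback.snd _ _, inferInstance, by simp [hz], hV, he.map _, ?_⟩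
  rw [← F.map_comp_apply, ← op_comp, ← pullback.condition, op_comp, F.map_comp_apply, hag,
    op_comp, F.map_comp_apply]

theorem exists_affine_nbhd (T : Scheme.{u}) (p : T) : ∃ (T' : Scheme.{u}) (h : T' ⟶ T) (q : T'),
    Etale h ∧ h q = p ∧ IsAffine T' := by
  obtain ⟨_, ⟨(V : T.Opens), hV, rfl⟩, hpV, -⟩ := T.isBasis_affineOpens.exists_subset_of_mem_open
    (Set.mem_univ p) isOpen_univ
  exact ⟨V.toScheme, V.ι, ⟨p, hpV⟩, inferInstance, rfl, hV⟩

/-- Since `x` need not be étale, only an inclusion holds: on the fibre product with `e`, the pulled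
back ideal vanishes on the preimage of `Z`, so it lies in the reduced ideal of this preimage. -/
theorem reducedIdeal_comap_le {Z : Closeds (Pts F)} {U T P : Scheme.{u}} {e : F.obj (op U)}
    (he : IsEtaleChart e) (x : F.obj (op T)) (q : P ⟶ U) (j : P ⟶ T)
    (h : F.map q.op e = F.map j.op x) :
    (reducedIdeal Z e).comap q ≤ (reducedIdeal Z x).comap j := by
  obtain ⟨W, a, g, hg, -, hag, hl⟩ := he.exists_pullback x
  obtain ⟨l, rfl, rfl⟩ := hl P q j h
  rw [comap_comp, comap_comp, ← reducedIdeal_map x g, ← hag]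
  refine comap_mono _ ?_
  rw [reducedIdeal, reducedIdeal, ← le_support_iff_le_vanishingIdeal, support_comap]
  intro p hp
  have : ptOf e (a p) ∈ Z := by
    have := (ptOf_map a e p).symm
    rw [this]; exact hp
  exact le_support_iff_le_vanishingIdeal.2 le_rfl this

end Charts

section PairIdeal

variable {S T : Scheme.{u}}

/-- The ideal sheaf generated by two functions. -/
def pairIdeal (a b : Γ(T, ⊤)) : T.IdealSheafData :=
  ofIdealTop (Ideal.span {a}) ⊔ ofIdealTop (Ideal.span {b})

theorem comap_ofIdealTop_span (h : S ⟶ T) (a : Γ(T, ⊤)) :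
    (ofIdealTop (Ideal.span {a})).comap h = ofIdealTop (Ideal.span {pullFn h a}) := by
  rw [comap_ofIdealTop, Ideal.map_span, Set.image_singleton]

theorem comap_pairIdeal (h : S ⟶ T) (a b : Γ(T, ⊤)) :
    (pairIdeal a b).comap h = pairIdeal (pullFn h a) (pullFn h b) := by
  rw [pairIdeal, comap_sup, comap_ofIdealTop_span, comap_ofIdealTop_span]
  rfl

theorem ofIdealTop_mono {I J : Ideal Γ(T, ⊤)} (h : I ≤ J) : ofIdealTop I ≤ ofIdealTop J :=
  ofIdealTop_le.2 fun V => h.trans (ofIdealTop_le.1 le_rfl V)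

theorem pairIdeal_of_dvd_left {a b : Γ(T, ⊤)} (h : b ∣ a) :
    pairIdeal a b = ofIdealTop (Ideal.span {b}) :=
  sup_of_le_right (ofIdealTop_mono (Ideal.span_singleton_le_span_singleton.2 h))

theorem pairIdeal_of_dvd_right {a b : Γ(T, ⊤)} (h : a ∣ b) :
    pairIdeal a b = ofIdealTop (Ideal.span {a}) :=
  sup_of_le_left (ofIdealTop_mono (Ideal.span_singleton_le_span_singleton.2 h))

theorem pairIdeal_eq [IsAffine T] (a b : Γ(T, ⊤)) :
    pairIdeal a b = ofIdealTop (Ideal.span {a, b}) := by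
  have : pairIdeal a b ≤ ofIdealTop (Ideal.span {a, b}) :=
    sup_le (ofIdealTop_mono (Ideal.span_mono (by simp))) (ofIdealTop_mono (Ideal.span_mono (by simp)))
  refine le_antisymm this (ofIdealTop_le.2 fun V => Ideal.span_le.2 ?_)
  rintro _ (rfl | rfl)
  · exact (le_sup_left : _ ≤ pairIdeal _ b) V
      (ofIdealTop_le.1 le_rfl V (Ideal.mem_span_singleton_self _))
  · exact (le_sup_right : _ ≤ pairIdeal a _) V
      (ofIdealTop_le.1 le_rfl V (Ideal.mem_span_singleton_self _))

theorem dvd_of_ofIdealTop_le [IsAffine T] {a b : Γ(T, ⊤)}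
    (h : ofIdealTop (Ideal.span {a}) ≤ ofIdealTop (Ideal.span {b})) : b ∣ a := by
  have := h ⟨⊤, isAffineOpen_top T⟩
  simp only [ofIdealTop_ideal] at this
  rw [← Ideal.span_singleton_le_span_singleton]
  simpa using this

/-- The pair `(a, b)` generates an effective Cartier divisor for one of the two obvious reasons. -/
def SchemeCartierPair (a b : Γ(T, ⊤)) : Prop :=
  (IsRegularFn b ∧ b ∣ a) ∨ (IsRegularFn a ∧ a ∣ b)

theorem SchemeCartierPair.pullFn {a b : Γ(T, ⊤)} (hab : SchemeCartierPair a b) (h : S ⟶ T)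
    [Flat h] : SchemeCartierPair (pullFn h a) (pullFn h b) := by
  rcases hab with ⟨h1, h2⟩ | ⟨h1, h2⟩
  · exact .inl ⟨h1.pullFn h, map_dvd _ h2⟩
  · exact .inr ⟨h1.pullFn h, map_dvd _ h2⟩

theorem SchemeCartierPair.isCartier [IsAffine T] {a b : Γ(T, ⊤)} (h : SchemeCartierPair a b) :
    IsCartier (pairIdeal a b) := by
  rcases h with ⟨h1, h2⟩ | ⟨h1, h2⟩
  · rw [pairIdeal_of_dvd_left h2]
    exact isCartier_ofIdealTop h1.mem_nonZeroDivisors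
  · rw [pairIdeal_of_dvd_right h2]
    exact isCartier_ofIdealTop h1.mem_nonZeroDivisors

theorem SchemeCartierPair.cartierPair {a b : Γ(T, ⊤)} (h : SchemeCartierPair a b) :
    CartierPair a b := by
  rcases h with ⟨h1, h2⟩ | ⟨h1, h2⟩
  · exact .inl ⟨h1.mem_nonZeroDivisors, h2⟩
  · exact .inr ⟨h1.mem_nonZeroDivisors, h2⟩

theorem isRegularFn_of_isUnit {a : Γ(T, ⊤)} (h : IsUnit a) : IsRegularFn a := fun p =>
  (h.map (T.presheaf.germ ⊤ p trivial).hom).mem_nonZeroDivisors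

theorem isUnit_of_basicOpen_eq_top {a : Γ(T, ⊤)} (h : T.basicOpen a = ⊤) : IsUnit a :=
  RingedSpace.isUnit_of_isUnit_germ _ ⊤ a fun x hx =>
    (T.mem_basicOpen a x hx).1 (by rw [h]; trivial)

theorem isUnit_pullFn_basicOpen (a : Γ(T, ⊤)) : IsUnit (pullFn (T.basicOpen a).ι a) := by
  refine isUnit_of_basicOpen_eq_top ?_
  rw [show (T.basicOpen a).toScheme.basicOpen (pullFn (T.basicOpen a).ι a) = _ from
    (Scheme.preimage_basicOpen_top _ a).symm]
  simp

theorem exists_isRegularFn_dvd [IsAffine T] {s a b : Γ(T, ⊤)} (hs : IsRegularFn s) {p : T}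
    (hp : p ∈ T.basicOpen a) : ∃ (T' : Scheme.{u}) (g : T' ⟶ T) (q : T'), Etale g ∧ g q = p ∧
      IsAffine T' ∧ IsRegularFn (pullFn g (s * a)) ∧ pullFn g (s * a) ∣ pullFn g (s * b) := by
  refine ⟨(T.basicOpen a).toScheme, (T.basicOpen a).ι, ⟨p, hp⟩, inferInstance, rfl,
    (isAffineOpen_top T).basicOpen a, ?_, ?_⟩
  · rw [map_mul]
    exact (hs.pullFn _).mul (isRegularFn_of_isUnit (isUnit_pullFn_basicOpen a))
  · rw [map_mul, map_mul]
    exact mul_dvd_mul_left _ (isUnit_pullFn_basicOpen a).dvd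

/-- Locally the ideal is `(s)` with `s` regular. Writing `a = s a₁`, `b = s b₁` and cancelling `s`
in `α a + β b = s` gives `α a₁ + β b₁ = 1`. So near each point `a₁` or `b₁` is invertible, and `a`
or `b` generates. -/
theorem exists_schemeCartierPair {a b : Γ(T, ⊤)} (h : IsCartier (pairIdeal a b)) (p : T) :
    ∃ (T' : Scheme.{u}) (g : T' ⟶ T) (q : T'), Etale g ∧ g q = p ∧ IsAffine T' ∧
      SchemeCartierPair (pullFn g a) (pullFn g b) := by
  obtain ⟨V, hpV, s, hs, hJ⟩ := h p
  have : IsAffine V.1 := V.2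
  let V' : Scheme.{u} := V.1.toScheme
  have h0 : ∃ s' ∈ nonZeroDivisors Γ(V', ⊤),
      Ideal.span {pullFn V.1.ι a, pullFn V.1.ι b} = Ideal.span {s'} := by
    have h1 := ideal_comap_ι (pairIdeal a b) V (isAffineOpen_top V')
    have hfl := flat_appLE V.1.ι V ⟨⊤, isAffineOpen_top V'⟩ (by simp)
    refine ⟨_, hfl.map_mem_nonZeroDivisors hs, ?_⟩
    rw [hJ, comap_pairIdeal, pairIdeal_eq, Ideal.map_span, Set.image_singleton] at h1
    simp only [ofIdealTop_ideal] at h1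
    rw [← h1]
    refine (Ideal.map_id _).symm.trans (congrArg (fun φ => Ideal.map φ _) ?_)
    ext z
    simp
    rfl
  obtain ⟨s', hs', hspan⟩ := h0
  set a' := pullFn V.1.ι a with ha'
  set b' := pullFn V.1.ι b with hb'
  obtain ⟨a₁, ha⟩ : s' ∣ a' := by
    rw [← Ideal.mem_span_singleton, ← hspan]; exact Ideal.subset_span (by simp)
  obtain ⟨b₁, hb⟩ : s' ∣ b' := by
    rw [← Ideal.mem_span_singleton, ← hspan]; exact Ideal.subset_span (by simp)
  obtain ⟨α, β, hαβ⟩ : ∃ α β, α * a' + β * b' = s' := by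
    rw [← Ideal.mem_span_pair, hspan]; exact Ideal.mem_span_singleton_self _
  have h1 : α * a₁ + β * b₁ = 1 := by
    have : s' * (α * a₁ + β * b₁ - 1) = 0 := by linear_combination hαβ - α * ha - β * hb
    exact sub_eq_zero.1 ((mem_nonZeroDivisors_iff.1 hs').1 _ this)
  have hreg : IsRegularFn s' := isRegularFn_of_mem hs'
  let p' : V' := ⟨p, hpV⟩
  have hcases : p' ∈ V'.basicOpen a₁ ∨ p' ∈ V'.basicOpen b₁ := by
    by_contra hcon
    rw [not_or] at hcon
    have h2 : p' ∈ V'.basicOpen (α * a₁ + β * b₁) := by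
      rw [h1, V'.basicOpen_one]; trivial
    rcases V'.basicOpen_add_le _ _ h2 with h3 | h3
    · rw [SetLike.mem_coe, V'.basicOpen_mul] at h3; exact hcon.1 h3.2
    · rw [SetLike.mem_coe, V'.basicOpen_mul] at h3; exact hcon.2 h3.2
  rcases hcases with hd | hd
  · obtain ⟨T', g, q, hg, hq, haff, h2, h3⟩ := exists_isRegularFn_dvd (b := b₁) hreg hd
    rw [← ha] at h2 h3
    rw [← hb] at h3
    exact ⟨T', g ≫ V.1.ι, q, inferInstance, by rw [Scheme.Hom.comp_apply, hq]; rfl, haff, .inr ⟨h2, h3⟩⟩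
  · obtain ⟨T', g, q, hg, hq, haff, h2, h3⟩ := exists_isRegularFn_dvd (b := a₁) hreg hd
    rw [← hb] at h2 h3
    rw [← ha] at h3
    exact ⟨T', g ≫ V.1.ι, q, inferInstance, by rw [Scheme.Hom.comp_apply, hq]; rfl, haff, .inl ⟨h2, h3⟩⟩

end PairIdeal

end ExpDeg

end

/-! ### Spaces over `X ×_{𝔸¹} 𝔸ⁿ⁺¹` described by local models. -/

noncomputable section

namespace ExpDeg

open Scheme.IdealSheafData

/-- A class of charts of `X` by spectra of rings, each with two functions on it. -/
abbrev ChartClass (X : Space.{u}) : Type (u + 1) :=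
  ∀ (R : Type u) [CommRing R], X.obj (op (Spec (.of R))) → R → R → Prop

/-- The charts in the class `Good` cover `X`, the product of the two functions on them is `f`, and
the first of them is an equation of the closure of `W`. -/
structure LocalEquations {X : Space.{u}} (f : X ⟶ A1) (W : Set (Pts X)) (Good : ChartClass X) :
    Prop where
  eq : ∀ {R : Type u} [CommRing R] {w : X.obj (op (Spec (.of R)))} {x y : R}, Good R w x y →
    fnAt f w = specFn (𝟙 _) (x * y)
  mul_mem : ∀ {R : Type u} [CommRing R] {w : X.obj (op (Spec (.of R)))} {x y : R}, Good R w x y →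
    x * y ∈ nonZeroDivisors R
  radicalRegular : ∀ {R : Type u} [CommRing R] {w : X.obj (op (Spec (.of R)))} {x y : R},
    Good R w x y → (Ideal.span {x}).RadicalRegular y
  mem : ∀ {R : Type u} [CommRing R] {w : X.obj (op (Spec (.of R)))} {x y : R}, Good R w x y →
    ∀ p : Spec (.of R), x ∈ p.asIdeal → y ∉ p.asIdeal → ptOf w p ∈ W
  mem_closure : ∀ {R : Type u} [CommRing R] {w : X.obj (op (Spec (.of R)))} {x y : R},
    Good R w x y → ∀ p : Spec (.of R), ptOf w p ∈ closure W → x ∈ p.asIdeal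
  compat : ∀ {R R' : Type u} [CommRing R] [CommRing R'] {w : X.obj (op (Spec (.of R)))} {x y : R}
    {w' : X.obj (op (Spec (.of R')))} {x' y' : R'}, Good R w x y → Good R' w' x' y' →
    ∀ {T : Scheme.{u}} (j : T ⟶ Spec (.of R)) (j' : T ⟶ Spec (.of R')),
      X.map j.op w = X.map j'.op w' →
        ofIdealTop (Ideal.span {specFn j x}) = ofIdealTop (Ideal.span {specFn j' x'})
  cover : ∀ {T : Scheme.{u}} (w : X.obj (op T)) (p : T),
    ∃ (T' : Scheme.{u}) (h : T' ⟶ T) (q : T'), Etale h ∧ h q = p ∧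
      ∃ (R : Type u) (_ : CommRing R) (w' : X.obj (op (Spec (.of R)))) (x y : R)
        (j : T' ⟶ Spec (.of R)), Good R w' x y ∧ X.map h.op w = X.map j.op w'

variable {X B : Space.{u}} {f : X ⟶ A1} {n : ℕ}

/-- A chart of the expanded degeneration with the coordinate ring of a local model. -/
structure ModelChart (r : B ⟶ fib X f n) (Good : ChartClass X) : Type (u + 1) where
  {R S : Type u}
  [ringR : CommRing R]
  [ringS : CommRing S]
  w : X.obj (op (Spec (.of R)))
  (x y : R)
  k : ℕ
  str : R →+* S
  t : Fin (n + 1) → S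
  (a b : S)
  m : B.obj (op (Spec (.of S)))
  good : Good R w x y
  isModel : IsModel x y n k str t a b
  pt_eq : (r.app _ m).pt = X.map (Spec.map (CommRingCat.ofHom str)).op w
  coord_eq : ∀ i, (r.app _ m).coord i = specFn (𝟙 _) (t i)

attribute [instance] ModelChart.ringR ModelChart.ringS

/-- `r : B ⟶ X ×_{𝔸¹} 𝔸ⁿ⁺¹` is étale locally given by the local models, and its sections with
regular coordinates are unique. -/
structure HasModels (r : B ⟶ fib X f n) (Good : ChartClass X) : Prop where
  exists_point : ∀ {R S : Type u} [CommRing R] [CommRing S] {w : X.obj (op (Spec (.of R)))}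
    {x y : R} {k : ℕ} {str : R →+* S} {t : Fin (n + 1) → S} {a b : S}, Good R w x y →
    IsModel x y n k str t a b → ∃ m : B.obj (op (Spec (.of S))),
      (r.app _ m).pt = X.map (Spec.map (CommRingCat.ofHom str)).op w ∧
      ∀ i, (r.app _ m).coord i = specFn (𝟙 _) (t i)
  exists_factor : ∀ {T : Scheme.{u}} (y : B.obj (op T)) (p : T),
    ∃ (T' : Scheme.{u}) (h : T' ⟶ T) (q : T'), Etale h ∧ h q = p ∧ IsAffine T' ∧
      ∃ (M : ModelChart r Good) (j : T' ⟶ Spec (.of M.S)), B.map h.op y = B.map j.op M.m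
  ext : ∀ {T : Scheme.{u}} (y y' : B.obj (op T)), r.app _ y = r.app _ y' →
    (∀ i, IsRegularFn ((r.app _ y).coord i)) → y = y'

theorem app_map {F G : Space.{u}} (r : F ⟶ G) {S T : Scheme.{u}} (g : S ⟶ T) (y : F.obj (op T)) :
    r.app _ (F.map g.op y) = G.map g.op (r.app _ y) :=
  NatTrans.naturality_apply r g.op y

theorem pt_map (r : B ⟶ fib X f n) {S T : Scheme.{u}} (g : S ⟶ T) (y : B.obj (op T)) :
    (r.app _ (B.map g.op y)).pt = X.map g.op (r.app _ y).pt := by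
  rw [app_map]; rfl

theorem coord_map (r : B ⟶ fib X f n) {S T : Scheme.{u}} (g : S ⟶ T) (y : B.obj (op T))
    (i : Fin (n + 1)) :
    (r.app _ (B.map g.op y)).coord i = pullFn g ((r.app _ y).coord i) := by
  rw [app_map]; rfl

theorem specFn_eq_pullFn {T : Scheme.{u}} {S : Type u} [CommRing S] (j : T ⟶ Spec (.of S)) (s : S) :
    specFn j s = pullFn j (specFn (𝟙 _) s) := by
  rw [← specFn_comp, Category.comp_id]

/-- A space over `X ×_{𝔸¹} 𝔸ⁿ⁺¹` isomorphic to it. -/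
theorem hasModels_of_isIso (r : B ⟶ fib X f n) [IsIso r] {W : Set (Pts X)} {Good : ChartClass X}
    (hG : LocalEquations f W Good)
    -- Every factorization of `x y` must come from the equations of some chart. This is applied for
    -- `n = 0`, and for all `n` where `x` or `y` is a unit.
    (hex : ∀ {R O : Type u} [CommRing R] [CommRing O] {w : X.obj (op (Spec (.of R)))}
      {x y : R} (φ : R →+* O) (t : Fin (n + 1) → O), Good R w x y → φ (x * y) = ∏ i, t i →
      ∃ k ≤ n, ∃ a b, ModelEqns (φ x) (φ y) k t a b) : HasModels r Good := by
  have hinv {T : Scheme.{u}} (z : (fib X f n).obj (op T)) : r.app _ ((inv r).app _ z) = z := by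
    have := congrArg (fun α => α.app (op T) z) (IsIso.inv_hom_id r)
    exact this
  have hinv' {T : Scheme.{u}} (z : B.obj (op T)) : (inv r).app _ (r.app _ z) = z := by
    have := congrArg (fun α => α.app (op T) z) (IsIso.hom_inv_id r)
    exact this
  have hpt : ∀ {R S : Type u} [CommRing R] [CommRing S] {w : X.obj (op (Spec (.of R)))}
      {x y : R} {k : ℕ} {str : R →+* S} {t : Fin (n + 1) → S} {a b : S}, Good R w x y →
      IsModel x y n k str t a b → ∃ m : B.obj (op (Spec (.of S))),
        (r.app _ m).pt = X.map (Spec.map (CommRingCat.ofHom str)).op w ∧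
        ∀ i, (r.app _ m).coord i = specFn (𝟙 _) (t i) := by
    intro R S _ _ w x y k str t a b hg hm
    let z : FibPt X f n (Spec (.of S)) := ⟨X.map (Spec.map (CommRingCat.ofHom str)).op w,
      fun i => specFn (𝟙 _) (t i), by
        rw [fnAt_map, hG.eq hg, ← specFn_comp, Category.comp_id, ← map_prod, ← hm.eqns.mul_eq hm.le,
          ← map_mul, ← Category.id_comp (Spec.map _), specFn_comp_map]⟩
    exact ⟨(inv r).app _ z, congrArg FibPt.pt (hinv z),
      fun i => congrArg (fun z => FibPt.coord z i) (hinv z)⟩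
  refine ⟨hpt, ?_, ?_⟩
  · intro T y p
    obtain ⟨T₁, h₁, q₁, hh₁, rfl, R, _, w, x, y', j, hg, hw⟩ := hG.cover (r.app _ y).pt p
    obtain ⟨T₂, h₂, q₂, hh₂, rfl, haff⟩ := exists_affine_nbhd T₁ q₁
    have hz : (r.app _ (B.map (h₂ ≫ h₁).op y)).pt = X.map (h₂ ≫ j).op w := by
      rw [pt_map, op_comp, X.map_comp_apply, hw, op_comp, X.map_comp_apply]
    obtain ⟨k, hk, a, b, hab⟩ := hex (specFn (h₂ ≫ j))
      (r.app _ (B.map (h₂ ≫ h₁).op y)).coord hg (by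
        rw [← (r.app _ (B.map (h₂ ≫ h₁).op y)).eq, hz, fnAt_map, hG.eq hg, ← specFn_comp,
          Category.comp_id])
    obtain ⟨S, _, str, t, a', b', hm⟩ := IsModel.exists_model (hG.mul_mem hg) (hG.radicalRegular hg)
      n k hk
    obtain ⟨m, hm1, hm2⟩ := hpt hg hm
    obtain ⟨g, hg1, hg2, -, -⟩ := hm.exists_hom _ _ _ _ hab
    refine ⟨T₂, h₂ ≫ h₁, q₂, inferInstance, rfl, haff,
      ⟨w, x, y', k, str, t, a', b', m, hg, hm, hm1, hm2⟩, specHom g, ?_⟩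
    rw [← hinv' (B.map (h₂ ≫ h₁).op y), ← hinv' (B.map (specHom g).op m)]
    refine congrArg _ (FibPt.ext ?_ (funext fun i => ?_))
    · rw [hz, pt_map, hm1, ← X.map_comp_apply, ← op_comp]
      have : h₂ ≫ j = specHom g ≫ Spec.map (CommRingCat.ofHom str) :=
        specFn_injective (RingHom.ext fun s => by rw [specFn_comp_map, specFn_specHom, hg1])
      rw [this]
    · rw [coord_map r (specHom g), hm2, ← specFn_eq_pullFn, specFn_specHom, hg2]
  · intro T y y' h _
    rw [← hinv' y, h, hinv']

end ExpDeg

end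

/-! ### Equations for the centre of the next blow-up. -/

noncomputable section

namespace ExpDeg

open Scheme.IdealSheafData

section Vanishing

theorem mem_support_ofIdealTop {T : Scheme.{u}} {I : Ideal Γ(T, ⊤)} {p : T} :
    p ∈ (ofIdealTop I).support ↔ ∀ a ∈ I, p ∉ T.basicOpen a := by
  rw [← SetLike.mem_coe, coe_support_ofIdealTop, Scheme.mem_zeroLocus_iff]
  rfl

theorem ofIdealTop_le_vanishingIdeal {T : Scheme.{u}} {a : Γ(T, ⊤)} {Z : Closeds T}
    (h : ∀ p ∈ Z, p ∉ T.basicOpen a) : ofIdealTop (Ideal.span {a}) ≤ vanishingIdeal Z := by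
  rw [← le_support_iff_le_vanishingIdeal]
  intro p hp
  refine mem_support_ofIdealTop.2 fun b hb hpb => h p hp ?_
  obtain ⟨c, rfl⟩ := Ideal.mem_span_singleton.1 hb
  rw [T.basicOpen_mul] at hpb
  exact hpb.1

theorem vanishingIdeal_support_ofIdealTop {T : Scheme.{u}} [IsAffine T] {I : Ideal Γ(T, ⊤)}
    (hI : I.IsRadical) : vanishingIdeal (ofIdealTop I).support = ofIdealTop I := by
  rw [vanishingIdeal_support]
  refine ext_of_isAffine ?_
  rw [radical_ideal]
  have : (ofIdealTop I).ideal ⟨⊤, isAffineOpen_top T⟩ = I := by simp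
  rw [this, hI.radical]

/-- The global functions on the spectrum of a ring. -/
def specEquiv (S : Type u) [CommRing S] : S ≃+* Γ(Spec (.of S), ⊤) :=
  (Scheme.ΓSpecIso (.of S)).symm.commRingCatIsoToRingEquiv

theorem specEquiv_apply {S : Type u} [CommRing S] (s : S) : specEquiv S s = specFn (𝟙 _) s :=
  (pullFn_id _ _).symm

theorem isRadical_map_specFn {S : Type u} [CommRing S] {I : Ideal S} (hI : I.IsRadical) :
    (I.map (specFn (𝟙 (Spec (.of S))))).IsRadical := by
  have : I.map (specFn (𝟙 (Spec (.of S)))) = I.comap (specEquiv S).symm := by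
    rw [← Ideal.map_symm]
    exact congrArg (fun φ => Ideal.map φ I) (RingHom.ext fun s => (specEquiv_apply s).symm)
  rw [this]
  exact hI.comap _

theorem vanishingIdeal_le_ofIdealTop {S : Type u} [CommRing S] {I : Ideal S} (h : I.IsRadical)
    {Z : Closeds (Spec (.of S))} (hZ : ∀ p : Spec (.of S), I ≤ p.asIdeal → p ∈ Z) :
    vanishingIdeal Z ≤ ofIdealTop (I.map (specFn (𝟙 _))) := by
  rw [← vanishingIdeal_support_ofIdealTop (isRadical_map_specFn h)]
  refine vanishingIdeal_antimono fun p hp => hZ p fun s hs => ?_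
  by_contra hc
  exact mem_support_ofIdealTop.1 hp _ (Ideal.mem_map_of_mem _ hs) ((mem_basicOpen_specFn _ _ _).2 hc)

theorem vanishingIdeal_le_pairIdeal {S : Type u} [CommRing S] {a b : S}
    (h : (Ideal.span {a, b}).IsRadical) {Z : Closeds (Spec (.of S))}
    (hZ : ∀ p : Spec (.of S), a ∈ p.asIdeal → b ∈ p.asIdeal → p ∈ Z) :
    vanishingIdeal Z ≤ pairIdeal (specFn (𝟙 _) a) (specFn (𝟙 _) b) := by
  rw [pairIdeal_eq, ← Set.image_pair, ← Ideal.map_span]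
  exact vanishingIdeal_le_ofIdealTop h fun p hp =>
    hZ p (hp (Ideal.subset_span (by simp))) (hp (Ideal.subset_span (by simp)))

end Vanishing

section Center

variable {X B : Space.{u}} {f : X ⟶ A1} {n : ℕ} {r : B ⟶ fib X f n} {W : Set (Pts X)}
  {Good : ChartClass X}

/-- The product of the blow-up of level `n` with the affine plane, in which the next blow-up takes
place. -/
abbrev splitSpace (r : B ⟶ fib X f n) : Space.{u} := prodA2 B (r ≫ fib.coord f n (Fin.last n))

/-- The centre of the next blow-up. -/
def center (r : B ⟶ fib X f n) (W : Set (Pts X)) : Closeds (Pts (splitSpace r)) :=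
  Closeds.closure (Pts.map (prodA2.toFib r ≫ fib.fst f (n + 1)) ⁻¹' W ∩ zeros (prodA2.snd _))

/-- Functions on a model chart of level `n` and on the affine plane. -/
abbrev ModelChart.SplitRing (M : ModelChart r Good) : Type u :=
  _root_.SplitRing M.S (M.t (Fin.last n))

/-- The chart of the product with the affine plane defined by a model chart. -/
def ModelChart.splitPt (M : ModelChart r Good) :
    (splitSpace r).obj (op (Spec (.of M.SplitRing))) :=
  (⟨B.map (Spec.map (CommRingCat.ofHom (SplitRing.incl (M.t (Fin.last n))))).op M.m,
    specFn (𝟙 _) (SplitRing.fst _), specFn (𝟙 _) (SplitRing.snd _), by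
      rw [fnAt_map, ← map_mul, SplitRing.fst_mul_snd]
      change pullFn _ ((r.app _ M.m).coord (Fin.last n)) = _
      rw [M.coord_eq, ← specFn_eq_pullFn, ← specFn_comp_map, Category.id_comp]⟩ : ProdA2Pt _ _ _)

/-- The first equation of the centre. -/
def ModelChart.eqn (M : ModelChart r Good) : M.SplitRing :=
  SplitRing.incl _ (M.str M.x)

theorem ModelChart.exists_factor_split (M : ModelChart r Good) {T : Scheme.{u}}
    (z : (splitSpace r).obj (op T)) (j : T ⟶ Spec (.of M.S)) (hj : z.pt = B.map j.op M.m) :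
    ∃ j' : T ⟶ Spec (.of M.SplitRing), z = (splitSpace r).map j'.op M.splitPt ∧
      (∀ s, specFn j' (SplitRing.incl _ s) = specFn j s) ∧
      specFn j' (SplitRing.fst _) = z.fst ∧ specFn j' (SplitRing.snd _) = z.snd := by
  have h1 : z.fst * z.snd = specFn j (M.t (Fin.last n)) := by
    rw [← z.eq, hj, fnAt_map]
    change pullFn _ ((r.app _ M.m).coord (Fin.last n)) = _
    rw [M.coord_eq, ← specFn_eq_pullFn]
  let g := SplitRing.lift (specFn j) _ _ h1
  have h2 : j = specHom g ≫ Spec.map (CommRingCat.ofHom (SplitRing.incl (M.t (Fin.last n)))) :=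
    specFn_injective (RingHom.ext fun s => by
      rw [specFn_comp_map, specFn_specHom, SplitRing.lift_incl])
  refine ⟨specHom g, ProdA2Pt.ext ?_ ?_ ?_, fun s => ?_, ?_, ?_⟩
  · rw [hj]
    conv_lhs => rw [h2]
    rw [op_comp, B.map_comp_apply]
    rfl
  · change _ = pullFn (specHom g) (specFn _ _)
    rw [← specFn_eq_pullFn, specFn_specHom, SplitRing.lift_fst]
  · change _ = pullFn (specHom g) (specFn _ _)
    rw [← specFn_eq_pullFn, specFn_specHom, SplitRing.lift_snd]
  · rw [specFn_specHom, SplitRing.lift_incl]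
  · rw [specFn_specHom, SplitRing.lift_fst]
  · rw [specFn_specHom, SplitRing.lift_snd]

theorem HasModels.exists_factor_split (hr : HasModels r Good) {T : Scheme.{u}}
    (z : (splitSpace r).obj (op T)) (p : T) :
    ∃ (T' : Scheme.{u}) (h : T' ⟶ T) (q : T'), Etale h ∧ h q = p ∧ IsAffine T' ∧
      ∃ (M : ModelChart r Good) (j : T' ⟶ Spec (.of M.SplitRing)),
        (splitSpace r).map h.op z = (splitSpace r).map j.op M.splitPt := by
  obtain ⟨T', h, q, h1, h2, h3, M, j, hj⟩ := hr.exists_factor z.pt p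
  obtain ⟨j', hj', -⟩ := M.exists_factor_split ((splitSpace r).map h.op z) j hj
  exact ⟨T', h, q, h1, h2, h3, M, j', hj'⟩

theorem ModelChart.pt_splitPt (M : ModelChart r Good) :
    (prodA2.toFib r ≫ fib.fst f (n + 1)).app _ M.splitPt =
      X.map (Spec.map (CommRingCat.ofHom ((SplitRing.incl (M.t (Fin.last n))).comp M.str))).op M.w := by
  change (r.app _ (B.map _ M.m)).pt = _
  rw [pt_map, M.pt_eq, ← X.map_comp_apply, ← op_comp, ← Spec.map_comp]
  rfl

theorem ModelChart.ptOf_splitPt (M : ModelChart r Good) (p : Spec (.of M.SplitRing)) :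
    Pts.map (prodA2.toFib r ≫ fib.fst f (n + 1)) (ptOf M.splitPt p) =
      ptOf M.w (Spec.map (CommRingCat.ofHom ((SplitRing.incl (M.t (Fin.last n))).comp M.str)) p) := by
  rw [Pts.map_ptOf, M.pt_splitPt, ptOf_map]

theorem ModelChart.radicalRegular_eqn (M : ModelChart r Good) :
    (Ideal.span {M.eqn, SplitRing.snd (M.t (Fin.last n))}).RadicalRegular
      (SplitRing.incl _ (M.str M.y)) :=
  radicalRegular_split (Ideal.subset_span (by simp)) ⟨1, (mul_one _).symm⟩ M.isModel.radicalRegular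

/-- The centre contains the subscheme of a model chart given by its equations. -/
theorem ModelChart.mem_center (hG : LocalEquations f W Good) (M : ModelChart r Good)
    (p : Spec (.of M.SplitRing)) (hx : M.eqn ∈ p.asIdeal)
    (hv : SplitRing.snd (M.t (Fin.last n)) ∈ p.asIdeal) : ptOf M.splitPt p ∈ center r W := by
  by_contra hp
  have hopen : IsOpen (ptOf M.splitPt ⁻¹' (center r W : Set _)ᶜ) :=
    (center r W).2.isOpen_compl.preimage (continuous_ptOf _)
  obtain ⟨_, ⟨g, rfl⟩, hpg, hg⟩ := PrimeSpectrum.isTopologicalBasis_basic_opens.exists_subset_of_mem_open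
    (show p ∈ _ from hp) hopen
  obtain ⟨hrad, hreg⟩ := M.radicalRegular_eqn
  set I := Ideal.span {M.eqn, SplitRing.snd (M.t (Fin.last n))} with hI
  -- Points of `V(I)` at which `y` does not vanish lie in the centre, where `g` vanishes. So `y g`
  -- vanishes on `V(I)`, and regularity of `y` modulo the radical ideal `I` gives `g ∈ I`,
  -- contradicting that `g` does not vanish at `p`.
  have key : SplitRing.incl _ (M.str M.y) * g ∈ I.radical := by
    rw [Ideal.radical_eq_sInf, Submodule.mem_sInf]
    rintro (P : Ideal M.SplitRing) ⟨hIP, hP⟩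
    by_cases hy : SplitRing.incl _ (M.str M.y) ∈ P
    · exact P.mul_mem_right _ hy
    refine P.mul_mem_left _ ?_
    by_contra hgP
    let P' : Spec (.of M.SplitRing) := ⟨P, hP⟩
    refine hg (show P' ∈ _ from hgP) (subset_closure ⟨?_, ?_⟩)
    · rw [Set.mem_preimage, M.ptOf_splitPt]
      exact hG.mem M.good _ (hIP (Ideal.subset_span (.inl rfl))) hy
    · rw [mem_zeros_ptOf]
      intro hc
      exact (mem_basicOpen_specFn (𝟙 _) _ P').1 hc (hIP (Ideal.subset_span (.inr rfl)))
  have h2 := hreg g (hrad key)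
  refine hpg ?_
  refine (Ideal.span_le.2 ?_ : I ≤ p.asIdeal) h2
  rintro _ (rfl | rfl)
  exacts [hx, hv]

/-- The equations of a model chart vanish on the centre. -/
theorem ModelChart.mem_of_mem_center (hG : LocalEquations f W Good) (M : ModelChart r Good)
    (p : Spec (.of M.SplitRing)) (hp : ptOf M.splitPt p ∈ center r W) :
    M.eqn ∈ p.asIdeal ∧ SplitRing.snd (M.t (Fin.last n)) ∈ p.asIdeal := by
  have h1 : (center r W : Set _) ⊆
      Pts.map (prodA2.toFib r ≫ fib.fst f (n + 1)) ⁻¹' closure W ∩ zeros (prodA2.snd _) :=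
    closure_minimal (Set.inter_subset_inter_left _ (Set.preimage_mono subset_closure))
      ((isClosed_closure.preimage (Pts.continuous_map _)).inter (isClosed_zeros _))
  obtain ⟨h2, h3⟩ := h1 hp
  constructor
  · rw [Set.mem_preimage, M.ptOf_splitPt] at h2
    exact hG.mem_closure M.good _ h2
  · rw [mem_zeros_ptOf] at h3
    by_contra hc
    exact h3 ((mem_basicOpen_specFn (𝟙 _) _ p).2 hc)

/-- On the product with the affine plane, the ideal of the centre of the next blow-up is generated
by the two equations of a model chart. -/
theorem HasModels.comap_center (hr : HasModels r Good) (hG : LocalEquations f W Good)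
    {U P : Scheme.{u}} {e : (splitSpace r).obj (op U)} (he : IsEtaleChart e) (q : P ⟶ U)
    (M : ModelChart r Good) (j : P ⟶ Spec (.of M.SplitRing))
    (h : (splitSpace r).map q.op e = (splitSpace r).map j.op M.splitPt) :
    (reducedIdeal (center r W) e).comap q =
      pairIdeal (specFn j M.eqn) (specFn j (SplitRing.snd _)) := by
  apply le_antisymm
  -- The zero set of the pair lies in the centre and the pair generates a radical ideal, which
  -- therefore contains the reduced ideal of the centre.
  · refine (reducedIdeal_comap_le he M.splitPt q j h).trans ?_
    rw [specFn_eq_pullFn j, specFn_eq_pullFn j, ← comap_pairIdeal]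
    refine comap_mono _ (vanishingIdeal_le_pairIdeal M.radicalRegular_eqn.1 fun p hx hv => ?_)
    exact M.mem_center hG p hx hv
  -- Conversely the equations vanish on the centre. Reduced ideals pull back well only to schemes
  -- étale over `U`, so étale locally `e` itself is factored through a model chart `M'`. By `compat`
  -- its first equation generates the same ideal as that of `M`.
  · refine ideal_le_of_etale_local fun p => ?_
    obtain ⟨U', h', q', hh', hq', -, M', j', hj'⟩ := hr.exists_factor_split e (q p)
    obtain ⟨z, hz, hz'⟩ := Scheme.Pullback.exists_preimage_pullback p q' hq'.symm
    refine ⟨pullback q h', pullback.fst _ _, z, inferInstance, hz, ?_⟩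
    have h1 : (splitSpace r).map (pullback.fst q h' ≫ j).op M.splitPt =
        (splitSpace r).map (pullback.snd q h' ≫ j').op M'.splitPt := by
      rw [op_comp, Functor.map_comp_apply, ← h, ← Functor.map_comp_apply, ← op_comp,
        pullback.condition, op_comp, Functor.map_comp_apply, hj', op_comp, Functor.map_comp_apply]
    have h2 : ofIdealTop (Ideal.span {specFn (pullback.fst q h' ≫ j) M.eqn}) =
        ofIdealTop (Ideal.span {specFn (pullback.snd q h' ≫ j') M'.eqn}) := by
      have h3 := congrArg ((prodA2.toFib r ≫ fib.fst f (n + 1)).app _) h1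
      rw [app_map, app_map, M.pt_splitPt, M'.pt_splitPt, ← X.map_comp_apply, ← X.map_comp_apply,
        ← op_comp, ← op_comp] at h3
      have h4 := hG.compat M.good M'.good _ _ h3
      rwa [specFn_comp_map, specFn_comp_map] at h4
    have h5 : specFn (pullback.fst q h' ≫ j) (SplitRing.snd _) =
        specFn (pullback.snd q h' ≫ j') (SplitRing.snd _) := by
      have h6 := congrArg ProdA2Pt.snd h1
      change pullFn _ (specFn _ _) = pullFn _ (specFn _ _) at h6
      rwa [← specFn_eq_pullFn, ← specFn_eq_pullFn] at h6
    rw [comap_pairIdeal, ← specFn_comp, ← specFn_comp, pairIdeal, h2, h5, ← comap_comp,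
      pullback.condition, comap_comp, ← reducedIdeal_map e h']
    refine le_trans ?_ (comap_mono (pullback.snd q h') (sup_le
      (a := ofIdealTop (Ideal.span {specFn j' M'.eqn}))
      (b := ofIdealTop (Ideal.span {specFn j' (SplitRing.snd (M'.t (Fin.last n)))})) ?_ ?_))
    · dsimp only
      rw [comap_sup, comap_ofIdealTop_span, comap_ofIdealTop_span]
      rfl
    · refine ofIdealTop_le_vanishingIdeal fun p hp hc => ?_
      rw [hj'] at hp
      have hp : ptOf ((splitSpace r).map j'.op M'.splitPt) p ∈ center r W := hp
      rw [ptOf_map] at hp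
      exact (mem_basicOpen_specFn _ _ _).1 hc (M'.mem_of_mem_center hG _ hp).1
    · refine ofIdealTop_le_vanishingIdeal fun p hp hc => ?_
      rw [hj'] at hp
      have hp : ptOf ((splitSpace r).map j'.op M'.splitPt) p ∈ center r W := hp
      rw [ptOf_map] at hp
      exact (mem_basicOpen_specFn _ _ _).1 hc (M'.mem_of_mem_center hG _ hp).2

end Center

end ExpDeg

end

/-! ### The effect of one blow-up on the local models. -/

noncomputable section

namespace ExpDeg

open Scheme.IdealSheafData

section Step

variable {X B' B : Space.{u}} {f : X ⟶ A1} {n : ℕ} {r : B' ⟶ fib X f n} {W : Set (Pts X)}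
  {Good : ChartClass X}

theorem PreimageCartier.map {F : Space.{u}} {Z : Closeds (Pts F)} {T T' : Scheme.{u}}
    {x : F.obj (op T)} (hx : PreimageCartier Z x) (h : T' ⟶ T) [Etale h] :
    PreimageCartier Z (F.map h.op x) := by
  intro P U g e q hg he hq
  refine hx P U (g ≫ h) e q inferInstance he ?_
  rw [hq, op_comp, F.map_comp_apply]

/-- Being Cartier is étale local, and by `comap_center` the pullback of the centre is generated by
the two functions of a model chart. -/
theorem HasModels.preimageCartier (hr : HasModels r Good) (hG : LocalEquations f W Good)
    {T : Scheme.{u}} (z : (splitSpace r).obj (op T))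
    (h : ∀ p : T, ∃ (T' : Scheme.{u}) (g : T' ⟶ T) (q : T'), Etale g ∧ g q = p ∧
      ∃ (M : ModelChart r Good) (j : T' ⟶ Spec (.of M.SplitRing)),
        (splitSpace r).map g.op z = (splitSpace r).map j.op M.splitPt ∧
        SchemeCartierPair (specFn j M.eqn) (specFn j (SplitRing.snd _))) :
    PreimageCartier (center r W) z := by
  intro P U g e q hg he hq
  refine isCartier_of_etale_local fun p => ?_
  obtain ⟨T', g', q', hg', hq', M, j, hj, hc⟩ := h (g p)
  obtain ⟨s, hs, hs'⟩ := Scheme.Pullback.exists_preimage_pullback p q' hq'.symm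
  obtain ⟨P', h, s', hh, hs'', haff⟩ := exists_affine_nbhd (pullback g g') s
  refine ⟨P', h ≫ pullback.fst _ _, s', inferInstance, ?_, ?_⟩
  · rw [Scheme.Hom.comp_apply, hs'', hs]
  · rw [← comap_comp, hr.comap_center hG he _ M ((h ≫ pullback.snd _ _) ≫ j), specFn_comp,
      specFn_comp]
    · exact (hc.pullFn (h ≫ pullback.snd g g')).isCartier
    · have h1 : (h ≫ pullback.fst g g') ≫ g = (h ≫ pullback.snd g g') ≫ g' := by
        rw [Category.assoc, pullback.condition, Category.assoc]
      rw [op_comp, Functor.map_comp_apply, hq, ← Functor.map_comp_apply, ← op_comp, h1, op_comp,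
        Functor.map_comp_apply, hj, ← Functor.map_comp_apply, ← op_comp]

/-- The Cartier condition refers to étale charts of the ambient space, which are provided by
`exists_chart_prodA2`. Since a pair of functions generates the Cartier ideal, one of them divides
the other étale locally. -/
theorem HasModels.exists_schemeCartierPair (hr : HasModels r Good) (hG : LocalEquations f W Good)
    (hB : IsAlgebraicSpace B') {T : Scheme.{u}} (z : (splitSpace r).obj (op T))
    (hz : PreimageCartier (center r W) z) (p : T) :
    ∃ (T' : Scheme.{u}) (g : T' ⟶ T) (q : T'), Etale g ∧ g q = p ∧ IsAffine T' ∧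
      ∃ (M : ModelChart r Good) (j : T' ⟶ Spec (.of M.SplitRing)),
        (splitSpace r).map g.op z = (splitSpace r).map j.op M.splitPt ∧
        SchemeCartierPair (specFn j M.eqn) (specFn j (SplitRing.snd _)) := by
  obtain ⟨T₁, h₁, q₁, U, e, c, hh₁, rfl, hU, he, hc⟩ := hB.exists_chart z.pt p
  obtain ⟨P, e', he', hP⟩ := exists_chart_prodA2 (g := r ≫ fib.coord f n (Fin.last n)) he
  obtain ⟨c', hc'⟩ := hP ((splitSpace r).map h₁.op z) c hc
  obtain ⟨T₂, h₂, q₂, hh₂, rfl, -, M, j, hj⟩ :=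
    hr.exists_factor_split ((splitSpace r).map h₁.op z) q₁
  have h1 := hz T₂ P (h₂ ≫ h₁) e' (h₂ ≫ c') inferInstance he' (by
    rw [op_comp, Functor.map_comp_apply, hc', op_comp, Functor.map_comp_apply])
  rw [hr.comap_center hG he' _ M j (by rw [op_comp, Functor.map_comp_apply, hc', hj])] at h1
  obtain ⟨T₃, h₃, q₃, hh₃, rfl, haff, h2⟩ := ExpDeg.exists_schemeCartierPair h1 q₂
  refine ⟨T₃, h₃ ≫ h₂ ≫ h₁, q₃, inferInstance, rfl, haff, M, h₃ ≫ j, ?_, h2⟩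
  rw [op_comp, op_comp, Functor.map_comp_apply, Functor.map_comp_apply, hj, op_comp,
    Functor.map_comp_apply]

theorem schemeCartierPair_specFn {S : Type u} [CommRing S] {a b : S} (h : CartierPair a b) :
    SchemeCartierPair (specFn (𝟙 (Spec (.of S))) a) (specFn (𝟙 (Spec (.of S))) b) := by
  rcases h with ⟨h1, h2⟩ | ⟨h1, h2⟩
  · exact .inl ⟨isRegularFn_specFn_id h1, map_dvd _ h2⟩
  · exact .inr ⟨isRegularFn_specFn_id h1, map_dvd _ h2⟩

theorem toFib_coord (r : B' ⟶ fib X f n) {T : Scheme.{u}} (z : (splitSpace r).obj (op T)) :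
    ((prodA2.toFib r).app _ z).coord = splitLast (r.app _ z.pt).coord z.fst z.snd := rfl

theorem toFib_pt (r : B' ⟶ fib X f n) {T : Scheme.{u}} (z : (splitSpace r).obj (op T)) :
    ((prodA2.toFib r).app _ z).pt = (r.app _ z.pt).pt := rfl

theorem split_eq (r : B' ⟶ fib X f n) {T : Scheme.{u}} (z : (splitSpace r).obj (op T)) :
    (r.app _ z.pt).coord (Fin.last n) = z.fst * z.snd := z.eq

/-- Sections of the product with the affine plane are determined by their coordinates, if these are
regular. -/
theorem HasModels.ext_split (hr : HasModels r Good) {T : Scheme.{u}}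
    (z z' : (splitSpace r).obj (op T))
    (h : (prodA2.toFib r).app _ z = (prodA2.toFib r).app _ z')
    (hreg : ∀ i, IsRegularFn (((prodA2.toFib r).app _ z).coord i)) : z = z' := by
  have hc := congrArg FibPt.coord h
  rw [toFib_coord, toFib_coord] at hc
  rw [toFib_coord] at hreg
  have h1 : z.fst = z'.fst := by simpa using congrFun hc (Fin.last n).castSucc
  have h2 : z.snd = z'.snd := by simpa using congrFun hc (Fin.last _)
  refine ProdA2Pt.ext (hr.ext _ _ (FibPt.ext (congrArg FibPt.pt h :) (funext fun i => ?_))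
    fun i => ?_) h1 h2
  · refine Fin.lastCases ?_ (fun i => ?_) i
    · rw [split_eq, split_eq, h1, h2]
    · simpa using congrFun hc i.castSucc.castSucc
  · refine Fin.lastCases ?_ (fun i => ?_) i
    · rw [split_eq]
      exact IsRegularFn.mul (by simpa using hreg (Fin.last n).castSucc)
        (by simpa using hreg (Fin.last _))
    · simpa using hreg i.castSucc.castSucc

/-- One step of the iterated blow-up. -/
theorem HasModels.step (hr : HasModels r Good) (hG : LocalEquations f W Good)
    (hB' : IsAlgebraicSpace B') (b : B ⟶ splitSpace r) (hb : IsBlowup b (center r W)) :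
    HasModels (b ≫ prodA2.toFib r) Good := by
  have huniq {T : Scheme.{u}} {y y' : B.obj (op T)} (h : b.app _ y = b.app _ y')
      (hc : PreimageCartier (center r W) (b.app _ y)) : y = y' :=
    (hb.existsUnique_lift T _ hc).unique rfl h.symm
  -- the point of a model chart, its image in the product with the affine plane
  have hmodel {R S : Type u} [CommRing R] [CommRing S] {w : X.obj (op (Spec (.of R)))}
      {x y : R} {k : ℕ} {str : R →+* S} {t : Fin (n + 2) → S} {a b : S} (hg : Good R w x y)
      (hm : IsModel x y (n + 1) k str t a b) : ∃ z : (splitSpace r).obj (op (Spec (.of S))),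
        ((prodA2.toFib r).app _ z).pt = X.map (Spec.map (CommRingCat.ofHom str)).op w ∧
        (∀ i, ((prodA2.toFib r).app _ z).coord i = specFn (𝟙 _) (t i)) ∧
        ∃ (M : ModelChart r Good) (j : Spec (.of S) ⟶ Spec (.of M.SplitRing)),
          z = (splitSpace r).map j.op M.splitPt ∧ specFn j M.eqn = specFn (𝟙 _) (str x) ∧
            specFn j (SplitRing.snd _) = specFn (𝟙 _) (t (Fin.last _)) := by
    obtain ⟨j, S₀, _, str₀, t₀, a₀, b₀, g, hm₀, hg1, hg2, hg3⟩ :=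
      hm.exists_refinement (hG.mul_mem hg) (hG.radicalRegular hg)
    obtain ⟨m₀, h1, h2⟩ := hr.exists_point hg hm₀
    let M : ModelChart r Good := ⟨w, x, y, j, str₀, t₀, a₀, b₀, m₀, hg, hm₀, h1, h2⟩
    let s : Spec (.of S) ⟶ Spec (.of S₀) := Spec.map (CommRingCat.ofHom g)
    have hs (c : S₀) : pullFn s (specFn (𝟙 _) c) = specFn (𝟙 _) (g c) := by
      rw [← specFn_eq_pullFn, ← specFn_comp_map, Category.id_comp]
    have hs1 : r.app _ (B'.map s.op m₀) = (fib X f n).map s.op (r.app _ m₀) := app_map _ _ _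
    let z : (splitSpace r).obj (op (Spec (.of S))) := (⟨B'.map s.op m₀,
      specFn (𝟙 _) (t (Fin.last n).castSucc), specFn (𝟙 _) (t (Fin.last _)), by
        change (r.app _ (B'.map s.op m₀)).coord (Fin.last n) = _
        rw [coord_map, h2, hs, ← map_mul, hg2]⟩ : ProdA2Pt _ _ _)
    have hz0 : z.pt = B'.map s.op m₀ := rfl
    obtain ⟨j', hj1, hj2, -, hj3⟩ := M.exists_factor_split z s rfl
    refine ⟨z, ?_, fun i => ?_, M, j', hj1, ?_, hj3⟩
    · have : g.comp str₀ = str := RingHom.ext hg1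
      rw [toFib_pt, hz0, pt_map, h1, ← X.map_comp_apply, ← op_comp, ← Spec.map_comp,
        ← CommRingCat.ofHom_comp, this]
    · rw [hg3, toFib_coord, map_splitLast]
      congr 1
      ext i
      rw [hz0, coord_map, h2, hs]
    · rw [ModelChart.eqn, hj2, specFn_eq_pullFn, hs, hg1]
  -- On a chart of level `n + 1` one of `x` and the last coordinate divides the other, so the
  -- universal property of the blow-up lifts the point found above.
  have hpoint {R S : Type u} [CommRing R] [CommRing S] {w : X.obj (op (Spec (.of R)))}
      {x y : R} {k : ℕ} {str : R →+* S} {t : Fin (n + 2) → S} {a b' : S} (hg : Good R w x y)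
      (hm : IsModel x y (n + 1) k str t a b') : ∃ m : B.obj (op (Spec (.of S))),
        ((b ≫ prodA2.toFib r).app _ m).pt = X.map (Spec.map (CommRingCat.ofHom str)).op w ∧
        (∀ i, ((b ≫ prodA2.toFib r).app _ m).coord i = specFn (𝟙 _) (t i)) := by
    obtain ⟨z, hz1, hz2, M, j, hj, hj1, hj2⟩ := hmodel hg hm
    have hc : PreimageCartier (center r W) z := by
      refine hr.preimageCartier hG z fun p => ⟨_, 𝟙 _, p, inferInstance, rfl, M, j, ?_, ?_⟩
      · rw [← hj]; simp
      · rw [hj1, hj2]; exact schemeCartierPair_specFn hm.cartierPair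
    obtain ⟨m, hm, -⟩ := hb.existsUnique_lift _ z hc
    refine ⟨m, ?_, fun i => ?_⟩
    · rw [← hz1, ← hm]; rfl
    · rw [← hz2, ← hm]; rfl
  -- On étale charts of the blow-up the preimage of the centre is Cartier. So `exists_factorization`
  -- yields a chart of level `n + 1` through which they factor, up to the uniqueness of lifts to the
  -- blow-up.
  have hchart {U : Scheme.{u}} (e : B.obj (op U)) (he : IsEtaleChart e) (p : U) :
      ∃ (T' : Scheme.{u}) (h : T' ⟶ U) (q : T'), Etale h ∧ h q = p ∧
        ∃ (M : ModelChart (b ≫ prodA2.toFib r) Good) (j : T' ⟶ Spec (.of M.S)),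
          B.map h.op e = B.map j.op M.m := by
    obtain ⟨T₃, h, q₃, hh₃, hq₃, haff, M, j₃, hj, hpair⟩ :=
      hr.exists_schemeCartierPair hG hB' _ (hb.preimageCartier U e he) p
    set y₃ := B.map h.op e with hy₃
    have hz₃ : b.app _ y₃ = (splitSpace r).map j₃.op M.splitPt := by
      rw [hy₃, app_map, hj]
    have hcart : PreimageCartier (center r W) (b.app _ y₃) := by
      rw [hy₃, app_map]
      exact (hb.preimageCartier U e he).map _
    let i : T₃ ⟶ Spec (.of M.S) :=
      j₃ ≫ Spec.map (CommRingCat.ofHom (SplitRing.incl (M.t (Fin.last n))))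
    have hi (s : M.S) : specFn i s = specFn j₃ (SplitRing.incl _ s) := specFn_comp_map _ _ _
    have hpt₃ : (b.app _ y₃).pt = B'.map i.op M.m := by
      rw [op_comp, B'.map_comp_apply, hz₃]; rfl
    have hfst : (b.app _ y₃).fst = specFn j₃ (SplitRing.fst _) := by
      rw [hz₃, specFn_eq_pullFn]; rfl
    have hsnd : (b.app _ y₃).snd = specFn j₃ (SplitRing.snd _) := by
      rw [hz₃, specFn_eq_pullFn]; rfl
    obtain ⟨k, S', _, str', t', a', b', ι, u', v', g', hm', ht', huv', hι, hg', hu', hv'⟩ :=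
      M.isModel.exists_factorization (specFn i) (specFn j₃ (SplitRing.fst _))
        (specFn j₃ (SplitRing.snd _)) (by rw [← map_mul, SplitRing.fst_mul_snd, hi]) (by
          rw [hi]; exact hpair.cartierPair)
    obtain ⟨m, hm1, hm2⟩ := hpoint M.good hm'
    refine ⟨T₃, h, q₃, hh₃, hq₃,
      ⟨M.w, M.x, M.y, k, str', t', a', b', m, M.good, hm', hm1, hm2⟩, specHom g', ?_⟩
    let s : Spec (.of S') ⟶ Spec (.of M.S) := Spec.map (CommRingCat.ofHom ι)
    have hs (c : M.S) : pullFn s (specFn (𝟙 _) c) = specFn (𝟙 _) (ι c) := by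
      rw [← specFn_eq_pullFn, ← specFn_comp_map, Category.id_comp]
    let z' : (splitSpace r).obj (op (Spec (.of S'))) := (⟨B'.map s.op M.m,
      specFn (𝟙 _) u', specFn (𝟙 _) v', by
        change (r.app _ (B'.map s.op M.m)).coord (Fin.last n) = _
        rw [coord_map, M.coord_eq, hs, ← map_mul, huv']⟩ : ProdA2Pt _ _ _)
    have hz0 : z'.pt = B'.map s.op M.m := rfl
    have hmz : b.app _ m = z' := by
      refine hr.ext_split _ _ (FibPt.ext ?_ (funext fun l => ?_)) fun l => ?_
      · refine hm1.trans ?_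
        have : ι.comp M.str = str' := RingHom.ext hι
        rw [toFib_pt, hz0, pt_map, M.pt_eq, ← X.map_comp_apply, ← op_comp, ← Spec.map_comp,
          ← CommRingCat.ofHom_comp, this]
      · refine (hm2 l).trans ?_
        rw [ht', toFib_coord, map_splitLast]
        congr 1
        ext l
        rw [hz0, coord_map, M.coord_eq, hs]
      · have : IsRegularFn (specFn (𝟙 _) (t' l)) := isRegularFn_specFn_id (hm'.t_mem l)
        rwa [← hm2 l] at this
    refine huniq ?_ hcart
    have hsi : specHom g' ≫ s = i := specFn_injective (RingHom.ext fun c => by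
      rw [specFn_comp_map, specFn_specHom, hg'])
    refine Eq.trans ?_ (app_map b (specHom g') m).symm
    rw [hmz]
    refine ProdA2Pt.ext ?_ ?_ ?_
    · rw [hpt₃, ← hsi, op_comp, B'.map_comp_apply]
      rfl
    · rw [hfst, ← hu']
      change _ = pullFn (specHom g') (specFn _ _)
      rw [← specFn_eq_pullFn, specFn_specHom]
    · rw [hsnd, ← hv']
      change _ = pullFn (specHom g') (specFn _ _)
      rw [← specFn_eq_pullFn, specFn_specHom]
  have hfactor {T : Scheme.{u}} (y : B.obj (op T)) (p : T) :
      ∃ (T' : Scheme.{u}) (h : T' ⟶ T) (q : T'), Etale h ∧ h q = p ∧ IsAffine T' ∧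
        ∃ (M : ModelChart (b ≫ prodA2.toFib r) Good) (j : T' ⟶ Spec (.of M.S)),
          B.map h.op y = B.map j.op M.m := by
    obtain ⟨T₁, h₁, q₁, U, e, c, hh₁, rfl, hU, he, hc⟩ := hb.isAlgebraicSpace.exists_chart y p
    obtain ⟨T₂, h₂, q₂, hh₂, hq₂, M, j, hj⟩ := hchart e he (c q₁)
    obtain ⟨z, hz, hz'⟩ := Scheme.Pullback.exists_preimage_pullback q₁ q₂ hq₂.symm
    obtain ⟨T₃, h₃, q₃, hh₃, rfl, haff₃⟩ := exists_affine_nbhd (pullback c h₂) z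
    refine ⟨T₃, (h₃ ≫ pullback.fst c h₂) ≫ h₁, q₃, inferInstance, ?_, haff₃, M,
      (h₃ ≫ pullback.snd c h₂) ≫ j, ?_⟩
    · rw [Scheme.Hom.comp_apply, Scheme.Hom.comp_apply, hz]
    · rw [op_comp, B.map_comp_apply, ← hc, ← B.map_comp_apply, ← op_comp, Category.assoc,
        pullback.condition, ← Category.assoc, op_comp, B.map_comp_apply, hj, ← B.map_comp_apply,
        ← op_comp]
  refine ⟨hpoint, hfactor, ?_⟩
  intro T y y' h hreg
  have hz : b.app _ y = b.app _ y' := hr.ext_split _ _ h hreg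
  -- Regularity of the last coordinate `v` suffices: if `v` divides `x` it is the generator, and if
  -- `x` divides `v` then `x` is regular too. Hence the preimage of the centre is Cartier and the
  -- lift is unique.
  refine huniq hz (hr.preimageCartier hG _ fun p => ?_)
  obtain ⟨T', h', q, hh', hq, haff, M, j, hj⟩ := hfactor y p
  obtain ⟨z, hz1, hz2, M₀, j₀, hj₀, hj1, hj2⟩ := hmodel M.good M.isModel
  have hMz : b.app _ M.m = z := by
    refine hr.ext_split _ _ (FibPt.ext ?_ (funext fun l => ?_)) fun l => ?_
    · exact M.pt_eq.trans hz1.symm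
    · exact (M.coord_eq l).trans (hz2 l).symm
    · have : IsRegularFn (specFn (𝟙 _) (M.t l)) := isRegularFn_specFn_id (M.isModel.t_mem l)
      rwa [← M.coord_eq l] at this
  refine ⟨T', h', q, hh', hq, M₀, j ≫ j₀, ?_, ?_⟩
  · rw [← app_map, hj, app_map, hMz, hj₀, ← Functor.map_comp_apply, ← op_comp]
  · rw [specFn_comp, specFn_comp, hj1, hj2, ← specFn_eq_pullFn, ← specFn_eq_pullFn]
    have hlast : IsRegularFn (specFn j (M.t (Fin.last _))) := by
      have := (hreg (Fin.last _)).pullFn h'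
      rw [← coord_map, hj, coord_map, M.coord_eq, ← specFn_eq_pullFn] at this
      exact this
    rcases M.isModel.cartierPair with ⟨-, h2⟩ | ⟨-, h2⟩
    · exact .inl ⟨hlast, map_dvd _ h2⟩
    · exact .inr ⟨hlast.of_dvd (map_dvd _ h2), map_dvd _ h2⟩

/-- The iterated blow-up is étale locally given by the local models. -/
theorem hasModels_of_isIteratedBlowup {Y D : Set (Pts X)} (hG : LocalEquations f (Y \ D) Good) :
    ∀ (n : ℕ) (B : Space.{u}) (r : B ⟶ fib X f n), IsIteratedBlowup f Y D n B r → HasModels r Good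
  | 0, B, r, h => by
    have : IsIso r := h
    refine hasModels_of_isIso r hG fun {R O _ _ w x y} φ t _ ht => ⟨0, le_rfl, φ x, φ y, ?_, ?_, ?_⟩
    · simp
    · simp
    · intro i _
      rw [Fin.fin_one_eq_zero i, ← map_mul, ht]
      simp
  | n + 1, B, r, ⟨B', r', hB', hr', b, hb, hbr⟩ => by
    subst hbr
    exact (hasModels_of_isIteratedBlowup hG n B' r' hr').step hG hB' b hb

end Step

end ExpDeg

end

/-! ### Coordinate ideals of polynomial rings and their étale extensions. -/

noncomputable section

open TensorProduct

theorem RingHom.nonempty_quotient_ringEquiv {R S : Type*} [CommRing R] [CommRing S] {κ : R →+* S}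
    (hκ : Function.Surjective κ) {I : Ideal R} (h : ∀ a, κ a = 0 ↔ a ∈ I) :
    Nonempty (R ⧸ I ≃+* S) := by
  obtain rfl : RingHom.ker κ = I := Ideal.ext h
  exact ⟨RingHom.quotientKerEquivOfSurjective hκ⟩

namespace MvPolynomial

variable {ι k : Type u} [Field k] (B : Set ι)

theorem exists_killing :
    ∃ κ : MvPolynomial ι k →ₐ[k] MvPolynomial {i // i ∉ B} k, (∀ i ∈ B, κ (X i) = 0) ∧
      ∀ i : {i // i ∉ B}, κ (X i.1) = X i := by
  classical
  refine ⟨aeval fun i => if h : i ∉ B then X ⟨i, h⟩ else 0, fun i hi => ?_, fun i => ?_⟩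
  · rw [aeval_X, dif_neg (not_not.2 hi)]
  · rw [aeval_X, dif_pos i.2]

/-- The ideal generated by some of the variables is the kernel of the map killing them. -/
theorem exists_eq_zero_iff_mem_span_X :
    ∃ κ : MvPolynomial ι k →+* MvPolynomial {i // i ∉ B} k, Function.Surjective κ ∧
      (∀ p, κ p = 0 ↔ p ∈ Ideal.span (X '' B)) ∧ ∀ i : {i // i ∉ B}, κ (X i.1) = X i := by
  obtain ⟨κ, hB, hB'⟩ := exists_killing (k := k) B
  let σ : MvPolynomial {i // i ∉ B} k →ₐ[k] MvPolynomial ι k := rename (↑)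
  have hren (p) : κ (σ p) = p := by
    have : κ.comp σ = AlgHom.id k _ := algHom_ext fun i => by
      rw [AlgHom.comp_apply, rename_X, hB']; rfl
    exact congrArg (fun φ => φ p) this
  have key (p : MvPolynomial ι k) : p - σ (κ p) ∈ Ideal.span (X '' B) := by
    induction p using MvPolynomial.induction_on with
    | C a =>
      have h1 : σ (κ (C a)) = C a := (congrArg σ (κ.commutes a)).trans (σ.commutes a)
      rw [h1, sub_self]
      exact zero_mem _
    | add p q hp hq =>
      rw [map_add, map_add]
      have := add_mem hp hq
      rwa [show p + q - (σ (κ p) + σ (κ q)) = p - σ (κ p) + (q - σ (κ q)) by ring]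
    | mul_X p i hp =>
      rw [map_mul, map_mul]
      by_cases hi : i ∈ B
      · rw [hB i hi, map_zero, mul_zero, sub_zero]
        exact Ideal.mul_mem_left _ _ (Ideal.subset_span ⟨i, hi, rfl⟩)
      · have h1 : σ (κ (X i)) = X i := by rw [hB' ⟨i, hi⟩]; exact rename_X _ _
        rw [h1, ← sub_mul]
        exact Ideal.mul_mem_right _ _ hp
  have hle : Ideal.span (X '' B) ≤ RingHom.ker κ := by
    rw [Ideal.span_le]
    rintro _ ⟨i, hi, rfl⟩
    exact hB i hi
  refine ⟨(κ : _ →+* _), fun p => ⟨σ p, hren p⟩, fun p => ⟨fun hp => ?_, fun hp => hle hp⟩, hB'⟩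
  have h1 : κ p = 0 := hp
  have := key p
  rwa [h1, map_zero, sub_zero] at this

theorem isDomain_quotient_span_X : IsDomain (MvPolynomial ι k ⧸ Ideal.span (X (R := k) '' B)) := by
  obtain ⟨κ, h1, h2, -⟩ := exists_eq_zero_iff_mem_span_X (k := k) B
  obtain ⟨e⟩ := RingHom.nonempty_quotient_ringEquiv h1 h2
  exact e.toMulEquiv.isDomain

theorem isIntegrallyClosed_quotient_span_X :
    IsIntegrallyClosed (MvPolynomial ι k ⧸ Ideal.span (X (R := k) '' B)) := by
  obtain ⟨κ, h1, h2, -⟩ := exists_eq_zero_iff_mem_span_X (k := k) B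
  obtain ⟨e⟩ := RingHom.nonempty_quotient_ringEquiv h1 h2
  exact IsIntegrallyClosed.of_equiv e.symm

theorem X_notMem_span_X {i : ι} (hi : i ∉ B) : X i ∉ Ideal.span (X (R := k) '' B) := by
  obtain ⟨κ, -, h2, h3⟩ := exists_eq_zero_iff_mem_span_X (k := k) B
  rw [← h2, h3 ⟨i, hi⟩]
  exact X_ne_zero _

end MvPolynomial

section EtaleQuotient

variable {S R : Type u} [CommRing S] [CommRing R] [Algebra S R] [Algebra.Etale S R] {I : Ideal S}

/-- `R / I R` is étale over the normal domain `S / I`, so its local rings are domains. If `p` does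
not contain `I R`, an element of `I R` outside `p` works. -/
theorem Algebra.Etale.exists_notMem_mul_mem_map [IsDomain (S ⧸ I)] [IsIntegrallyClosed (S ⧸ I)]
    (p : Ideal R) [hp : p.IsPrime] {a b : R} (hab : a * b ∈ I.map (algebraMap S R)) :
    ∃ s ∉ p, s * a ∈ I.map (algebraMap S R) ∨ s * b ∈ I.map (algebraMap S R) := by
  by_cases hI : I.map (algebraMap S R) ≤ p
  · let e := (Algebra.TensorProduct.quotIdealMapEquivQuotTensor R I)
    let ψ : R →+* (S ⧸ I) ⊗[S] R := e.toRingEquiv.toRingHom.comp (Ideal.Quotient.mk (I.map (algebraMap S R)))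
    have hψ (a : R) : ψ a = 0 ↔ a ∈ I.map (algebraMap S R) := by
      rw [← Ideal.Quotient.eq_zero_iff_mem]
      exact ⟨fun h => e.injective (h.trans (map_zero e).symm),
      fun h => (congrArg e h).trans (map_zero e)⟩
    have hsurj : Function.Surjective ψ := e.surjective.comp Ideal.Quotient.mk_surjective
    have hker : RingHom.ker ψ ≤ p := fun a ha => hI ((hψ a).1 ha)
    have := Ideal.map_isPrime_of_surjective hsurj hker
    obtain ⟨s, hs, h⟩ := Algebra.Etale.exists_notMem_mul_eq_zero (R := S ⧸ I) (p.map ψ)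
      (a := ψ a) (b := ψ b) (by rw [← map_mul, hψ]; exact hab)
    obtain ⟨s, rfl⟩ := hsurj s
    refine ⟨s, fun h => hs (Ideal.mem_map_of_mem _ h), ?_⟩
    rwa [← map_mul, ← map_mul, hψ, hψ] at h
  · obtain ⟨s, hs, hsp⟩ := SetLike.not_le_iff_exists.1 hI
    exact ⟨s, hsp, .inl (Ideal.mul_mem_right _ _ hs)⟩

/-- `R / I R` is flat over `S / I`, so `c` remains regular. -/
theorem Algebra.Etale.mem_map_of_mul_mem {c : S}
    (hc : ∀ a, c * a ∈ I → a ∈ I) {a : R}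
    (h : algebraMap S R c * a ∈ I.map (algebraMap S R)) : a ∈ I.map (algebraMap S R) := by
  let e := (Algebra.TensorProduct.quotIdealMapEquivQuotTensor R I)
  let ψ : R →+* (S ⧸ I) ⊗[S] R := e.toRingEquiv.toRingHom.comp (Ideal.Quotient.mk (I.map (algebraMap S R)))
  have hψ (a : R) : ψ a = 0 ↔ a ∈ I.map (algebraMap S R) := by
    rw [← Ideal.Quotient.eq_zero_iff_mem]
    exact ⟨fun h => e.injective (h.trans (map_zero e).symm),
      fun h => (congrArg e h).trans (map_zero e)⟩
  have hfl : (algebraMap (S ⧸ I) ((S ⧸ I) ⊗[S] R)).Flat := by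
    rw [RingHom.flat_algebraMap_iff]
    infer_instance
  have hcI : Ideal.Quotient.mk I c ∈ nonZeroDivisors (S ⧸ I) := by
    rw [mem_nonZeroDivisors_iff_right]
    intro x hx
    obtain ⟨x, rfl⟩ := Ideal.Quotient.mk_surjective x
    rw [← map_mul, Ideal.Quotient.eq_zero_iff_mem] at hx
    exact Ideal.Quotient.eq_zero_iff_mem.2 (hc x (by rwa [mul_comm]))
  have h1 := hfl.map_mem_nonZeroDivisors hcI
  have h2 : ψ (algebraMap S R c) = algebraMap (S ⧸ I) ((S ⧸ I) ⊗[S] R) (Ideal.Quotient.mk I c) := by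
    have h3 : ψ (algebraMap S R c) = e (algebraMap (S ⧸ I) _ (Ideal.Quotient.mk I c)) := rfl
    rw [h3]
    exact e.commutes _
  rw [← hψ, map_mul, h2] at h
  rw [← hψ]
  exact (mem_nonZeroDivisors_iff.1 h1).1 _ h

/-- An ideal which is prime in a local ring is prime on a neighbourhood. -/
theorem Ideal.exists_isPrime_map_away {R : Type*} [CommRing R] [IsNoetherianRing R] {I : Ideal R}
    (p : Ideal R) [hp : p.IsPrime] (hI : I ≤ p)
    (h : ∀ a b, a * b ∈ I → ∃ s ∉ p, s * a ∈ I ∨ s * b ∈ I) :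
    ∃ s ∉ p, ∀ g ∉ p, s ∣ g → ∀ (R' : Type*) [CommRing R'] [Algebra R R'] [IsLocalization.Away g R'],
      (I.map (algebraMap R R')).IsPrime := by
  -- This is the contraction of `I R_p`. It is prime, and being finitely generated it agrees with
  -- `I` after inverting a single `s`.
  let q : Ideal R :=
    { carrier := {a | ∃ s ∉ p, s * a ∈ I}
      add_mem' := by
        rintro a b ⟨s, hs, ha⟩ ⟨t, ht, hb⟩
        refine ⟨s * t, fun h => (hp.mem_or_mem h).elim hs ht, ?_⟩
        rw [show s * t * (a + b) = t * (s * a) + s * (t * b) by ring]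
        exact add_mem (I.mul_mem_left _ ha) (I.mul_mem_left _ hb)
      zero_mem' := ⟨1, fun h => hp.ne_top ((Ideal.eq_top_iff_one p).2 h), by simp⟩
      smul_mem' := by
        rintro c a ⟨s, hs, ha⟩
        refine ⟨s, hs, ?_⟩
        rw [smul_eq_mul, show s * (c * a) = c * (s * a) by ring]
        exact I.mul_mem_left _ ha }
  have hqp : q ≤ p := by
    rintro a ⟨s, hs, ha⟩
    exact (hp.mem_or_mem (hI ha)).resolve_left hs
  have hq : q.IsPrime := by
    refine ⟨fun h => hp.ne_top (top_le_iff.1 (h ▸ hqp)), ?_⟩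
    rintro a b ⟨s, hs, hab⟩
    obtain ⟨t, ht, h1⟩ := h (s * a) b (by rwa [mul_assoc])
    rcases h1 with h1 | h1
    · exact .inl ⟨t * s, fun h => (hp.mem_or_mem h).elim ht hs, by rwa [mul_assoc]⟩
    · exact .inr ⟨t, ht, h1⟩
  obtain ⟨s, hs, hsq⟩ : ∃ s ∉ p, ∀ a ∈ q, s * a ∈ I := by
    obtain ⟨T, hT⟩ := (isNoetherianRing_iff_ideal_fg R).1 inferInstance q
    have h1 (a : R) (ha : a ∈ T) : ∃ s ∉ p, s * a ∈ I :=
      (hT ▸ Ideal.subset_span ha : a ∈ q)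
    choose! f hf hf' using h1
    refine ⟨∏ a ∈ T, f a, fun h => ?_, fun a ha => ?_⟩
    · obtain ⟨a, ha, h2⟩ := (hp.prod_mem_iff).1 h
      exact hf a ha h2
    · rw [← hT] at ha
      induction ha using Submodule.span_induction with
      | mem x hx =>
        obtain ⟨d, hd⟩ := Finset.dvd_prod_of_mem f hx
        rw [hd, mul_comm (f x), mul_assoc]
        exact I.mul_mem_left _ (hf' x hx)
      | zero => simp
      | add x y _ _ hx hy => rw [mul_add]; exact add_mem hx hy
      | smul c x _ hx => rw [smul_eq_mul, mul_left_comm]; exact I.mul_mem_left _ hx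
  refine ⟨s, hs, fun g hg hsg R' _ _ _ => ?_⟩
  have h1 : I.map (algebraMap R R') = q.map (algebraMap R R') := by
    refine le_antisymm (Ideal.map_mono fun a ha =>
      ⟨1, fun h => hp.ne_top ((Ideal.eq_top_iff_one p).2 h), by simpa using ha⟩) ?_
    rw [Ideal.map_le_iff_le_comap]
    intro a ha
    have h2 : IsUnit (algebraMap R R' s) :=
      isUnit_of_dvd_unit (map_dvd _ hsg) (IsLocalization.Away.algebraMap_isUnit g)
    have h3 := Ideal.mem_map_of_mem (algebraMap R R') (hsq a ha)
    rw [map_mul] at h3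
    exact (Ideal.unit_mul_mem_iff_mem _ h2).1 h3
  rw [h1]
  refine IsLocalization.isPrime_of_isPrime_disjoint (.powers g) R' q hq ?_
  rw [Set.disjoint_left]
  rintro _ ⟨n, rfl⟩ h2
  exact hg (hp.mem_of_pow_mem n (hqp h2))

end EtaleQuotient

end

/-! ### Smoothness of closed subschemes, and normal crossings. -/

noncomputable section

/-- If the closed subscheme defined by an ideal `J` is smooth, but `J` is contained in the square of
a prime ideal, then `J` vanishes near this prime ideal. -/
theorem Algebra.FormallySmooth.exists_notMem_mul_eq_zero {k R Q : Type*} [CommRing k] [CommRing R]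
    [CommRing Q] [Algebra k R] [Algebra k Q] [Algebra.FormallySmooth k Q] [IsNoetherianRing R]
    (ψ : R →ₐ[k] Q) (hψ : Function.Surjective ψ) (p : Ideal R) [p.IsPrime]
    (hp : RingHom.ker ψ ≤ p ^ 2) : ∃ s ∉ p, ∀ j, ψ j = 0 → s * j = 0 := by
  set J := RingHom.ker ψ with hJ
  have hJp : J ≤ p := hp.trans (Ideal.pow_le_self two_ne_zero)
  let g : R ⧸ J ^ 2 →ₐ[k] Q := Ideal.Quotient.liftₐ (J ^ 2) ψ fun a ha =>
    Ideal.pow_le_self two_ne_zero ha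
  have hgmk (a : R) : g (Ideal.Quotient.mk _ a) = ψ a := rfl
  have hg : Function.Surjective g := fun q => by
    obtain ⟨a, rfl⟩ := hψ q
    exact ⟨Ideal.Quotient.mk _ a, rfl⟩
  have hker (a : R ⧸ J ^ 2) (ha : g a = 0) : ∃ j ∈ J, Ideal.Quotient.mk _ j = a := by
    obtain ⟨a, rfl⟩ := Ideal.Quotient.mk_surjective a
    exact ⟨a, ha, rfl⟩
  have hsq (a b : R ⧸ J ^ 2) (ha : g a = 0) (hb : g b = 0) : a * b = 0 := by
    obtain ⟨a, ha, rfl⟩ := hker a ha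
    obtain ⟨b, hb, rfl⟩ := hker b hb
    rw [← map_mul, Ideal.Quotient.eq_zero_iff_mem, pow_two]
    exact Ideal.mul_mem_mul ha hb
  have hnil : IsNilpotent (RingHom.ker (g : R ⧸ J ^ 2 →+* Q)) := by
    refine ⟨2, ?_⟩
    exact (pow_two _).trans (le_bot_iff.1 (Ideal.mul_le.2 fun a ha b hb => hsq a b ha hb))
  -- A section of `R / J² → R / J = Q`. The map `d` below is then a derivation into `J / J²` which
  -- is minus the projection on `J`. It maps `p²` into the image of `p J`, so `J ⊆ p²` gives `J ⊆ p
  -- J + J² = p J`, and Nakayama's lemma applies.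
  let σ : Q →ₐ[k] R ⧸ J ^ 2 := Algebra.FormallySmooth.liftOfSurjective (AlgHom.id k Q) g hg hnil
  have hσ (q : Q) : g (σ q) = q := by
    have := Algebra.FormallySmooth.liftOfSurjective_apply (AlgHom.id k Q) g hg hnil q
    exact this
  let d : R → R ⧸ J ^ 2 := fun a => σ (ψ a) - Ideal.Quotient.mk _ a
  have hd (a : R) : g (d a) = 0 := by
    rw [map_sub, hσ, hgmk, sub_self]
  let N : Ideal (R ⧸ J ^ 2) := (p * J).map (Ideal.Quotient.mk (J ^ 2))
  have hdp (a : R) (ha : a ∈ p ^ 2) : d a ∈ N := by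
    rw [pow_two] at ha
    induction ha using Submodule.mul_induction_on' with
    | mem_mul_mem a ha b hb =>
      have h1 : d (a * b) = Ideal.Quotient.mk _ a * d b + Ideal.Quotient.mk _ b * d a := by
        have h2 := hsq _ _ (hd a) (hd b)
        simp only [d, map_mul] at h2 ⊢
        linear_combination h2
      have h3 {a b : R} (ha : a ∈ p) : Ideal.Quotient.mk _ a * d b ∈ N := by
        obtain ⟨j, hj, hj'⟩ := hker _ (hd b)
        rw [← hj', ← map_mul]
        exact Ideal.mem_map_of_mem _ (Ideal.mul_mem_mul ha hj)
      rw [h1]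
      exact add_mem (h3 ha) (h3 hb)
    | add a _ b _ ha hb =>
      have : d (a + b) = d a + d b := by simp only [d, map_add]; ring
      rw [this]
      exact add_mem ha hb
  have hle : J ≤ p • J := by
    intro j hj
    have h1 := hdp j (hp hj)
    have h2 : d j = - Ideal.Quotient.mk _ j := by
      have : ψ j = 0 := hj
      simp [d, this]
    rw [h2, neg_mem_iff, Ideal.mem_quotient_iff_mem_sup] at h1
    rw [smul_eq_mul]
    refine (sup_le le_rfl ?_ : p * J ⊔ J ^ 2 ≤ p * J) h1
    rw [pow_two]
    exact Ideal.mul_mono_left hJp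
  obtain ⟨r, hr, hr'⟩ := Submodule.exists_sub_one_mem_and_smul_eq_zero_of_fg_of_le_smul p J
    ((isNoetherianRing_iff_ideal_fg R).1 inferInstance J) hle
  refine ⟨r, fun h => ?_, fun j hj => hr' j hj⟩
  have := p.sub_mem h hr
  rw [sub_sub_cancel] at this
  exact Ideal.IsPrime.ne_top ‹_› ((Ideal.eq_top_iff_one p).2 this)

/-- The elements `x i`, for `i ∈ A`, are the equations of a divisor with normal crossings, the
intersections of whose components are irreducible. -/
structure IsNormalCrossings {R ι : Type*} [CommRing R] (x : ι → R) (A : Finset ι) : Prop where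
  isPrime : ∀ B ⊆ A, (Ideal.span (x '' (B : Set ι))).IsPrime
  notMem : ∀ B ⊆ A, ∀ c ∈ A, c ∉ B → x c ∉ Ideal.span (x '' (B : Set ι))

namespace IsNormalCrossings

/-- In the polynomial ring the coordinate ideals are prime with normal quotients, so their étale
extensions become prime near `p`; finitely many subsets `B` are involved. By flatness `x c` is
regular modulo the extended ideals, which keeps it out of them. -/
theorem exists_away {k ι R : Type u} [Field k] [CommRing R] [IsNoetherianRing R]
    [Algebra (MvPolynomial ι k) R] [Algebra.Etale (MvPolynomial ι k) R] (p : Ideal R) [p.IsPrime]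
    (A : Finset ι) (hA : ∀ i ∈ A, algebraMap (MvPolynomial ι k) R (.X i) ∈ p) :
    ∃ s ∉ p, ∀ g ∉ p, s ∣ g → ∀ (R' : Type u) [CommRing R'] [Algebra R R']
      [IsLocalization.Away g R'], IsNormalCrossings
        (fun i => algebraMap R R' (algebraMap (MvPolynomial ι k) R (.X i))) A := by
  set x : ι → R := fun i => algebraMap (MvPolynomial ι k) R (.X i)
  have hmap (B : Finset ι) : (Ideal.span (MvPolynomial.X (R := k) '' (B : Set ι))).map
      (algebraMap (MvPolynomial ι k) R) = Ideal.span (x '' (B : Set ι)) := by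
    rw [Ideal.map_span, Set.image_image]
  have hle (B : Finset ι) (hB : B ⊆ A) : Ideal.span (x '' (B : Set ι)) ≤ p := by
    rw [Ideal.span_le]
    rintro _ ⟨i, hi, rfl⟩
    exact hA i (hB hi)
  have key (B : Finset ι) (hB : B ∈ A.powerset) : ∃ s ∉ p, ∀ g ∉ p, s ∣ g → ∀ (R' : Type u)
      [CommRing R'] [Algebra R R'] [IsLocalization.Away g R'],
      ((Ideal.span (x '' (B : Set ι))).map (algebraMap R R')).IsPrime := by
    refine Ideal.exists_isPrime_map_away p (hle B (Finset.mem_powerset.1 hB)) fun a b hab => ?_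
    rw [← hmap] at hab ⊢
    have := MvPolynomial.isDomain_quotient_span_X (k := k) (B : Set ι)
    have := MvPolynomial.isIntegrallyClosed_quotient_span_X (k := k) (B : Set ι)
    exact Algebra.Etale.exists_notMem_mul_mem_map p hab
  choose! s hs hs' using key
  refine ⟨∏ B ∈ A.powerset, s B, fun h => ?_, fun g hg hsg R' _ _ _ => ⟨fun B hB => ?_,
    fun B hB c hc hcB h => ?_⟩⟩
  · obtain ⟨B, hB, h⟩ := (Ideal.IsPrime.prod_mem_iff).1 h
    exact hs B hB h
  · have := hs' B (Finset.mem_powerset.2 hB) g hg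
      ((Finset.dvd_prod_of_mem s (Finset.mem_powerset.2 hB)).trans hsg) R'
    rwa [Ideal.map_span, Set.image_image] at this
  · have h1 : algebraMap R R' (x c) ∈ (Ideal.span (x '' (B : Set ι))).map (algebraMap R R') := by
      rwa [Ideal.map_span, Set.image_image]
    obtain ⟨⟨a, t⟩, ht⟩ := (IsLocalization.mem_map_algebraMap_iff (.powers g) R').1 h1
    obtain ⟨t', ht'⟩ := t.2
    rw [← map_mul] at ht
    obtain ⟨t₂, ht₂⟩ := (IsLocalization.eq_iff_exists (.powers g) R').1 ht
    obtain ⟨t₂', ht₂'⟩ := t₂.2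
    have h2 : x c * (t₂.1 * t.1) ∈ Ideal.span (x '' (B : Set ι)) := by
      rw [show x c * (t₂.1 * t.1) = t₂.1 * (x c * t.1) by ring]
      rw [ht₂]
      exact Ideal.mul_mem_left _ _ a.2
    rw [← hmap] at h2
    have := MvPolynomial.isDomain_quotient_span_X (k := k) (B : Set ι)
    have h3 := Algebra.Etale.mem_map_of_mul_mem (S := MvPolynomial ι k) (c := .X c) (fun a ha => by
      refine (Ideal.IsPrime.mem_or_mem ((Ideal.Quotient.isDomain_iff_prime _).1 this) ha).resolve_left ?_
      exact MvPolynomial.X_notMem_span_X _ (by simpa using hcB)) h2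
    rw [hmap] at h3
    have h4 := hle B hB h3
    rw [← ht', ← ht₂'] at h4
    simp only [← pow_add] at h4
    exact hg (Ideal.IsPrime.mem_of_pow_mem ‹_› _ h4)

variable {R ι : Type*} [CommRing R] {x : ι → R} {A : Finset ι}

theorem isDomain (h : IsNormalCrossings x A) : IsDomain R := by
  have h0 := h.isPrime ∅ (Finset.empty_subset _)
  simp only [Finset.coe_empty, Set.image_empty, Ideal.span_empty] at h0
  have : Nontrivial R := ⟨⟨0, 1, fun h => h0.ne_top ((Ideal.eq_top_iff_one _).2 h.symm)⟩⟩
  have : NoZeroDivisors R := ⟨fun hab => h0.mem_or_mem hab⟩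
  exact NoZeroDivisors.to_isDomain R

theorem prime (h : IsNormalCrossings x A) {a : ι} (ha : a ∈ A) : Prime (x a) := by
  have h1 := h.isPrime {a} (by simpa using ha)
  have h2 := h.notMem ∅ (Finset.empty_subset _) a ha (by simp)
  simp only [Finset.coe_singleton, Set.image_singleton] at h1
  simp only [Finset.coe_empty, Set.image_empty, Ideal.span_empty] at h2
  exact (Ideal.span_singleton_prime h2).1 h1

theorem not_dvd (h : IsNormalCrossings x A) {a b : ι} (ha : a ∈ A) (hb : b ∈ A) (hab : a ≠ b) :
    ¬ x a ∣ x b := by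
  have := h.notMem {a} (by simpa using ha) b hb (by simpa using hab.symm)
  simpa [Ideal.mem_span_singleton] using this

theorem isPrime_pair (h : IsNormalCrossings x A) {a b : ι} (ha : a ∈ A) (hb : b ∈ A) :
    (Ideal.span {x a, x b}).IsPrime := by
  classical
  have := h.isPrime {a, b} (by simp [Finset.insert_subset_iff, ha, hb])
  rwa [Finset.coe_pair, Set.image_pair] at this

theorem notMem_pair (h : IsNormalCrossings x A) {a b c : ι} (ha : a ∈ A) (hb : b ∈ A) (hc : c ∈ A)
    (hca : c ≠ a) (hcb : c ≠ b) : x c ∉ Ideal.span {x a, x b} := by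
  classical
  have := h.notMem {a, b} (by simp [Finset.insert_subset_iff, ha, hb]) c hc (by simp [hca, hcb])
  rwa [Finset.coe_pair, Set.image_pair] at this

theorem prod_dvd (h : IsNormalCrossings x A) {B : Finset ι} (hB : B ⊆ A) {r : R}
    (hr : ∀ b ∈ B, x b ∣ r) : ∏ b ∈ B, x b ∣ r := by
  classical
  have := h.isDomain
  induction B using Finset.induction_on with
  | empty => simp
  | insert a s ha ih =>
    rw [Finset.insert_subset_iff] at hB
    obtain ⟨c, rfl⟩ := ih hB.2 fun b hb => hr b (Finset.mem_insert_of_mem hb)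
    rw [Finset.prod_insert ha, mul_comm]
    refine mul_dvd_mul_left _ ((h.prime hB.1).dvd_or_dvd (hr a (Finset.mem_insert_self _ _))
      |>.resolve_left fun hd => ?_)
    obtain ⟨b, hb, hd⟩ := (h.prime hB.1).exists_mem_finset_dvd hd
    exact h.not_dvd hB.1 (hB.2 hb) (fun e => ha (e ▸ hb)) hd

/-- The `x b` are primes none of which divides another. So a product of distinct ones generates a
radical ideal, modulo which a product of different ones is regular. -/
theorem radicalRegular (h : IsNormalCrossings x A) {B B' : Finset ι} (hB : B ⊆ A) (hB' : B' ⊆ A)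
    (hd : Disjoint B B') {u v : R} (hu : IsUnit u) (hv : IsUnit v) :
    (Ideal.span {u * ∏ b ∈ B, x b}).RadicalRegular (v * ∏ b ∈ B', x b) := by
  rw [Ideal.span_singleton_mul_left_unit hu]
  refine ⟨fun r hr => ?_, fun g hg => ?_⟩
  · obtain ⟨n, hn⟩ := hr
    rw [Ideal.mem_span_singleton] at hn ⊢
    exact h.prod_dvd hB fun b hb =>
      (h.prime (hB hb)).dvd_of_dvd_pow ((Finset.dvd_prod_of_mem x hb).trans hn)
  · rw [Ideal.mem_span_singleton] at hg ⊢
    refine h.prod_dvd hB fun b hb => ?_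
    have hp := h.prime (hB hb)
    have h1 := (Finset.dvd_prod_of_mem x hb).trans hg
    rw [mul_assoc] at h1
    have h2 := (hp.dvd_or_dvd h1).resolve_left fun hv' => hp.not_isUnit (isUnit_of_dvd_unit hv' hv)
    refine (hp.dvd_or_dvd h2).resolve_left fun h3 => ?_
    obtain ⟨c, hc, h3⟩ := hp.exists_mem_finset_dvd h3
    exact h.not_dvd (hB hb) (hB' hc) (fun e => Finset.disjoint_left.1 hd hb (e ▸ hc)) h3

/-- The intersection of the three ideals is generated by the products of two of the three equations,
and these lie in `p²`. -/
theorem inf_le_sq (h : IsNormalCrossings x A) {a b c : ι} (ha : a ∈ A) (hb : b ∈ A) (hc : c ∈ A)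
    (hab : a ≠ b) (hac : a ≠ c) (hbc : b ≠ c) (p : Ideal R) (hpa : x a ∈ p) (hpb : x b ∈ p)
    (hpc : x c ∈ p) :
    Ideal.span {x a, x b} ⊓ Ideal.span {x a, x c} ⊓ Ideal.span {x b, x c} ≤ p ^ 2 := by
  rintro r ⟨⟨h1, h2⟩, h3⟩
  simp only [SetLike.mem_coe] at h1 h2 h3
  obtain ⟨α, β, rfl⟩ := Ideal.mem_span_pair.1 h1
  have h4 : β * x b ∈ Ideal.span {x a, x c} := by
    refine (Submodule.add_mem_iff_right _ (Ideal.mul_mem_left _ _ ?_)).1 h2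
    exact Ideal.subset_span (by simp)
  obtain ⟨γ, δ, rfl⟩ := Ideal.mem_span_pair.1
    (((h.isPrime_pair ha hc).mem_or_mem h4).resolve_right (h.notMem_pair ha hc hb hab.symm hbc))
  have h5 : (α + γ * x b) * x a ∈ Ideal.span {x b, x c} := by
    have : (δ * x b) * x c ∈ Ideal.span {x b, x c} :=
      Ideal.mul_mem_left _ _ (Ideal.subset_span (by simp))
    refine (Submodule.add_mem_iff_left _ this).1 ?_
    convert h3 using 1
    ring
  have h6 := ((h.isPrime_pair hb hc).mem_or_mem h5).resolve_right (h.notMem_pair hb hc ha hab hac)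
  have h7 : Ideal.span {x b, x c} ≤ p := by
    rw [Ideal.span_le]
    rintro _ (rfl | rfl) <;> assumption
  have : α * x a + (γ * x a + δ * x c) * x b = (α + γ * x b) * x a + δ * x b * x c := by ring
  rw [this, pow_two]
  exact add_mem (Ideal.mul_mem_mul (h7 h6) hpa) (Ideal.mul_mem_mul (p.mul_mem_left _ hpb) hpc)

end IsNormalCrossings

end

/-! ### Irreducible components and continuous open maps. -/

noncomputable section

namespace ExpDeg

section Components

variable {P : Type*} [TopologicalSpace P]

theorem exists_componentsOf_superset {A S : Set P} (hSA : S ⊆ A) (hS : IsIrreducible S) :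
    ∃ Z ∈ componentsOf A, S ⊆ Z := by
  obtain ⟨Z, hSZ, hZ⟩ := zorn_subset_nonempty {W : Set P | W ⊆ A ∧ IsIrreducible W} (by
    intro c hc hch hne
    refine ⟨⋃₀ c, ⟨Set.sUnion_subset fun s hs => (hc hs).1, ?_, ?_⟩,
      fun s hs => Set.subset_sUnion_of_mem hs⟩
    · obtain ⟨s, hs⟩ := hne
      exact (hc hs).2.1.mono (Set.subset_sUnion_of_mem hs)
    · rintro u v hu hv ⟨a, ⟨s, hs, has⟩, hau⟩ ⟨b, ⟨t, ht, hbt⟩, hbv⟩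
      rcases hch.total hs ht with hst | hst
      · obtain ⟨z, hz, hz'⟩ := (hc ht).2.2 u v hu hv ⟨a, hst has, hau⟩ ⟨b, hbt, hbv⟩
        exact ⟨z, ⟨t, ht, hz⟩, hz'⟩
      · obtain ⟨z, hz, hz'⟩ := (hc hs).2.2 u v hu hv ⟨a, has, hau⟩ ⟨b, hst hbt, hbv⟩
        exact ⟨z, ⟨s, hs, hz⟩, hz'⟩) S ⟨hSA, hS⟩
  exact ⟨Z, hZ, hSZ⟩

theorem exists_componentsOf_mem {A : Set P} {q : P} (hq : q ∈ A) :
    ∃ Z ∈ componentsOf A, q ∈ Z := by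
  obtain ⟨Z, hZ, h⟩ := exists_componentsOf_superset (Set.singleton_subset_iff.2 hq)
    isIrreducible_singleton
  exact ⟨Z, hZ, h rfl⟩

theorem mem_componentsOf {A Z : Set P} :
    Z ∈ componentsOf A ↔ Maximal (fun W => W ⊆ A ∧ IsIrreducible W) Z := Iff.rfl

theorem componentsOf_subset {A Z : Set P} (hZ : Z ∈ componentsOf A) : Z ⊆ A :=
  (mem_componentsOf.1 hZ).prop.1

theorem isIrreducible_of_mem_componentsOf {A Z : Set P} (hZ : Z ∈ componentsOf A) :
    IsIrreducible Z :=
  (mem_componentsOf.1 hZ).prop.2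

theorem eq_of_mem_componentsOf {A Z W : Set P} (hZ : Z ∈ componentsOf A) (hW : W ⊆ A)
    (hW' : IsIrreducible W) (h : Z ⊆ W) : Z = W :=
  (mem_componentsOf.1 hZ).eq_of_subset ⟨hW, hW'⟩ h

theorem isClosed_of_mem_componentsOf {A Z : Set P} (hA : IsClosed A) (hZ : Z ∈ componentsOf A) :
    IsClosed Z := by
  have h := eq_of_mem_componentsOf hZ
    (closure_minimal (componentsOf_subset hZ) hA) (isIrreducible_of_mem_componentsOf hZ).closure
    subset_closure
  exact h ▸ isClosed_closure

variable {U ι : Type*} [TopologicalSpace U] {g : U → P} {A : Set P} {s : Finset ι} {V : ι → Set U}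

/-- A component of `A` meeting the image of an open subset `Ω` is the closure of the image of
one of the components of the preimage of `A`. -/
theorem exists_eq_closure_image (hg : Continuous g) (hgo : IsOpenMap g) (hA : IsClosed A)
    (hV : ∀ i ∈ s, IsIrreducible (V i)) (hgA : g ⁻¹' A = ⋃ i ∈ s, V i) {Z : Set P}
    (hZ : Z ∈ componentsOf A) {Ω : Set U} (hΩ : IsOpen Ω) {z : U} (hz : z ∈ Ω) (hzZ : g z ∈ Z) :
    ∃ i ∈ s, (V i ∩ Ω).Nonempty ∧ Z = closure (g '' (V i ∩ Ω)) ∧ V i ⊆ g ⁻¹' Z := by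
  classical
  have hVA (i) (hi : i ∈ s) : V i ⊆ g ⁻¹' A := hgA ▸ Set.subset_biUnion_of_mem hi
  -- `Z` is irreducible and meets the open set `g(Ω)`, whose trace on it is therefore dense.
  have hd : Z ⊆ closure (Z ∩ g '' Ω) := by
    intro y hy
    rw [mem_closure_iff]
    intro o ho hyo
    obtain ⟨y', hy', h1, h2⟩ := (isIrreducible_of_mem_componentsOf hZ).2 o (g '' Ω) ho (hgo Ω hΩ) ⟨y, hy, hyo⟩
      ⟨g z, hzZ, z, hz, rfl⟩
    exact ⟨y', h1, hy', h2⟩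
  have hcov : Z ⊆ ⋃₀ ((s.image fun i => closure (g '' (V i ∩ Ω)) : Finset (Set P)) : Set (Set P)) := by
    refine hd.trans (closure_minimal ?_ ?_)
    · rintro _ ⟨hy, y, hyΩ, rfl⟩
      have : y ∈ g ⁻¹' A := componentsOf_subset hZ hy
      rw [hgA] at this
      obtain ⟨i, hi, hyi⟩ := Set.mem_iUnion₂.1 this
      exact ⟨_, Finset.mem_coe.2 (Finset.mem_image_of_mem _ hi),
        subset_closure ⟨y, ⟨hyi, hyΩ⟩, rfl⟩⟩
    · rw [Set.sUnion_eq_biUnion]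
      refine Set.Finite.isClosed_biUnion (Finset.finite_toSet _) fun t ht => ?_
      obtain ⟨i, -, rfl⟩ := Finset.mem_image.1 (Finset.mem_coe.1 ht)
      exact isClosed_closure
  -- An irreducible set covered by finitely many closed sets lies in one of them; maximality of `Z`
  -- then turns the inclusion into an equality.
  obtain ⟨t, ht, hZt⟩ := isIrreducible_iff_sUnion_isClosed.1 (isIrreducible_of_mem_componentsOf hZ) _ (fun t ht => by
    obtain ⟨i, -, rfl⟩ := Finset.mem_image.1 ht
    exact isClosed_closure) hcov
  obtain ⟨i, hi, rfl⟩ := Finset.mem_image.1 ht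
  have hne : (V i ∩ Ω).Nonempty := by
    rw [Set.nonempty_iff_ne_empty]
    intro h
    simp only [h, Set.image_empty, closure_empty] at hZt
    exact hZt hzZ
  have hVΩ : IsIrreducible (V i ∩ Ω) := by
    refine ⟨hne, ?_⟩
    rintro u v hu hv ⟨a, ha, hau⟩ ⟨b, hb, hbv⟩
    obtain ⟨w, hw, ⟨h1, h2⟩, h3⟩ := (hV i hi).2 (u ∩ Ω) (v ∩ Ω) (hu.inter hΩ) (hv.inter hΩ)
      ⟨a, ha.1, hau, ha.2⟩ ⟨b, hb.1, hbv, hb.2⟩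
    exact ⟨w, ⟨hw, h2⟩, h1, h3.1⟩
  have heq : Z = closure (g '' (V i ∩ Ω)) :=
    eq_of_mem_componentsOf hZ (closure_minimal (by
      rintro _ ⟨y, hy, rfl⟩
      exact hVA i hi hy.1) hA) (hVΩ.image g hg.continuousOn).closure hZt
  refine ⟨i, hi, hne, heq, fun y hy => ?_⟩
  have h1 : y ∈ closure (V i ∩ Ω) := by
    rw [mem_closure_iff]
    intro o ho hyo
    obtain ⟨w, hw, h1, h2⟩ := (hV i hi).2 o Ω ho hΩ ⟨y, hy, hyo⟩ hne
    exact ⟨w, h1, hw, h2⟩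
  have h2 := image_closure_subset_closure_image hg ⟨y, h1, rfl⟩
  rw [← heq] at h2
  exact h2

/-- Removing the finitely many closed `V i` that avoid `z` leaves an open neighbourhood of `z`, so
the `V i` obtained from it passes through `z`. -/
theorem exists_mem_subset_preimage (hg : Continuous g) (hgo : IsOpenMap g) (hA : IsClosed A)
    (hV : ∀ i ∈ s, IsIrreducible (V i)) (hVc : ∀ i ∈ s, IsClosed (V i))
    (hgA : g ⁻¹' A = ⋃ i ∈ s, V i) {Z : Set P}
    (hZ : Z ∈ componentsOf A) {z : U} (hz : g z ∈ Z) : ∃ i ∈ s, z ∈ V i ∧ V i ⊆ g ⁻¹' Z := by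
  classical
  obtain ⟨i, hi, ⟨y, hy, hyΩ⟩, -, h⟩ := exists_eq_closure_image hg hgo hA hV hgA hZ
    (Ω := (⋃ i ∈ s.filter (z ∉ V ·), V i)ᶜ) (isOpen_compl_iff.2 <|
      Set.Finite.isClosed_biUnion (Finset.finite_toSet _) fun i hi =>
        hVc i (Finset.mem_filter.1 (Finset.mem_coe.1 hi)).1) (z := z) (by simp) hz
  refine ⟨i, hi, ?_, h⟩
  by_contra hzi
  exact hyΩ (Set.mem_iUnion₂.2 ⟨i, Finset.mem_filter.2 ⟨hi, hzi⟩, hy⟩)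

/-- Once the other `V j` are removed, any component containing the image of `V i` is the closure of
the image of what is left of `V i`. -/
theorem componentsOf_unique (hg : Continuous g) (hgo : IsOpenMap g) (hA : IsClosed A)
    (hV : ∀ i ∈ s, IsIrreducible (V i)) (hVc : ∀ i ∈ s, IsClosed (V i))
    (hgA : g ⁻¹' A = ⋃ i ∈ s, V i) (hn : ∀ i ∈ s, ∃ v ∈ V i, ∀ j ∈ s, v ∈ V j → j = i)
    {Z Z' : Set P} (hZ : Z ∈ componentsOf A) (hZ' : Z' ∈ componentsOf A) {i : ι} (hi : i ∈ s)
    (hiZ : V i ⊆ g ⁻¹' Z) (hiZ' : V i ⊆ g ⁻¹' Z') : Z = Z' := by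
  classical
  obtain ⟨v, hv, hvi⟩ := hn i hi
  set Ω : Set U := (⋃ j ∈ s.erase i, V j)ᶜ
  have hΩ : IsOpen Ω := isOpen_compl_iff.2 <|
      Set.Finite.isClosed_biUnion (Finset.finite_toSet _) fun i hi =>
        hVc i (Finset.mem_erase.1 (Finset.mem_coe.1 hi)).2
  have hvΩ : v ∈ Ω := by
    intro h
    obtain ⟨j, hj, h⟩ := Set.mem_iUnion₂.1 h
    have := Finset.mem_erase.1 hj
    exact this.1 (hvi j this.2 h)
  have key {Z} (hZ : Z ∈ componentsOf A) (hiZ : V i ⊆ g ⁻¹' Z) : Z = closure (g '' (V i ∩ Ω)) := by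
    obtain ⟨j, hj, ⟨y, hy, hyΩ⟩, h, -⟩ := exists_eq_closure_image hg hgo hA hV hgA hZ hΩ hvΩ (hiZ hv)
    by_cases hji : j = i
    · exact hji ▸ h
    · exact absurd (Set.mem_iUnion₂.2 ⟨j, Finset.mem_erase.2 ⟨hji, hj⟩, hy⟩) hyΩ
  exact (key hZ hiZ).trans (key hZ' hiZ').symm

end Components

end ExpDeg

end

/-! ### Non-smooth points of closed subschemes of affine schemes. -/

noncomputable section

namespace ExpDeg

theorem isIso_opens_ι_appLE {X : Scheme.{u}} (U : X.Opens) :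
    IsIso (U.ι.appLE U ⊤ (by simp)) := by
  have := Scheme.Opens.ι_appLE U U ⊤ (by simp)
  rw [this]
  exact X.presheaf.map_isIso (eqToHom (by simp : U.ι ''ᵁ ⊤ = U)).op

/-- If the ideal of a closed subscheme of an affine scheme is contained in the square of the
prime ideal of a point, and contains an element which is not a zero divisor, then the subscheme
is not smooth at this point. -/
theorem not_smoothAt_of_ideal_le_sq {T S : Scheme.{u}} [IsAffine T] [IsAffine S]
    [IsNoetherianRing Γ(T, ⊤)] (str : T ⟶ S) (I : T.IdealSheafData) (z : I.subscheme)
    (P : Ideal Γ(T, ⊤)) [P.IsPrime] (hP : ∀ a, a ∈ P ↔ I.subschemeι z ∉ T.basicOpen a)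
    (hI : I.ideal ⟨⊤, isAffineOpen_top T⟩ ≤ P ^ 2) {f : Γ(T, ⊤)} (hf : f ∈ nonZeroDivisors Γ(T, ⊤))
    (hfI : f ∈ I.ideal ⟨⊤, isAffineOpen_top T⟩) : ¬ SmoothAt (I.subschemeι ≫ str) z := by
  rintro ⟨V, hz, hV⟩
  obtain ⟨W, hW, hWV⟩ := I.subschemeι.isEmbedding.isOpen_iff.1 V.2
  have hzW : I.subschemeι z ∈ W := by
    change z ∈ I.subschemeι ⁻¹' W
    rw [hWV]
    exact hz
  obtain ⟨g, hgW, hzg⟩ := (isAffineOpen_top T).exists_basicOpen_le (V := ⟨W, hW⟩)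
    ⟨_, hzW⟩ trivial
  have hgP : g ∉ P := fun h => (hP g).1 h hzg
  set D : T.affineOpens := ⟨T.basicOpen g, (isAffineOpen_top T).basicOpen g⟩ with hD
  set U : I.subscheme.Opens := I.subschemeι ⁻¹ᵁ D.1 with hU
  have hUaff : IsAffineOpen U := D.2.preimage _
  have hUV : U ≤ V := by
    intro y hy
    have : y ∈ I.subschemeι ⁻¹' W := hgW hy
    rwa [hWV] at this
  have : IsAffine U.toScheme := hUaff
  have hsm : Smooth (U.ι ≫ I.subschemeι ≫ str) := by
    rw [← Scheme.homOfLE_ι _ hUV, Category.assoc]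
    infer_instance
  have hsm2 : RingHom.Smooth (U.ι ≫ I.subschemeι ≫ str).appTop.hom :=
    HasRingHomProperty.appTop @Smooth _ hsm
  have hle : (⊤ : U.toScheme.Opens) ≤ (U.ι ≫ I.subschemeι) ⁻¹ᵁ D.1 := fun y _ => y.2
  have hUU : ⊤ ≤ U.ι ⁻¹ᵁ U := by simp
  let ψ : Γ(T, D.1) →+* Γ(U, ⊤) := ((U.ι ≫ I.subschemeι).appLE D.1 ⊤ hle).hom
  have hψ' : (U.ι ≫ I.subschemeι).appLE D.1 ⊤ hle =
      I.subschemeι.app D.1 ≫ U.ι.appLE U ⊤ hUU := by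
    rw [Scheme.Hom.app_eq_appLE, Scheme.Hom.appLE_comp_appLE]
  have hiso : IsIso (U.ι.appLE U ⊤ hUU) := isIso_opens_ι_appLE U
  have hbij := ConcreteCategory.bijective_of_isIso (U.ι.appLE U ⊤ hUU)
  have hψapp (a) : ψ a = (U.ι.appLE U ⊤ hUU).hom ((I.subschemeι.app D.1).hom a) := by
    have := congrArg (fun h => h.hom a) hψ'
    exact this
  have hψs : Function.Surjective ψ := by
    intro y
    obtain ⟨y, rfl⟩ := hbij.2 y
    obtain ⟨y, rfl⟩ := I.subschemeι_app_surjective D y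
    exact ⟨y, hψapp y⟩
  have hker : RingHom.ker ψ = I.ideal D := by
    rw [← I.ker_subschemeι_app D]
    ext a
    rw [RingHom.mem_ker, RingHom.mem_ker, hψapp]
    exact map_eq_zero_iff _ hbij.1
  have hstr : D.1 ≤ str ⁻¹ᵁ ⊤ := fun _ _ => trivial
  let α : Γ(S, ⊤) →+* Γ(T, D.1) := (str.appLE ⊤ D.1 hstr).hom
  have hα' : str.appLE ⊤ D.1 hstr ≫ (U.ι ≫ I.subschemeι).appLE D.1 ⊤ hle =
      (U.ι ≫ I.subschemeι ≫ str).appTop := by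
    rw [Scheme.Hom.appLE_comp_appLE, Scheme.Hom.appTop, Scheme.Hom.app_eq_appLE]
    simp only [Category.assoc]
    rfl
  have hα : ψ.comp α = (U.ι ≫ I.subschemeι ≫ str).appTop.hom :=
    congrArg CommRingCat.Hom.hom hα'
  let := α.toAlgebra
  let := (ψ.comp α).toAlgebra
  have hsm3 : Algebra.Smooth Γ(S, ⊤) Γ(U, ⊤) := by
    rw [← hα] at hsm2
    exact hsm2
  let := (T.presheaf.map (homOfLE le_top : D.1 ⟶ ⊤).op).hom.toAlgebra
  have hloc : IsLocalization.Away g Γ(T, D.1) := (isAffineOpen_top T).isLocalization_basicOpen g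
  have hnoeth : IsNoetherianRing Γ(T, D.1) := IsLocalization.isNoetherianRing (.powers g) _ ‹_›
  have hPD : (P.map (algebraMap Γ(T, ⊤) Γ(T, D.1))).IsPrime := by
    refine IsLocalization.isPrime_of_isPrime_disjoint (.powers g) _ P ‹_› ?_
    rw [Set.disjoint_left]
    rintro _ ⟨m, rfl⟩ h
    exact hgP (Ideal.IsPrime.mem_of_pow_mem ‹_› m h)
  have hID : (I.ideal ⟨⊤, isAffineOpen_top T⟩).map (algebraMap Γ(T, ⊤) Γ(T, D.1)) = I.ideal D :=
    I.map_ideal (U := D) (V := ⟨⊤, isAffineOpen_top T⟩) (le_top : D.1 ≤ ⊤)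
  -- Smoothness yields an `s` outside the prime which kills the ideal; as the ideal contains the
  -- regular element `f`, this forces `s = 0`.
  obtain ⟨s, hs, hs'⟩ := Algebra.FormallySmooth.exists_notMem_mul_eq_zero
    ({ ψ with commutes' := fun _ => rfl } : Γ(T, D.1) →ₐ[Γ(S, ⊤)] Γ(U, ⊤)) hψs
    (P.map (algebraMap Γ(T, ⊤) Γ(T, D.1))) (by
      refine (hker.le : RingHom.ker ψ ≤ _).trans ?_
      rw [← hID, ← Ideal.map_pow]
      exact Ideal.map_mono hI)
  refine hs ?_
  have hfD : algebraMap Γ(T, ⊤) Γ(T, D.1) f ∈ I.ideal D := hID ▸ Ideal.mem_map_of_mem _ hfI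
  have h0 := hs' (algebraMap Γ(T, ⊤) Γ(T, D.1) f) (by
    rw [← hker] at hfD
    exact hfD)
  have hnz := IsLocalization.map_nonZeroDivisors_le (.powers g) Γ(T, D.1) ⟨f, hf, rfl⟩
  rw [(mem_nonZeroDivisors_iff_right.1 hnz) s h0]
  exact zero_mem _

end ExpDeg

end

/-! ### Étale coordinates and charts with normal crossings. -/

noncomputable section

namespace ExpDeg

open Scheme.IdealSheafData

section Coordinates

variable {k : Type u} [Field k] {T : Scheme.{u}} {ι : Type u}

/-- Functions on a scheme over `k` define a morphism to the spectrum of the polynomial ring. -/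
theorem exists_etale_specFn_X {str : T ⟶ Spec (.of k)} {v : ι → Γ(T, ⊤)}
    (h : Etale (AffineSpace.homOfVector str v)) :
    ∃ Φ : T ⟶ Spec (.of (MvPolynomial ι k)), Etale Φ ∧ ∀ i, specFn Φ (.X i) = v i := by
  refine ⟨AffineSpace.homOfVector str v ≫ (AffineSpace.SpecIso ι (.of k)).hom, inferInstance,
    fun i => ?_⟩
  rw [specFn_comp]
  have h1 : specFn (AffineSpace.SpecIso ι (.of k)).hom (MvPolynomial.X i) =
      AffineSpace.coord (Spec (.of k)) i := by
    have h2 := AffineSpace.SpecIso_inv_appTop_coord (n := ι) (.of k) i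
    have h3 := congrArg (AffineSpace.SpecIso ι (.of k)).hom.appTop h2
    rw [← CommRingCat.comp_apply, ← Scheme.Hom.comp_appTop, Iso.hom_inv_id] at h3
    refine Eq.trans ?_ (h3.symm.trans ?_)
    · rfl
    · simp
  rw [h1]
  exact AffineSpace.homOfVector_appTop_coord _ _ _

variable {C : Scheme.{u}} [C.Over (Spec (.of k))] {t : Γ(C, ⊤)} {c₀ : C}

/-- As `t` is an étale coordinate, `(t)` is pulled back from the radical ideal of the origin of the
affine line along an étale map, hence is reduced. Its zero set is `c₀`. -/
theorem vanishingIdeal_closure_point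
    (ht : Etale (AffineSpace.homOfVector (C ↘ Spec (.of k)) (fun _ : PUnit.{u + 1} => t)))
    (hc₀ : ∀ c : C, c ∉ C.basicOpen t ↔ c = c₀) :
    vanishingIdeal (Closeds.closure {c₀}) = ofIdealTop (Ideal.span {t}) := by
  obtain ⟨Φ, hΦ, hX⟩ := exists_etale_specFn_X ht
  set a : Γ(Spec (.of (MvPolynomial PUnit.{u + 1} k)), ⊤) := specFn (𝟙 _) (.X PUnit.unit) with ha
  have hrad : (Ideal.span {a}).IsRadical := by
    have h1 : (Ideal.span {(MvPolynomial.X PUnit.unit : MvPolynomial PUnit.{u + 1} k)}).IsPrime :=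
      (Ideal.span_singleton_prime (MvPolynomial.X_ne_zero _)).2
        (MvPolynomial.X_prime (σ := PUnit.{u + 1}) (R := k) (i := PUnit.unit))
    have h2 := isRadical_map_specFn h1.isRadical
    rwa [Ideal.map_span, Set.image_singleton] at h2
  have h1 := congrArg (·.comap Φ) (vanishingIdeal_support_ofIdealTop hrad)
  simp only [comap_vanishingIdeal, comap_ofIdealTop_span] at h1
  rw [ha, ← specFn_comp, Category.comp_id, hX] at h1
  rw [← h1]
  congr 1
  have hiff (p : C) : Φ p ∈ (ofIdealTop (Ideal.span {a})).support ↔ p = c₀ := by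
    rw [← hc₀, mem_support_ofIdealTop]
    have h2 : p ∉ C.basicOpen t ↔ Φ p ∉ Scheme.basicOpen _ a := by
      rw [← hX PUnit.unit, mem_basicOpen_specFn, ha, mem_basicOpen_specFn]
      rfl
    rw [h2]
    refine ⟨fun h => h a (Ideal.mem_span_singleton_self a), fun h b hb hpb => h ?_⟩
    obtain ⟨c, rfl⟩ := Ideal.mem_span_singleton.1 hb
    rw [Scheme.basicOpen_mul] at hpb
    exact hpb.1
  have hcl : IsClosed ({c₀} : Set C) := by
    have : ({c₀} : Set C) = (C.basicOpen t : Set C)ᶜ := by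
      ext p
      exact (hc₀ p).symm
    rw [this]
    exact (C.basicOpen t).2.isClosed_compl
  refine SetLike.ext fun p => ?_
  have : p ∈ Closeds.closure {c₀} ↔ p = c₀ := by
    change p ∈ closure {c₀} ↔ _
    rw [hcl.closure_eq]
    rfl
  rw [this]
  exact (hiff p).symm

end Coordinates

theorem fnAt_fnOf {X : Space.{u}} {C : Scheme.{u}} (π : X ⟶ yoneda.obj C) (t : Γ(C, ⊤))
    {T : Scheme.{u}} (x : X.obj (op T)) : fnAt (π ≫ fnOf t) x = pullFn (chartMap π x) t := rfl

section CentralFibre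

variable {k : Type u} [Field k] {C : Scheme.{u}} [C.Over (Spec (.of k))] {t : Γ(C, ⊤)} {c₀ : C}
    {X : Space.{u}} {π : X ⟶ yoneda.obj C}

theorem centralIdeal_eq
    (ht : Etale (AffineSpace.homOfVector (C ↘ Spec (.of k)) (fun _ : PUnit.{u + 1} => t)))
    (hc₀ : ∀ c : C, c ∉ C.basicOpen t ↔ c = c₀) {U : Scheme.{u}} (x : X.obj (op U)) :
    centralIdeal c₀ π x = ofIdealTop (Ideal.span {fnAt (π ≫ fnOf t) x}) := by
  rw [centralIdeal, vanishingIdeal_closure_point ht hc₀, comap_ofIdealTop_span, fnAt_fnOf]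

theorem centralFibre_eq_zeros (hc₀ : ∀ c : C, c ∉ C.basicOpen t ↔ c = c₀) :
    centralFibre c₀ π = zeros (π ≫ fnOf t) := by
  ext q
  obtain ⟨T, x, p, rfl⟩ := Pts.exists_ptOf q
  rw [mem_zeros_ptOf, fnAt_fnOf, ← Scheme.preimage_basicOpen_top]
  exact (hc₀ _).symm

end CentralFibre

/-- An étale chart of `X` with a point over `q`, in which `f` is up to a unit the product of the
equations `x i`, for `i ∈ A`, of divisors with normal crossings passing through this point. -/
structure CrossingChart {X : Space.{u}} (f : X ⟶ A1) (q : Pts X) where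
  R : Type u
  [commRing : CommRing R]
  [isNoetherianRing : IsNoetherianRing R]
  w : X.obj (op (Spec (.of R)))
  p : Spec (.of R)
  isEtaleChart : IsEtaleChart w
  ptOf_eq : ptOf w p = q
  ι : Type u
  x : ι → R
  A : Finset ι
  isNormalCrossings : IsNormalCrossings x A
  mem : ∀ a ∈ A, x a ∈ p.asIdeal
  v : R
  isUnit : IsUnit v
  eq : fnAt f w = specFn (𝟙 _) (v * ∏ a ∈ A, x a)

attribute [instance] CrossingChart.commRing CrossingChart.isNoetherianRing

section Exists

variable {k : Type u} [Field k] {C : Scheme.{u}} [C.Over (Spec (.of k))] {t : Γ(C, ⊤)} {c₀ : C}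
    {X : Space.{u}} {π : X ⟶ yoneda.obj C}

theorem specFn_id_injective (S : Type u) [CommRing S] :
    Function.Injective (specFn (𝟙 (Spec (.of S)))) := fun a b h => by
  rw [← specEquiv_apply, ← specEquiv_apply] at h
  exact (specEquiv S).injective h

theorem specFn_id_surjective (S : Type u) [CommRing S] :
    Function.Surjective (specFn (𝟙 (Spec (.of S)))) := fun a => by
  obtain ⟨b, rfl⟩ := (specEquiv S).surjective a
  exact ⟨b, (specEquiv_apply b).symm⟩

theorem dvd_of_ofIdealTop_specFn_le {S : Type u} [CommRing S] {a b : S}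
    (h : ofIdealTop (Ideal.span {specFn (𝟙 (Spec (.of S))) a}) ≤
      ofIdealTop (Ideal.span {specFn (𝟙 (Spec (.of S))) b})) : b ∣ a := by
  obtain ⟨c, hc⟩ := dvd_of_ofIdealTop_le h
  obtain ⟨c, rfl⟩ := specFn_id_surjective S c
  rw [← map_mul] at hc
  exact ⟨c, specFn_id_injective S hc⟩

/-- The chart is shrunk until it is the spectrum of a domain on which the ideals of the coordinates
through the point are prime. There `t ∘ π` and the product of the coordinates generate the same
ideal, by `centralIdeal_eq`, so they differ by a unit. -/
theorem HasNormalCrossings.exists_crossingChart (hπ : HasNormalCrossings k c₀ π)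
    (ht : Etale (AffineSpace.homOfVector (C ↘ Spec (.of k)) (fun _ : PUnit.{u + 1} => t)))
    (hc₀ : ∀ c : C, c ∉ C.basicOpen t ↔ c = c₀) {q : Pts X} (hq : q ∈ centralFibre c₀ π) :
    Nonempty (CrossingChart (π ≫ fnOf t) q) := by
  classical
  obtain ⟨U, e, p, he, rfl, ι, _, x, s, hx, hI⟩ := hπ q hq
  obtain ⟨T, h, p, hh, rfl, hT⟩ := exists_affine_nbhd U p
  obtain ⟨Φ, hΦ, hΦx⟩ := exists_etale_specFn_X hx
  let R := Γ(T, ⊤)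
  let j : Spec (.of R) ⟶ T := T.isoSpec.inv
  let p₁ : Spec (.of R) := T.isoSpec.hom p
  have hp₁ : j p₁ = p := by
    change (T.isoSpec.hom ≫ T.isoSpec.inv) p = p
    rw [Iso.hom_inv_id]
    rfl
  let ρ : MvPolynomial ι k →+* R := (specEquiv R).symm.toRingHom.comp (specFn (j ≫ h ≫ Φ))
  have hρ (a) : specFn (𝟙 (Spec (.of R))) (ρ a) = specFn (j ≫ h ≫ Φ) a := by
    rw [← specEquiv_apply]
    exact (specEquiv R).apply_symm_apply _
  have hρΦ : Spec.map (CommRingCat.ofHom ρ) = j ≫ h ≫ Φ := by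
    refine specFn_injective (RingHom.ext fun a => ?_)
    rw [← hρ, ← specFn_comp_map, Category.id_comp]
  have hρet : RingHom.Etale ρ := by
    have h1 : Etale (Spec.map (CommRingCat.ofHom ρ)) := by
      rw [hρΦ]
      infer_instance
    exact (HasRingHomProperty.Spec_iff (P := @Etale)).1 h1
  let := ρ.toAlgebra
  have : Algebra.Etale (MvPolynomial ι k) R := hρet
  have : IsNoetherianRing R := Algebra.FiniteType.isNoetherianRing (MvPolynomial ι k) R
  let A := s.filter fun i => ρ (.X i) ∈ p₁.asIdeal
  have hp₁' : p₁.asIdeal.IsPrime := p₁.2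
  obtain ⟨s₀, hs₀, hA⟩ := IsNormalCrossings.exists_away (k := k) (ι := ι) p₁.asIdeal A
    fun i hi => (Finset.mem_filter.1 hi).2
  -- Inverting `g` turns the coordinates of `s` not vanishing at the point into units, and makes the
  -- ideals generated by the others prime.
  let g := s₀ * ∏ i ∈ s \ A, ρ (.X i)
  have hg : g ∉ p₁.asIdeal := by
    intro hg
    refine (p₁.2.mem_or_mem hg).elim hs₀ fun hg => ?_
    obtain ⟨i, hi, hi'⟩ := Ideal.IsPrime.prod_mem_iff.1 hg
    rw [Finset.mem_sdiff] at hi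
    exact hi.2 (Finset.mem_filter.2 ⟨hi.1, hi'⟩)
  let R' := Localization.Away g
  have hNC := hA g hg (Dvd.intro _ rfl) R'
  let l : Spec (.of R') ⟶ Spec (.of R) := Spec.map (CommRingCat.ofHom (algebraMap R R'))
  have hl : IsOpenImmersion l := IsOpenImmersion.of_isLocalization (R := R) (S := R') g
  obtain ⟨p₂, hp₂⟩ : ∃ p₂ : Spec (.of R'), l p₂ = p₁ := by
    have h1 := PrimeSpectrum.localization_away_comap_range R' g
    have h2 : p₁ ∈ Set.range (PrimeSpectrum.comap (algebraMap R R')) := by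
      rw [h1]
      exact hg
    exact h2
  let y : ι → R' := fun i => algebraMap R R' (ρ (.X i))
  have hy (a : MvPolynomial ι k) : specFn (𝟙 (Spec (.of R'))) (algebraMap R R' (ρ a)) =
      specFn (l ≫ j ≫ h ≫ Φ) a := by
    rw [specFn_comp, ← hρ, ← specFn_comp, Category.comp_id, ← specFn_comp_map, Category.id_comp]
  let w : X.obj (op (Spec (.of R'))) := X.map (l ≫ j ≫ h).op e
  have hdom : IsDomain R' := hNC.isDomain
  have hw : IsEtaleChart w := he.map _
  obtain ⟨f₀, hf₀⟩ := specFn_id_surjective R' (fnAt (π ≫ fnOf t) w)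
  have hunit : IsUnit (∏ i ∈ s \ A, y i) := by
    have h1 : IsUnit (algebraMap R R' g) := IsLocalization.Away.algebraMap_isUnit g
    refine isUnit_of_dvd_unit ?_ h1
    simp only [g, map_mul, map_prod]
    exact Dvd.intro_left _ rfl
  have hsplit : ∏ i ∈ s, y i = (∏ i ∈ s \ A, y i) * ∏ i ∈ A, y i :=
    (Finset.prod_sdiff (Finset.filter_subset _ _)).symm
  have hI2 : ofIdealTop (Ideal.span {specFn (𝟙 (Spec (.of R'))) f₀}) =
      ofIdealTop (Ideal.span {specFn (𝟙 (Spec (.of R'))) (∏ i ∈ s, y i)}) := by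
    rw [hf₀, ← centralIdeal_eq ht hc₀]
    have h1 : centralIdeal c₀ π w = (centralIdeal c₀ π e).comap (l ≫ j ≫ h) := by
      rw [centralIdeal, centralIdeal, ← comap_comp, ← chartMap_map]
    rw [h1, hI, comap_ofIdealTop_span]
    congr 3
    simp only [map_prod]
    refine Finset.prod_congr rfl fun i _ => ?_
    rw [hy, ← hΦx, ← specFn_comp]
    simp only [Category.assoc]
  obtain ⟨v, hv⟩ := associated_of_dvd_dvd (dvd_of_ofIdealTop_specFn_le hI2.le)
    (dvd_of_ofIdealTop_specFn_le hI2.ge)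
  refine ⟨{
    R := R'
    isNoetherianRing := IsLocalization.isNoetherianRing (.powers g) _ inferInstance
    w := w
    p := p₂
    isEtaleChart := hw
    ptOf_eq := ?_
    ι := ι
    x := y
    A := A
    isNormalCrossings := hNC
    mem := fun i hi => ?_
    v := v * ∏ i ∈ s \ A, y i
    isUnit := v.isUnit.mul hunit
    eq := ?_ }⟩
  · rw [ptOf_map]
    congr 1
    rw [← hp₁, ← hp₂]
    rfl
  · have h1 := (Finset.mem_filter.1 hi).2
    rw [← hp₂] at h1
    exact h1
  · rw [← hf₀, ← hv, hsplit]
    congr 1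
    ring

end Exists

end ExpDeg

end

/-! ### Components of the zero fibre on a chart with normal crossings. -/

noncomputable section

namespace ExpDeg

open Scheme.IdealSheafData

theorem mem_ofIdealTop_ideal_top {T : Scheme.{u}} [IsAffine T] {I : Ideal Γ(T, ⊤)} {a : Γ(T, ⊤)} :
    a ∈ (ofIdealTop I).ideal ⟨⊤, isAffineOpen_top T⟩ ↔ a ∈ I := by
  simp

theorem not_smoothAt_of_le_sq {R : Type u} [CommRing R] [IsNoetherianRing R] {S : Scheme.{u}}
    [IsAffine S] (str : Spec (.of R) ⟶ S) (I : (Spec (.of R)).IdealSheafData) (z : I.subscheme)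
    (hI : ∀ a, specFn (𝟙 _) a ∈ I.ideal ⟨⊤, isAffineOpen_top _⟩ → a ∈ (I.subschemeι z).asIdeal ^ 2)
    {f : R} (hf : f ∈ nonZeroDivisors R)
    (hfI : specFn (𝟙 _) f ∈ I.ideal ⟨⊤, isAffineOpen_top _⟩) :
    ¬ SmoothAt (I.subschemeι ≫ str) z := by
  have : IsNoetherianRing Γ(Spec (.of R), ⊤) := isNoetherianRing_of_ringEquiv R (specEquiv R)
  have : (I.subschemeι z).asIdeal.IsPrime := (I.subschemeι z).2
  have : ((I.subschemeι z).asIdeal.map (specEquiv R)).IsPrime := Ideal.map_isPrime_of_equiv _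
  refine not_smoothAt_of_ideal_le_sq str I z
    ((I.subschemeι z).asIdeal.map (specEquiv R)) (fun a => ?_) (fun a ha => ?_)
    (specFn_id_mem hf) hfI
  · obtain ⟨a, rfl⟩ := (specEquiv R).surjective a
    rw [specEquiv_apply, mem_basicOpen_specFn, not_not, ← specEquiv_apply, Ideal.mem_map_of_equiv]
    refine ⟨fun ⟨b, hb, h⟩ => ?_, fun h => ⟨a, h, rfl⟩⟩
    obtain rfl := (specEquiv R).injective h
    exact hb
  · obtain ⟨a, rfl⟩ := (specEquiv R).surjective a
    rw [← Ideal.map_pow]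
    exact Ideal.mem_map_of_mem (specEquiv R) (hI a (by rwa [← specEquiv_apply]))

namespace CrossingChart

variable {X : Space.{u}} {f : X ⟶ A1} {q : Pts X} (M : CrossingChart f q)

theorem isDomain : IsDomain M.R := M.isNormalCrossings.isDomain

theorem eqn_mem_nonZeroDivisors : M.v * ∏ a ∈ M.A, M.x a ∈ nonZeroDivisors M.R := by
  have := M.isDomain
  refine mem_nonZeroDivisors_of_ne_zero (mul_ne_zero M.isUnit.ne_zero ?_)
  exact Finset.prod_ne_zero_iff.2 fun a ha => (M.isNormalCrossings.prime ha).ne_zero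

/-- The component of the zero fibre on the chart which is defined by the equation `x a`. -/
def V (a : M.ι) : Set (Spec (.of M.R)) := {p | M.x a ∈ p.asIdeal}

theorem isClosed_V (a : M.ι) : IsClosed (M.V a) := by
  have : M.V a = PrimeSpectrum.zeroLocus {M.x a} := by
    ext p
    exact (Set.singleton_subset_iff (a := M.x a) (s := (p.asIdeal : Set M.R))).symm
  rw [this]
  exact PrimeSpectrum.isClosed_zeroLocus _

theorem isIrreducible_V_inter {a b : M.ι} (ha : a ∈ M.A) (hb : b ∈ M.A) :
    IsIrreducible (M.V a ∩ M.V b) := by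
  have : M.V a ∩ M.V b = PrimeSpectrum.zeroLocus (Ideal.span {M.x a, M.x b} : Ideal M.R) := by
    ext p
    rw [PrimeSpectrum.zeroLocus_span]
    exact (Set.pair_subset_iff (a := M.x a) (b := M.x b) (s := (p.asIdeal : Set M.R))).symm
  rw [this]
  have hp := M.isNormalCrossings.isPrime_pair ha hb
  exact (PrimeSpectrum.isIrreducible_zeroLocus_iff_of_radical _ hp.isRadical).2 hp

theorem isIrreducible_V {a : M.ι} (ha : a ∈ M.A) : IsIrreducible (M.V a) := by
  have := M.isIrreducible_V_inter ha ha
  rwa [Set.inter_self] at this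

/-- The generic point `(x a)` of `V a` lies on no other branch. -/
theorem exists_mem_V_unique {a : M.ι} (ha : a ∈ M.A) :
    ∃ p ∈ M.V a, ∀ b ∈ M.A, p ∈ M.V b → b = a := by
  refine ⟨⟨Ideal.span {M.x a}, ?_⟩, Ideal.mem_span_singleton_self _, fun b hb h => ?_⟩
  · exact (Ideal.span_singleton_prime (M.isNormalCrossings.prime ha).ne_zero).2
      (M.isNormalCrossings.prime ha)
  · by_contra hab
    exact M.isNormalCrossings.not_dvd ha hb (Ne.symm hab) (Ideal.mem_span_singleton.1 h)

theorem mem_zeros_iff {p : Spec (.of M.R)} : ptOf M.w p ∈ zeros f ↔ ∃ a ∈ M.A, p ∈ M.V a := by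
  have hp : p.asIdeal.IsPrime := p.2
  rw [mem_zeros_ptOf, M.eq, mem_basicOpen_specFn, not_not]
  change _ ∈ p.asIdeal ↔ _
  refine ⟨fun h => ?_, fun ⟨a, ha, hp⟩ => ?_⟩
  · have h1 := (hp.mem_or_mem h).resolve_left fun h => hp.ne_top
      (Ideal.eq_top_of_isUnit_mem _ h M.isUnit)
    obtain ⟨a, ha, h2⟩ := Ideal.IsPrime.prod_mem_iff.1 h1
    exact ⟨a, ha, h2⟩
  · exact Ideal.mem_of_dvd _ ((Finset.dvd_prod_of_mem M.x ha).mul_left _) hp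

theorem preimage_zeros : ptOf M.w ⁻¹' zeros f = ⋃ a ∈ M.A, M.V a := by
  ext p
  rw [Set.mem_preimage, mem_zeros_iff]
  simp

variable {Y Y' : Set (Pts X)}

theorem exists_V_subset (hY : Y ∈ componentsOf (zeros f)) {p : Spec (.of M.R)}
    (hp : ptOf M.w p ∈ Y) : ∃ a ∈ M.A, p ∈ M.V a ∧ M.V a ⊆ ptOf M.w ⁻¹' Y :=
  exists_mem_subset_preimage (continuous_ptOf M.w) M.isEtaleChart.isOpenMap (isClosed_zeros f)
    (fun _ ha => M.isIrreducible_V ha) (fun a _ => M.isClosed_V a) M.preimage_zeros hY hp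

theorem eq_of_V_subset (hY : Y ∈ componentsOf (zeros f)) (hY' : Y' ∈ componentsOf (zeros f))
    {a : M.ι} (ha : a ∈ M.A) (h : M.V a ⊆ ptOf M.w ⁻¹' Y) (h' : M.V a ⊆ ptOf M.w ⁻¹' Y') : Y = Y' :=
  componentsOf_unique (continuous_ptOf M.w) M.isEtaleChart.isOpenMap (isClosed_zeros f)
    (fun _ ha => M.isIrreducible_V ha) (fun a _ => M.isClosed_V a) M.preimage_zeros
    (fun _ ha => M.exists_mem_V_unique ha) hY hY' ha h h'

theorem exists_component_V_subset {a : M.ι} (ha : a ∈ M.A) :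
    ∃ Y ∈ componentsOf (zeros f), M.V a ⊆ ptOf M.w ⁻¹' Y := by
  obtain ⟨Y, hY, h⟩ := exists_componentsOf_superset (A := zeros f) (S := ptOf M.w '' M.V a) (by
    rintro _ ⟨p, hp, rfl⟩
    exact M.mem_zeros_iff.2 ⟨a, ha, hp⟩)
    ((M.isIrreducible_V ha).image _ (continuous_ptOf M.w).continuousOn)
  exact ⟨Y, hY, Set.image_subset_iff.1 h⟩

theorem mem_of_V_subset {a : M.ι} (ha : a ∈ M.A) (h : M.V a ⊆ ptOf M.w ⁻¹' Y) : q ∈ Y := by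
  rw [← M.ptOf_eq]
  exact h (M.mem a ha)

/-- There are no triple intersections on the chart. -/
def NoTriple : Prop := ∀ a ∈ M.A, ∀ b ∈ M.A, ∀ c ∈ M.A, a ≠ b → c = a ∨ c = b

/-- A branch lies in only one component, and without triple intersections there are only the
branches `a` and `b`. So `Y` and `Y'` are each a single branch on the chart. -/
theorem exists_pair (hM : M.NoTriple) (hY : Y ∈ componentsOf (zeros f))
    (hY' : Y' ∈ componentsOf (zeros f)) (hYY' : Y ≠ Y') {p : Spec (.of M.R)} (hp : ptOf M.w p ∈ Y)
    (hp' : ptOf M.w p ∈ Y') : ∃ a ∈ M.A, ∃ b ∈ M.A, a ≠ b ∧ p ∈ M.V a ∧ p ∈ M.V b ∧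
      M.V a ⊆ ptOf M.w ⁻¹' Y ∧ M.V b ⊆ ptOf M.w ⁻¹' Y' ∧
      ptOf M.w ⁻¹' (Y ∩ Y') = M.V a ∩ M.V b := by
  obtain ⟨a, ha, hpa, haY⟩ := M.exists_V_subset hY hp
  obtain ⟨b, hb, hpb, hbY⟩ := M.exists_V_subset hY' hp'
  have hab : a ≠ b := by
    rintro rfl
    exact hYY' (M.eq_of_V_subset hY hY' ha haY hbY)
  refine ⟨a, ha, b, hb, hab, hpa, hpb, haY, hbY, Set.Subset.antisymm ?_ ?_⟩
  · rintro z ⟨hz, hz'⟩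
    obtain ⟨c, hc, hzc, hcY⟩ := M.exists_V_subset hY hz
    obtain ⟨d, hd, hzd, hdY⟩ := M.exists_V_subset hY' hz'
    constructor
    · rcases hM a ha b hb c hc hab with rfl | rfl
      · exact hzc
      · exact absurd (M.eq_of_V_subset hY hY' hc hcY hbY) hYY'
    · rcases hM a ha b hb d hd hab with rfl | rfl
      · exact absurd (M.eq_of_V_subset hY hY' hd haY hdY) hYY'
      · exact hzd
  · rintro z ⟨hz, hz'⟩
    exact ⟨haY hz, hbY hz'⟩

theorem isClosed_component (hY : Y ∈ componentsOf (zeros f)) : IsClosed Y :=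
  isClosed_of_mem_componentsOf (isClosed_zeros f) hY

/-- On the chart `Y ∩ Y'` is the irreducible set `V a ∩ V b`. A component meeting it contains it,
and with it the point `q` where the chart is centred. -/
theorem component_inter_subset (hM : M.NoTriple) (hY : Y ∈ componentsOf (zeros f))
    (hY' : Y' ∈ componentsOf (zeros f)) (hYY' : Y ≠ Y') {Z : Set (Pts X)}
    (hZ : Z ∈ componentsOf (Y ∩ Y')) {p : Spec (.of M.R)} (hp : ptOf M.w p ∈ Z) :
    ptOf M.w ⁻¹' (Y ∩ Y') ⊆ ptOf M.w ⁻¹' Z ∧ q ∈ Z := by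
  have hpY := componentsOf_subset hZ hp
  obtain ⟨a, ha, b, hb, -, -, -, -, -, h⟩ := M.exists_pair hM hY hY' hYY' hpY.1 hpY.2
  obtain ⟨_, -, -, h1⟩ := exists_mem_subset_preimage (s := ({()} : Finset Unit)) (V := fun _ => M.V a ∩ M.V b)
    (continuous_ptOf M.w) M.isEtaleChart.isOpenMap
    ((isClosed_component hY).inter (isClosed_component hY'))
    (fun _ _ => M.isIrreducible_V_inter ha hb)
    (fun _ _ => (M.isClosed_V a).inter (M.isClosed_V b)) (by rw [h]; ext; simp) hZ hp
  refine ⟨h.le.trans h1, ?_⟩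
  rw [← M.ptOf_eq]
  exact h1 ⟨M.mem a ha, M.mem b hb⟩

theorem component_inter_unique (hM : M.NoTriple) (hY : Y ∈ componentsOf (zeros f))
    (hY' : Y' ∈ componentsOf (zeros f)) (hYY' : Y ≠ Y') {Z Z' : Set (Pts X)}
    (hZ : Z ∈ componentsOf (Y ∩ Y')) (hZ' : Z' ∈ componentsOf (Y ∩ Y')) {p p' : Spec (.of M.R)}
    (hp : ptOf M.w p ∈ Z) (hp' : ptOf M.w p' ∈ Z') : Z = Z' := by
  have hpY := componentsOf_subset hZ hp
  obtain ⟨a, ha, b, hb, -, hpa, hpb, -, -, h⟩ := M.exists_pair hM hY hY' hYY' hpY.1 hpY.2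
  refine componentsOf_unique (s := ({()} : Finset Unit)) (V := fun _ => M.V a ∩ M.V b) (i := ())
    (continuous_ptOf M.w) M.isEtaleChart.isOpenMap
    ((isClosed_component hY).inter (isClosed_component hY'))
    (fun _ _ => M.isIrreducible_V_inter ha hb)
    (fun _ _ => (M.isClosed_V a).inter (M.isClosed_V b)) (by rw [h]; ext; simp) (fun _ _ =>
      ⟨p, ⟨hpa, hpb⟩, fun _ _ _ => rfl⟩) hZ hZ' (by simp)
    (h.ge.trans (M.component_inter_subset hM hY hY' hYY' hZ hp).1)
    (h.ge.trans (M.component_inter_subset hM hY hY' hYY' hZ' hp').1)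

end CrossingChart

end ExpDeg

end

/-! ### Triple points, the singular locus, and neighbourhoods of its components. -/

noncomputable section

namespace ExpDeg

open Scheme.IdealSheafData

section Degeneration

variable {k : Type u} [Field k] {C : Scheme.{u}} [C.Over (Spec (.of k))] {t : Γ(C, ⊤)} {c₀ : C}
    {X : Space.{u}} {π : X ⟶ yoneda.obj C}

theorem singularLocus_subset (hc₀ : ∀ c : C, c ∉ C.basicOpen t ↔ c = c₀)
    (ht : Etale (AffineSpace.homOfVector (C ↘ Spec (.of k)) (fun _ : PUnit.{u + 1} => t))) :
    singularLocus k c₀ π ⊆ zeros (π ≫ fnOf t) := by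
  rintro _ ⟨U, x, z, -, rfl, -⟩
  rw [mem_zeros_ptOf]
  have h1 : (centralIdeal c₀ π x).subschemeι z ∈ (centralIdeal c₀ π x).support := by
    rw [← SetLike.mem_coe, ← range_subschemeι]
    exact ⟨z, rfl⟩
  rw [congrArg support (centralIdeal_eq ht hc₀ x)] at h1
  exact mem_support_ofIdealTop.1 h1 _ (Ideal.mem_span_singleton_self _)

namespace CrossingChart

variable {q : Pts X} (M : CrossingChart (π ≫ fnOf t) q)

theorem exists_smoothAt_point {I : (Spec (.of M.R)).IdealSheafData} {p : Spec (.of M.R)}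
    (hI : ∀ a, specFn (𝟙 _) a ∈ I.ideal ⟨⊤, isAffineOpen_top _⟩ → a ∈ p.asIdeal ^ 2)
    (hp : p ∈ I.support)
    (hfI : specFn (𝟙 _) (M.v * ∏ a ∈ M.A, M.x a) ∈ I.ideal ⟨⊤, isAffineOpen_top _⟩) :
    ∃ z, I.subschemeι z = p ∧ ¬ SmoothAt (I.subschemeι ≫ chartStr k π M.w) z := by
  rw [← SetLike.mem_coe, ← range_subschemeι] at hp
  obtain ⟨z, rfl⟩ := hp
  exact ⟨z, rfl, not_smoothAt_of_le_sq _ I z hI M.eqn_mem_nonZeroDivisors hfI⟩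

/-- Where two branches meet, the equation of the central fibre lies in the square of the prime
ideal, which rules out smoothness. -/
theorem mem_singularLocus (hc₀ : ∀ c : C, c ∉ C.basicOpen t ↔ c = c₀)
    (ht : Etale (AffineSpace.homOfVector (C ↘ Spec (.of k)) (fun _ : PUnit.{u + 1} => t)))
    {a b : M.ι} (ha : a ∈ M.A) (hb : b ∈ M.A) (hab : a ≠ b) {p : Spec (.of M.R)} (hpa : p ∈ M.V a)
    (hpb : p ∈ M.V b) : ptOf M.w p ∈ singularLocus k c₀ π := by
  classical
  have hI := centralIdeal_eq (π := π) ht hc₀ M.w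
  rw [M.eq] at hI
  have hdvd : M.x a * M.x b ∣ M.v * ∏ a ∈ M.A, M.x a := by
    refine Dvd.dvd.mul_left ?_ _
    rw [← Finset.prod_pair hab]
    exact Finset.prod_dvd_prod_of_subset _ _ _ (by simp [Finset.insert_subset_iff, ha, hb])
  have hsq : M.v * ∏ a ∈ M.A, M.x a ∈ p.asIdeal ^ 2 := by
    rw [pow_two]
    exact Ideal.mem_of_dvd _ hdvd (Ideal.mul_mem_mul hpa hpb)
  obtain ⟨z, hz, hz'⟩ := M.exists_smoothAt_point (k := k) (I := centralIdeal c₀ π M.w) (p := p) (by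
    intro r hr
    rw [hI, mem_ofIdealTop_ideal_top, Ideal.mem_span_singleton] at hr
    obtain ⟨c, hc⟩ := hr
    obtain ⟨c, rfl⟩ := specFn_id_surjective _ c
    rw [← map_mul] at hc
    rw [specFn_id_injective _ hc]
    exact Ideal.mul_mem_right _ _ hsq) (by
      rw [hI]
      refine mem_support_ofIdealTop.2 fun r hr hpr => ?_
      obtain ⟨c, rfl⟩ := Ideal.mem_span_singleton.1 hr
      rw [Scheme.basicOpen_mul] at hpr
      exact (mem_basicOpen_specFn _ _ _).1 hpr.1 (Ideal.pow_le_self two_ne_zero hsq)) (by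
    rw [hI, mem_ofIdealTop_ideal_top]
    exact Ideal.mem_span_singleton_self _)
  exact ⟨_, M.w, z, M.isEtaleChart, congrArg _ hz, hz'⟩

/-- At a triple point the singular locus contains three double loci, so its reduced ideal lies in
the intersection of their ideals and hence in the square of the prime of the point. As it contains
the regular function `t ∘ π`, the singular locus would not be smooth there. -/
theorem noTriple (hπ : IsStrictSimpleDegeneration k c₀ π)
    (hc₀ : ∀ c : C, c ∉ C.basicOpen t ↔ c = c₀)
    (ht : Etale (AffineSpace.homOfVector (C ↘ Spec (.of k)) (fun _ : PUnit.{u + 1} => t))) :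
    M.NoTriple := by
  intro a ha b hb c hc hab
  by_contra! hcon
  set Z := Closeds.closure (singularLocus k c₀ π) with hZ
  have hle {a b : M.ι} (ha : a ∈ M.A) (hb : b ∈ M.A) (hab : a ≠ b) {r : M.R}
      (hr : specFn (𝟙 _) r ∈ (reducedIdeal Z M.w).ideal ⟨⊤, isAffineOpen_top _⟩) :
      r ∈ Ideal.span {M.x a, M.x b} := by
    have h1 := vanishingIdeal_le_ofIdealTop (M.isNormalCrossings.isPrime_pair ha hb).isRadical
      (Z := Z.preimage (continuous_ptOf M.w)) fun p hp =>
        subset_closure (M.mem_singularLocus hc₀ ht ha hb hab (hp (Ideal.subset_span (by simp)))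
          (hp (Ideal.subset_span (by simp))))
    have h2 := h1 ⟨⊤, isAffineOpen_top _⟩ hr
    rw [mem_ofIdealTop_ideal_top] at h2
    obtain ⟨s, hs, hs'⟩ := (Ideal.mem_map_iff_of_surjective _ (specFn_id_surjective _)).1 h2
    exact specFn_id_injective _ hs' ▸ hs
  have hZf : ptOf M.w M.p ∈ Z :=
    subset_closure (M.mem_singularLocus hc₀ ht ha hb hab (M.mem a ha) (M.mem b hb))
  obtain ⟨z, -, hz⟩ := M.exists_smoothAt_point (k := k) (I := reducedIdeal Z M.w) (p := M.p) (by
    intro r hr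
    exact M.isNormalCrossings.inf_le_sq ha hb hc hab hcon.1.symm hcon.2.symm _ (M.mem a ha)
      (M.mem b hb) (M.mem c hc) ⟨⟨hle ha hb hab hr, hle ha hc hcon.1.symm hr⟩,
        hle hb hc hcon.2.symm hr⟩) (by
      rw [reducedIdeal, ← SetLike.mem_coe, coe_support_vanishingIdeal]
      exact hZf) (by
    have h1 : ofIdealTop (Ideal.span {specFn (𝟙 _) (M.v * ∏ a ∈ M.A, M.x a)}) ≤
        reducedIdeal Z M.w := by
      refine ofIdealTop_le_vanishingIdeal fun p hp => ?_
      rw [← M.eq, ← mem_zeros_ptOf]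
      exact closure_minimal (singularLocus_subset hc₀ ht) (isClosed_zeros _) hp
    exact h1 ⟨⊤, isAffineOpen_top _⟩ (mem_ofIdealTop_ideal_top.2 (Ideal.mem_span_singleton_self _)))
  refine hz ⟨⊤, trivial, ?_⟩
  have := hπ.smooth_singularLocus _ M.w M.isEtaleChart
  infer_instance

end CrossingChart

variable (o : Orientation k c₀ π)

theorem node_mem (hc₀ : ∀ c : C, c ∉ C.basicOpen t ↔ c = c₀) (Y : Node c₀ π) :
    Y.1 ∈ componentsOf (zeros (π ≫ fnOf t)) := by
  rw [← centralFibre_eq_zeros hc₀]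
  exact Y.2

namespace Orientation

variable {o}

theorem nbhd_reverse (D : Edge k c₀ π) : o.reverse.nbhd D = o.nbhd D := by
  ext q
  simp only [nbhd, reverse, Set.mem_ofPred_eq, Set.inter_comm (o.tgt D).1]
  refine and_congr_left fun _ => forall_congr' fun Y => ?_
  tauto

theorem src_ne_tgt_coe (D : Edge k c₀ π) : (o.src D).1 ≠ (o.tgt D).1 :=
  fun h => o.src_ne_tgt D (Subtype.ext h)

theorem subset_src (D : Edge k c₀ π) : D.1 ⊆ (o.src D).1 := fun _ h =>
  (componentsOf_subset (o.mem_components D) h).1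

theorem subset_tgt (D : Edge k c₀ π) : D.1 ⊆ (o.tgt D).1 := fun _ h =>
  (componentsOf_subset (o.mem_components D) h).2

end Orientation

namespace CrossingChart

variable {q : Pts X} (M : CrossingChart (π ≫ fnOf t) q)

/-- Every component meeting the chart passes through its centre `q`. So none of the closed sets
removed in the definition of the neighbourhood meets the chart. -/
theorem mem_nbhd (hM : M.NoTriple) (hc₀ : ∀ c : C, c ∉ C.basicOpen t ↔ c = c₀) {D : Edge k c₀ π}
    (hq : q ∈ o.nbhd D) (p : Spec (.of M.R)) : ptOf M.w p ∈ o.nbhd D := by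
  refine ⟨fun Y h1 h2 hY => ?_, fun Z hZ hZD hp => ?_⟩
  · obtain ⟨a, ha, -, h⟩ := M.exists_V_subset (node_mem hc₀ Y) hY
    exact hq.1 Y h1 h2 (M.mem_of_V_subset ha h)
  · exact hq.2 Z hZ hZD (M.component_inter_subset hM (node_mem hc₀ _) (node_mem hc₀ _)
      (o.src_ne_tgt_coe D) hZ hp).2

/-- The two branches at `q` belong to the end points of `[D]`, there is no third one, and the two
meet on the chart in one irreducible set, so `D` is the only component of the intersection through
`q`. -/
theorem mem_nbhd_of_mem (hM : M.NoTriple) (hc₀ : ∀ c : C, c ∉ C.basicOpen t ↔ c = c₀)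
    {D : Edge k c₀ π} (hq : q ∈ D.1) : q ∈ o.nbhd D := by
  have hq' : ptOf M.w M.p ∈ D.1 := by rwa [M.ptOf_eq]
  obtain ⟨a, ha, b, hb, hab, -, -, haY, hbY, -⟩ := M.exists_pair hM (node_mem hc₀ (o.src D))
    (node_mem hc₀ (o.tgt D)) (o.src_ne_tgt_coe D) (o.subset_src D hq')
    (o.subset_tgt D hq')
  refine ⟨fun Y h1 h2 hY => ?_, fun Z hZ hZD hp => hZD ?_⟩
  · rw [← M.ptOf_eq] at hY
    obtain ⟨c, hc, -, h⟩ := M.exists_V_subset (node_mem hc₀ Y) hY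
    rcases hM a ha b hb c hc hab with rfl | rfl
    · exact h1 (Subtype.ext (M.eq_of_V_subset (node_mem hc₀ Y) (node_mem hc₀ _) hc h haY))
    · exact h2 (Subtype.ext (M.eq_of_V_subset (node_mem hc₀ Y) (node_mem hc₀ _) hc h hbY))
  · exact M.component_inter_unique hM (node_mem hc₀ _) (node_mem hc₀ _) (o.src_ne_tgt_coe D) hZ
      (o.mem_components D) (p := M.p) (p' := M.p) (M.ptOf_eq.symm ▸ hp) hq'

/-- The orientation shows that a point of the singular locus lies on two different components of the
central fibre. So the chart has two branches, and these meet at its centre `q`. -/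
theorem mem_singularLocus_of_mem (hM : M.NoTriple) (hc₀ : ∀ c : C, c ∉ C.basicOpen t ↔ c = c₀)
    (ht : Etale (AffineSpace.homOfVector (C ↘ Spec (.of k)) (fun _ : PUnit.{u + 1} => t)))
    (o : Orientation k c₀ π) {p : Spec (.of M.R)} (hp : ptOf M.w p ∈ singularLocus k c₀ π) :
    q ∈ singularLocus k c₀ π := by
  obtain ⟨Z, hZ, hpZ⟩ := exists_componentsOf_mem hp
  let D : Edge k c₀ π := ⟨Z, hZ⟩
  obtain ⟨a, ha, b, hb, hab, -⟩ := M.exists_pair hM (node_mem hc₀ (o.src D))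
    (node_mem hc₀ (o.tgt D)) (o.src_ne_tgt_coe D) (o.subset_src D hpZ) (o.subset_tgt D hpZ)
  rw [← M.ptOf_eq]
  exact M.mem_singularLocus hc₀ ht ha hb hab (M.mem a ha) (M.mem b hb)

theorem range_mem_nhds : Set.range (ptOf M.w) ∈ nhds q := by
  have h := M.isEtaleChart.isOpenMap.isOpen_range.mem_nhds ⟨M.p, rfl⟩
  rwa [M.ptOf_eq] at h

end CrossingChart

theorem exists_crossingChart (hπ : IsStrictSimpleDegeneration k c₀ π)
    (hc₀ : ∀ c : C, c ∉ C.basicOpen t ↔ c = c₀)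
    (ht : Etale (AffineSpace.homOfVector (C ↘ Spec (.of k)) (fun _ : PUnit.{u + 1} => t)))
    {q : Pts X} (hq : q ∈ zeros (π ≫ fnOf t)) : Nonempty (CrossingChart (π ≫ fnOf t) q) :=
  hπ.normalCrossings.exists_crossingChart ht hc₀ (centralFibre_eq_zeros hc₀ ▸ hq)

theorem isClosed_singularLocus (hπ : IsStrictSimpleDegeneration k c₀ π)
    (hc₀ : ∀ c : C, c ∉ C.basicOpen t ↔ c = c₀)
    (ht : Etale (AffineSpace.homOfVector (C ↘ Spec (.of k)) (fun _ : PUnit.{u + 1} => t)))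
    (o : Orientation k c₀ π) : IsClosed (singularLocus k c₀ π) := by
  rw [← isOpen_compl_iff, isOpen_iff_mem_nhds]
  intro q hq
  by_cases h : q ∈ zeros (π ≫ fnOf t)
  · obtain ⟨M⟩ := exists_crossingChart hπ hc₀ ht h
    filter_upwards [M.range_mem_nhds]
    rintro _ ⟨p, rfl⟩ hp
    exact hq (M.mem_singularLocus_of_mem (M.noTriple hπ hc₀ ht) hc₀ ht o hp)
  · filter_upwards [(isClosed_zeros _).isOpen_compl.mem_nhds h] with p hp hp'
    exact hp (singularLocus_subset hc₀ ht hp')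

theorem Orientation.mem_nbhd_of_notMem_zeros (hc₀ : ∀ c : C, c ∉ C.basicOpen t ↔ c = c₀)
    {q : Pts X} (hq : q ∉ zeros (π ≫ fnOf t)) (D : Edge k c₀ π) : q ∈ o.nbhd D :=
  ⟨fun Y _ _ h => hq (componentsOf_subset (node_mem hc₀ Y) h), fun _ hZ _ h =>
    hq (componentsOf_subset (node_mem hc₀ _) (componentsOf_subset hZ h).1)⟩

theorem Orientation.isOpen_nbhd (hπ : IsStrictSimpleDegeneration k c₀ π)
    (hc₀ : ∀ c : C, c ∉ C.basicOpen t ↔ c = c₀)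
    (ht : Etale (AffineSpace.homOfVector (C ↘ Spec (.of k)) (fun _ : PUnit.{u + 1} => t)))
    (D : Edge k c₀ π) : IsOpen (o.nbhd D) := by
  rw [isOpen_iff_mem_nhds]
  intro q hq
  by_cases h : q ∈ zeros (π ≫ fnOf t)
  · obtain ⟨M⟩ := exists_crossingChart hπ hc₀ ht h
    filter_upwards [M.range_mem_nhds]
    rintro _ ⟨p, rfl⟩
    exact M.mem_nbhd o (M.noTriple hπ hc₀ ht) hc₀ hq p
  · filter_upwards [(isClosed_zeros _).isOpen_compl.mem_nhds h] with p hp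
    exact o.mem_nbhd_of_notMem_zeros hc₀ hp D

theorem Orientation.exists_mem_nbhd (hπ : IsStrictSimpleDegeneration k c₀ π)
    (hc₀ : ∀ c : C, c ∉ C.basicOpen t ↔ c = c₀)
    (ht : Etale (AffineSpace.homOfVector (C ↘ Spec (.of k)) (fun _ : PUnit.{u + 1} => t)))
    {q : Pts X} (hq : q ∈ singularLocus k c₀ π) : ∃ D, q ∈ o.nbhd D := by
  obtain ⟨Z, hZ, hqZ⟩ := exists_componentsOf_mem hq
  obtain ⟨M⟩ := exists_crossingChart hπ hc₀ ht (singularLocus_subset hc₀ ht hq)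
  exact ⟨⟨Z, hZ⟩, M.mem_nbhd_of_mem o (M.noTriple hπ hc₀ ht) hc₀ hqZ⟩

end Degeneration

end ExpDeg

end

/-! ### Charts on which the function is a product of two reduced equations. -/

noncomputable section

namespace ExpDeg

open Scheme.IdealSheafData

/-- An étale chart on which `f` is the product of reduced equations `x` and `y` of `Y` and `Y'`
without common components. -/
structure IsProductChart {X : Space.{u}} (f : X ⟶ A1) (Y Y' : Set (Pts X)) {R : Type u} [CommRing R]
    (w : X.obj (op (Spec (.of R)))) (x y : R) : Prop where
  isEtaleChart : IsEtaleChart w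
  eq : fnAt f w = specFn (𝟙 _) (x * y)
  mul_mem : x * y ∈ nonZeroDivisors R
  radicalRegular : (Ideal.span {x}).RadicalRegular y
  radicalRegular' : (Ideal.span {y}).RadicalRegular x
  mem_iff : ∀ p : Spec (.of R), ptOf w p ∈ Y ↔ x ∈ p.asIdeal
  mem_iff' : ∀ p : Spec (.of R), ptOf w p ∈ Y' ↔ y ∈ p.asIdeal

/-- The class of these charts on the subspace `N`. -/
def productCharts {X : Space.{u}} (f : X ⟶ A1) (N Y Y' : Set (Pts X)) :
    ChartClass (subspaceOn N).toFunctor :=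
  fun _ _ w x y => IsProductChart f Y Y' w.1 x y

variable {X : Space.{u}} {f : X ⟶ A1} {N Y Y' : Set (Pts X)}

theorem IsProductChart.symm {R : Type u} [CommRing R] {w : X.obj (op (Spec (.of R)))} {x y : R}
    (h : IsProductChart f Y Y' w x y) : IsProductChart f Y' Y w y x :=
  ⟨h.isEtaleChart, by rw [h.eq, mul_comm], mul_comm x y ▸ h.mul_mem, h.radicalRegular',
    h.radicalRegular, h.mem_iff', h.mem_iff⟩

theorem IsProductChart.reducedIdeal_eq {R : Type u} [CommRing R] {w : X.obj (op (Spec (.of R)))}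
    {x y : R} (h : IsProductChart f Y Y' w x y) (hY : IsClosed Y) :
    reducedIdeal ⟨Y, hY⟩ w = ofIdealTop (Ideal.span {specFn (𝟙 _) x}) := by
  refine le_antisymm ?_ ?_
  · have := vanishingIdeal_le_ofIdealTop h.radicalRegular.1
      (Z := Closeds.preimage ⟨Y, hY⟩ (continuous_ptOf w)) fun p hp =>
        (h.mem_iff p).2 (hp (Ideal.mem_span_singleton_self _))
    rwa [Ideal.map_span, Set.image_singleton] at this
  · refine ofIdealTop_le_vanishingIdeal fun p hp => ?_
    rw [mem_basicOpen_specFn, not_not]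
    exact (h.mem_iff p).1 hp

/-- The reduced ideal of the closed set `Y` is generated by `x`, so different charts give the same
ideal. Where `x` vanishes but `y` does not, the point lies in `Y` and outside `Y'`, hence outside
`D`. -/
theorem localEquations_productCharts {D : Set (Pts X)} (hY : IsClosed Y) (hD : D ⊆ Y')
    (hcov : ∀ {T : Scheme.{u}} (w : X.obj (op T)) (p : T), ptOf w p ∈ N →
      ∃ (T' : Scheme.{u}) (h : T' ⟶ T) (q : T'), Etale h ∧ h q = p ∧
      ∃ (R : Type u) (_ : CommRing R) (w' : X.obj (op (Spec (.of R)))) (x y : R)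
        (j : T' ⟶ Spec (.of R)), IsProductChart f Y Y' w' x y ∧ X.map h.op w = X.map j.op w' ∧
          ∀ p', ptOf w' p' ∈ N) :
    LocalEquations ((subspaceOn N).ι ≫ f)
      (Pts.map (subspaceOn N).ι ⁻¹' Y \ Pts.map (subspaceOn N).ι ⁻¹' D)
      (productCharts f N Y Y') where
  eq h := h.eq
  mul_mem h := h.mul_mem
  radicalRegular h := h.radicalRegular
  mem h p hx hy := ⟨(h.mem_iff p).2 hx, fun hp => hy ((h.mem_iff' p).1 (hD hp))⟩
  mem_closure h p hp := (h.mem_iff p).1 <|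
    (closure_minimal Set.sdiff_subset (hY.preimage (Pts.continuous_map _)) hp :)
  compat {R R'} _ _ {w x y w' x' y'} h h' {T} j j' hj := by
    have h1 := reducedIdeal_comap_eq (Z := ⟨Y, hY⟩) h.isEtaleChart h'.isEtaleChart j j'
      (congrArg Subtype.val hj)
    rw [h.reducedIdeal_eq, h'.reducedIdeal_eq, comap_ofIdealTop_span, comap_ofIdealTop_span,
      ← specFn_eq_pullFn, ← specFn_eq_pullFn] at h1
    exact h1
  cover {T} w p := by
    obtain ⟨T', h, q, hh, hq, R, _, w', x, y, j, hg, hw, hN⟩ := hcov w.1 p (w.2 p)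
    exact ⟨T', h, q, hh, hq, R, _, ⟨w', hN⟩, x, y, j, hg, Subtype.ext hw⟩

/-- Where `f` is invertible one takes `x = f` and `y = 1`; `Y` and `Y'` do not meet such a chart. -/
theorem IsAlgebraicSpace.exists_unit_productChart (hX : IsAlgebraicSpace X) (hY : Y ⊆ zeros f)
    (hY' : Y' ⊆ zeros f) {T : Scheme.{u}} (w : X.obj (op T)) (p : T) (hp : ptOf w p ∉ zeros f) :
    ∃ (T' : Scheme.{u}) (h : T' ⟶ T) (q : T'), Etale h ∧ h q = p ∧
      ∃ (R : Type u) (_ : CommRing R) (w' : X.obj (op (Spec (.of R)))) (x y : R)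
        (j : T' ⟶ Spec (.of R)), IsProductChart f Y Y' w' x y ∧ X.map h.op w = X.map j.op w' ∧
          ∀ p', ptOf w' p' ∉ zeros f := by
  obtain ⟨T₁, h₁, p, U, e, c, hh₁, rfl, hU, he, hc⟩ := hX.exists_chart w p
  let V : U.Opens := U.basicOpen (fnAt f e)
  have hV : IsAffineOpen V := (isAffineOpen_top U).basicOpen _
  have hcp : c p ∈ V := by
    by_contra hcon
    rw [← ptOf_map, ← hc, ptOf_map] at hp
    exact hp hcon
  obtain ⟨z, hz, -⟩ := Scheme.Pullback.exists_preimage_pullback (f := c) (g := V.ι) p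
    (⟨c p, hcp⟩ : V) rfl
  let R := Γ(V, ⊤)
  have : IsAffine V.toScheme := hV
  let i : Spec (.of R) ⟶ V := V.toScheme.isoSpec.inv
  let w' : X.obj (op (Spec (.of R))) := X.map (i ≫ V.ι).op e
  have hu : IsUnit (fnAt f w') := by
    have h1 : fnAt f w' = pullFn i (pullFn V.ι (fnAt f e)) := fnAt_map f _ _
    rw [h1]
    exact (isUnit_pullFn_basicOpen _).map _
  obtain ⟨x, hx⟩ := specFn_id_surjective R (fnAt f w')
  have hxu : IsUnit x := by
    rw [← hx, ← specEquiv_apply] at hu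
    exact (MulEquiv.isUnit_map (specEquiv R)).1 hu
  have hz' (p') : ptOf w' p' ∉ zeros f := by
    rw [mem_zeros_ptOf, not_not, Scheme.basicOpen_of_isUnit _ hu]
    trivial
  have hnot {r : R} (hr : IsUnit r) (p' : Spec (.of R)) : r ∉ p'.asIdeal := fun h =>
    p'.2.ne_top (Ideal.eq_top_of_isUnit_mem _ h hr)
  have hrr {r s : R} (hr : IsUnit r) : (Ideal.span {r}).RadicalRegular s := by
    rw [Ideal.span_singleton_eq_top.2 hr]
    exact ⟨fun _ _ => trivial, fun _ _ => trivial⟩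
  refine ⟨pullback c V.ι, pullback.fst _ _ ≫ h₁, z, inferInstance, by simp [hz], R, inferInstance,
    w', x, 1, pullback.snd _ _ ≫ V.toScheme.isoSpec.hom, ⟨he.map _, ?_, ?_, hrr hxu, hrr isUnit_one,
      fun p' => iff_of_false (fun h => hz' p' (hY h)) (hnot hxu p'),
      fun p' => iff_of_false (fun h => hz' p' (hY' h)) (hnot isUnit_one p')⟩, ?_, hz'⟩
  · rw [mul_one, hx]
  · rw [mul_one]
    exact hxu.mem_nonZeroDivisors
  · rw [← X.map_comp_apply, ← op_comp, op_comp, X.map_comp_apply, ← hc, ← X.map_comp_apply,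
      ← op_comp]
    congr 3
    simp [i, pullback.condition]

theorem IsProductChart.exists_cover {R : Type u} [CommRing R] {w' : X.obj (op (Spec (.of R)))}
    {x y : R} (h : IsProductChart f Y Y' w' x y) {T : Scheme.{u}} {w : X.obj (op T)} {p : T}
    {p' : Spec (.of R)} (hp : ptOf w' p' = ptOf w p) (hN : ∀ p', ptOf w' p' ∈ N) :
    ∃ (T' : Scheme.{u}) (h : T' ⟶ T) (q : T'), Etale h ∧ h q = p ∧
      ∃ (R : Type u) (_ : CommRing R) (w' : X.obj (op (Spec (.of R)))) (x y : R)
        (j : T' ⟶ Spec (.of R)), IsProductChart f Y Y' w' x y ∧ X.map h.op w = X.map j.op w' ∧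
          ∀ p', ptOf w' p' ∈ N := by
  obtain ⟨P, a, g, r, hg, hag, -, hr⟩ := h.isEtaleChart.exists_factor hp
  exact ⟨P, g, r, hg, hr, R, _, w', x, y, a, h, hag.symm, hN⟩

/-- Chart `0` works: `b = y` is forced, and invertibility of `y` allows `a = t_0 y⁻¹`. -/
theorem modelEqns_of_isUnit {O : Type*} [CommRing O] {n : ℕ} {x y : O} (hy : IsUnit y)
    (t : Fin (n + 1) → O) (h : x * y = ∏ i, t i) : ∃ k ≤ n, ∃ a b, ModelEqns x y k t a b := by
  obtain ⟨v, rfl⟩ := hy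
  refine ⟨0, Nat.zero_le _, t 0 * ↑v⁻¹, v, ?_, by simp, fun i hi => ?_⟩
  · rw [Fin.prod_univ_succ] at h
    rw [Fin.prod_univ_succ]
    simp only [Fin.val_zero, lt_self_iff_false, if_false, Fin.val_succ, Nat.succ_pos, if_true,
      one_mul]
    rw [mul_right_comm, ← h, mul_assoc, Units.mul_inv, mul_one]
  · rw [Fin.ext (b := (0 : Fin (n + 1))) hi]
    simp

theorem isUnit_of_forall_notMem {R : Type u} [CommRing R] {y : R}
    (h : ∀ p : Spec (.of R), y ∉ p.asIdeal) : IsUnit y := by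
  by_contra hy
  obtain ⟨m, hm, hym⟩ := exists_max_ideal_of_mem_nonunits hy
  exact h ⟨m, hm.isPrime⟩ hym

end ExpDeg

end

/-! ### Local models of the expanded degenerations. -/

noncomputable section

namespace ExpDeg

open Scheme.IdealSheafData

namespace CrossingChart

variable {X : Space.{u}} {f : X ⟶ A1} {q : Pts X} (M : CrossingChart f q)

theorem mem_prod_iff {B : Finset M.ι} {v : M.R} (hv : IsUnit v) (p : Spec (.of M.R)) :
    v * ∏ b ∈ B, M.x b ∈ p.asIdeal ↔ ∃ b ∈ B, p ∈ M.V b := by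
  have hp : p.asIdeal.IsPrime := p.2
  rw [show v * ∏ b ∈ B, M.x b ∈ p.asIdeal ↔ ∏ b ∈ B, M.x b ∈ p.asIdeal from
    Ideal.unit_mul_mem_iff_mem _ hv]
  exact Ideal.IsPrime.prod_mem_iff

theorem isProductChart {B B' : Finset M.ι} (hB : B ⊆ M.A) (hB' : B' ⊆ M.A) (hd : Disjoint B B')
    (hA : ∀ a ∈ M.A, a ∈ B ∨ a ∈ B') {Y Y' : Set (Pts X)}
    (hY : ∀ p, ptOf M.w p ∈ Y ↔ ∃ b ∈ B, p ∈ M.V b)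
    (hY' : ∀ p, ptOf M.w p ∈ Y' ↔ ∃ b ∈ B', p ∈ M.V b) :
    IsProductChart f Y Y' M.w (M.v * ∏ b ∈ B, M.x b) (1 * ∏ b ∈ B', M.x b) := by
  classical
  have hU : M.A = B ∪ B' := Finset.Subset.antisymm
    (fun a ha => Finset.mem_union.2 (hA a ha)) (Finset.union_subset hB hB')
  have heq : M.v * ∏ a ∈ M.A, M.x a = (M.v * ∏ b ∈ B, M.x b) * (1 * ∏ b ∈ B', M.x b) := by
    rw [hU, Finset.prod_union hd]
    ring
  refine ⟨M.isEtaleChart, heq ▸ M.eq, heq ▸ M.eqn_mem_nonZeroDivisors,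
    M.isNormalCrossings.radicalRegular hB hB' hd M.isUnit isUnit_one,
    M.isNormalCrossings.radicalRegular hB' hB hd.symm isUnit_one M.isUnit,
    fun p => (hY p).trans (M.mem_prod_iff M.isUnit p).symm,
    fun p => (hY' p).trans (M.mem_prod_iff isUnit_one p).symm⟩

end CrossingChart

section Degeneration

variable {k : Type u} [Field k] {C : Scheme.{u}} [C.Over (Spec (.of k))] {t : Γ(C, ⊤)} {c₀ : C}
    {X : Space.{u}} {π : X ⟶ yoneda.obj C}

/-- All branches pass through `q`, and components other than the end points of `[D]` avoid the
neighbourhood. Grouping the branches by the end point containing them gives `x` and `y`. -/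
theorem CrossingChart.exists_isProductChart_nbhd {q : Pts X} (M : CrossingChart (π ≫ fnOf t) q)
    (hc₀ : ∀ c : C, c ∉ C.basicOpen t ↔ c = c₀) (o : Orientation k c₀ π) {D : Edge k c₀ π}
    (hq : q ∈ o.nbhd D) :
    ∃ x y, IsProductChart (π ≫ fnOf t) (o.src D).1 (o.tgt D).1 M.w x y := by
  classical
  have hs := node_mem hc₀ (o.src D)
  have ht := node_mem hc₀ (o.tgt D)
  let B := M.A.filter fun a => M.V a ⊆ ptOf M.w ⁻¹' (o.src D).1
  let B' := M.A.filter fun a => M.V a ⊆ ptOf M.w ⁻¹' (o.tgt D).1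
  refine ⟨_, _, M.isProductChart (B := B) (B' := B') (Finset.filter_subset _ _)
    (Finset.filter_subset _ _) ?_ (fun a ha => ?_) (fun p => ⟨fun hp => ?_, ?_⟩)
    (fun p => ⟨fun hp => ?_, ?_⟩)⟩
  · rw [Finset.disjoint_left]
    intro a ha ha'
    exact o.src_ne_tgt_coe D (M.eq_of_V_subset hs ht (Finset.mem_filter.1 ha).1
      (Finset.mem_filter.1 ha).2 (Finset.mem_filter.1 ha').2)
  · obtain ⟨Y, hY, h⟩ := M.exists_component_V_subset ha
    let Y' : Node c₀ π := ⟨Y, by rwa [centralFibre_eq_zeros hc₀]⟩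
    by_cases h1 : Y' = o.src D
    · exact .inl (Finset.mem_filter.2 ⟨ha, h1 ▸ h⟩)
    · by_cases h2 : Y' = o.tgt D
      · exact .inr (Finset.mem_filter.2 ⟨ha, h2 ▸ h⟩)
      · exact absurd (M.mem_of_V_subset ha h) (hq.1 Y' h1 h2)
  · obtain ⟨a, ha, hpa, h⟩ := M.exists_V_subset hs hp
    exact ⟨a, Finset.mem_filter.2 ⟨ha, h⟩, hpa⟩
  · rintro ⟨b, hb, hp⟩
    exact (Finset.mem_filter.1 hb).2 hp
  · obtain ⟨a, ha, hpa, h⟩ := M.exists_V_subset ht hp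
    exact ⟨a, Finset.mem_filter.2 ⟨ha, h⟩, hpa⟩
  · rintro ⟨b, hb, hp⟩
    exact (Finset.mem_filter.1 hb).2 hp

theorem hasModels_nbhd (hπ : IsStrictSimpleDegeneration k c₀ π)
    (hc₀ : ∀ c : C, c ∉ C.basicOpen t ↔ c = c₀)
    (ht : Etale (AffineSpace.homOfVector (C ↘ Spec (.of k)) (fun _ : PUnit.{u + 1} => t)))
    {o : Orientation k c₀ π} {n : ℕ} (E : ExpandedDegeneration t o n) (D : Edge k c₀ π) :
    HasModels (restrictOver E.res (o.nbhd D))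
      (productCharts (π ≫ fnOf t) (o.nbhd D) (o.src D).1 (o.tgt D).1) := by
  have hs := node_mem hc₀ (o.src D)
  have ht' := node_mem hc₀ (o.tgt D)
  refine hasModels_of_isIteratedBlowup (localEquations_productCharts
    (CrossingChart.isClosed_component hs) (o.subset_tgt D) fun {T} w p hp => ?_) n _ _
    (E.isIteratedBlowup D)
  by_cases h : ptOf w p ∈ zeros (π ≫ fnOf t)
  · obtain ⟨M⟩ := exists_crossingChart hπ hc₀ ht h
    obtain ⟨x, y, hxy⟩ := M.exists_isProductChart_nbhd hc₀ o hp
    exact hxy.exists_cover M.ptOf_eq (M.mem_nbhd o (M.noTriple hπ hc₀ ht) hc₀ hp)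
  · obtain ⟨T', h, q, hh, hq, R, _, w', x, y, j, hg, hw, hN⟩ :=
      hπ.isAlgebraicSpace.exists_unit_productChart (componentsOf_subset hs)
        (componentsOf_subset ht') w p h
    exact ⟨T', h, q, hh, hq, R, _, w', x, y, j, hg, hw, fun p' =>
      o.mem_nbhd_of_notMem_zeros hc₀ (hN p') D⟩

/-- Away from the singular locus `x` is taken to be the whole equation of the central fibre and `y =
1`. -/
theorem exists_cover_away (hπ : IsStrictSimpleDegeneration k c₀ π)
    (hc₀ : ∀ c : C, c ∉ C.basicOpen t ↔ c = c₀)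
    (ht : Etale (AffineSpace.homOfVector (C ↘ Spec (.of k)) (fun _ : PUnit.{u + 1} => t)))
    (o : Orientation k c₀ π) {T : Scheme.{u}} (w : X.obj (op T)) (p : T)
    (hp : ptOf w p ∈ (singularLocus k c₀ π)ᶜ) :
    ∃ (T' : Scheme.{u}) (h : T' ⟶ T) (q : T'), Etale h ∧ h q = p ∧
      ∃ (R : Type u) (_ : CommRing R) (w' : X.obj (op (Spec (.of R)))) (x y : R)
        (j : T' ⟶ Spec (.of R)), IsProductChart (π ≫ fnOf t) (zeros (π ≫ fnOf t)) ∅ w' x y ∧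
          X.map h.op w = X.map j.op w' ∧ ∀ p', ptOf w' p' ∈ (singularLocus k c₀ π)ᶜ := by
  by_cases h : ptOf w p ∈ zeros (π ≫ fnOf t)
  · obtain ⟨M⟩ := exists_crossingChart hπ hc₀ ht h
    have hxy := M.isProductChart (B := M.A) (B' := ∅) subset_rfl (Finset.empty_subset _)
      (Finset.disjoint_empty_right _) (fun a ha => .inl ha) (Y := zeros (π ≫ fnOf t)) (Y' := ∅)
      (fun p => M.mem_zeros_iff) (by simp)
    exact hxy.exists_cover M.ptOf_eq fun p' hp' =>
      hp (M.mem_singularLocus_of_mem (M.noTriple hπ hc₀ ht) hc₀ ht o hp')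
  · obtain ⟨T', h, q, hh, hq, R, _, w', x, y, j, hg, hw, hN⟩ :=
      hπ.isAlgebraicSpace.exists_unit_productChart (subset_refl _) (Set.empty_subset _) w p h
    exact ⟨T', h, q, hh, hq, R, _, w', x, y, j, hg, hw, fun p' hp' =>
      hN p' (singularLocus_subset hc₀ ht hp')⟩

theorem hasModels_away (hπ : IsStrictSimpleDegeneration k c₀ π)
    (hc₀ : ∀ c : C, c ∉ C.basicOpen t ↔ c = c₀)
    (ht : Etale (AffineSpace.homOfVector (C ↘ Spec (.of k)) (fun _ : PUnit.{u + 1} => t)))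
    {o : Orientation k c₀ π} {n : ℕ} (E : ExpandedDegeneration t o n) :
    HasModels (restrictOver E.res (singularLocus k c₀ π)ᶜ) (productCharts (π ≫ fnOf t)
      (singularLocus k c₀ π)ᶜ (zeros (π ≫ fnOf t)) ∅) := by
  have := E.isIso_away
  refine hasModels_of_isIso _ (localEquations_productCharts (D := ∅) (isClosed_zeros _) subset_rfl
    (exists_cover_away hπ hc₀ ht o)) fun {R O _ _ w x y} φ τ h hτ => ?_
  rw [map_mul] at hτ
  exact modelEqns_of_isUnit ((isUnit_of_forall_notMem fun p hp => (h.mem_iff' p).2 hp).map φ) τ hτ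

/-- The same space seen with `x` a unit instead of `y`; the chart equations are the reversed ones.
This provides the opposite models for the reversed orientation away from the singular locus. -/
theorem hasModels_away_swap (hπ : IsStrictSimpleDegeneration k c₀ π)
    (hc₀ : ∀ c : C, c ∉ C.basicOpen t ↔ c = c₀)
    (ht : Etale (AffineSpace.homOfVector (C ↘ Spec (.of k)) (fun _ : PUnit.{u + 1} => t)))
    {o : Orientation k c₀ π} {n : ℕ} (E : ExpandedDegeneration t o n) :
    HasModels (restrictOver E.res (singularLocus k c₀ π)ᶜ) (productCharts (π ≫ fnOf t)
      (singularLocus k c₀ π)ᶜ ∅ (zeros (π ≫ fnOf t))) := by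
  have := E.isIso_away
  refine hasModels_of_isIso _ (localEquations_productCharts (D := ∅) isClosed_empty
    (Set.empty_subset _) fun {T} w p hp => ?_) fun {R O _ _ w x y} φ τ h hτ => ?_
  · obtain ⟨T', h, q, hh, hq, R, _, w', x, y, j, hg, hw, hN⟩ :=
      exists_cover_away hπ hc₀ ht o w p hp
    exact ⟨T', h, q, hh, hq, R, _, w', y, x, j, hg.symm, hw, hN⟩
  · rw [map_mul, mul_comm] at hτ
    have hu := isUnit_of_forall_notMem fun p hp => (h.mem_iff p).2 hp
    rw [← Equiv.prod_comp Fin.revPerm] at hτ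
    obtain ⟨k, hk, a, b, hab⟩ := modelEqns_of_isUnit (hu.map φ) _ hτ
    refine ⟨_, Nat.sub_le _ k, b, a, ?_⟩
    simpa using hab.reverse hk

/-- Locally on `X`, the expanded degenerations associated with opposite orientations are given by
the local models with the roles of the two equations interchanged. -/
theorem exists_hasModels (hπ : IsStrictSimpleDegeneration k c₀ π)
    (hc₀ : ∀ c : C, c ∉ C.basicOpen t ↔ c = c₀)
    (ht : Etale (AffineSpace.homOfVector (C ↘ Spec (.of k)) (fun _ : PUnit.{u + 1} => t)))
    {o : Orientation k c₀ π} {n : ℕ} (E : ExpandedDegeneration t o n)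
    (E' : ExpandedDegeneration t o.reverse n) (q : Pts X) :
    ∃ N, IsOpen N ∧ q ∈ N ∧ ∃ Y Y',
      HasModels (restrictOver E.res N) (productCharts (π ≫ fnOf t) N Y Y') ∧
      HasModels (restrictOver E'.res N) (productCharts (π ≫ fnOf t) N Y' Y) := by
  by_cases hq : q ∈ singularLocus k c₀ π
  · obtain ⟨D, hD⟩ := o.exists_mem_nbhd hπ hc₀ ht hq
    refine ⟨o.nbhd D, o.isOpen_nbhd hπ hc₀ ht D, hD, _, _, hasModels_nbhd hπ hc₀ ht E D, ?_⟩
    have := hasModels_nbhd hπ hc₀ ht E' D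
    rwa [Orientation.nbhd_reverse] at this
  · exact ⟨_, (isClosed_singularLocus hπ hc₀ ht o).isOpen_compl, hq, _, _,
      hasModels_away hπ hc₀ ht E, hasModels_away_swap hπ hc₀ ht E'⟩

end Degeneration

end ExpDeg

end

/-! ### Gluing the local reversals to an isomorphism. -/

noncomputable section

namespace ExpDeg

variable {X B B' : Space.{u}} {f : X ⟶ A1} {n : ℕ} {r : B ⟶ fib X f n} {r' : B' ⟶ fib X f n}

/-- Locally on `X`, the spaces `B` and `B'` over `X ×_{𝔸¹} 𝔸ⁿ⁺¹` are given by the local models,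
the roles of the two equations being interchanged. -/
def OppositeModels (r : B ⟶ fib X f n) (r' : B' ⟶ fib X f n) : Prop :=
  ∀ q : Pts X, ∃ N, IsOpen N ∧ q ∈ N ∧ ∃ Y Y',
    HasModels (restrictOver r N) (productCharts f N Y Y') ∧
    HasModels (restrictOver r' N) (productCharts f N Y' Y)

theorem OppositeModels.symm (h : OppositeModels r r') : OppositeModels r' r := fun q => by
  obtain ⟨N, hN, hq, Y, Y', h1, h2⟩ := h q
  exact ⟨N, hN, hq, Y', Y, h2, h1⟩

theorem exists_restrict (r : B ⟶ fib X f n) {N : Set (Pts X)} (hN : IsOpen N) {T : Scheme.{u}}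
    (p : T) {y : B.obj (op T)} (hp : ptOf (r.app _ y).pt p ∈ N) :
    ∃ (V : Scheme.{u}) (h : V ⟶ T) (q : V), IsOpenImmersion h ∧ h q = p ∧
      ∀ z : B.obj (op T), (r.app _ z).pt = (r.app _ y).pt →
        ∃ z' : (subspaceOn (Pts.map (r ≫ fib.fst f n) ⁻¹' N)).toFunctor.obj (op V),
          z'.1 = B.map h.op z := by
  let V : T.Opens := ⟨ptOf (r.app _ y).pt ⁻¹' N, hN.preimage (continuous_ptOf _)⟩
  refine ⟨V, V.ι, ⟨p, hp⟩, inferInstance, rfl, fun z hz => ⟨⟨B.map V.ι.op z, fun p' => ?_⟩, rfl⟩⟩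
  rw [ptOf_map]
  change ptOf (r.app _ z).pt _ ∈ N
  rw [hz]
  exact p'.2

/-- Locally on `X` this is the uniqueness in the local models, and equality of sections of the sheaf
`B` is étale local. -/
theorem OppositeModels.ext (h : OppositeModels r r') (hB : IsAlgebraicSpace B) {T : Scheme.{u}}
    {y y' : B.obj (op T)} (hy : r.app _ y = r.app _ y')
    (hreg : ∀ i, IsRegularFn ((r.app _ y).coord i)) : y = y' := by
  refine eq_of_etale_local hB.isSheaf fun p => ?_
  obtain ⟨N, hN, hp, Y, Y', h1, -⟩ := h (ptOf (r.app _ y).pt p)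
  obtain ⟨V, g, q, hg, hq, hV⟩ := exists_restrict r hN p hp
  obtain ⟨z, hz⟩ := hV y rfl
  obtain ⟨z', hz'⟩ := hV y' (congrArg FibPt.pt hy.symm)
  refine ⟨V, g, q, inferInstance, hq, ?_⟩
  rw [← hz, ← hz']
  have hrz : r.app _ z.1 = r.app _ z'.1 := by
    rw [hz, hz', app_map, app_map, hy]
  refine congrArg Subtype.val (h1.ext z z' ?_ fun i => ?_)
  · exact FibPt.ext (Subtype.ext (congrArg FibPt.pt hrz :)) (congrArg FibPt.coord hrz :)
  · change IsRegularFn ((r.app _ z.1).coord i)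
    rw [hz, coord_map]
    exact (hreg i).pullFn g

/-- An étale chart factors étale locally through model charts, whose coordinates are regular. As
these are not known to be flat over `B`, regularity is carried over through the fibre product with
the model chart, using flatness of the composite to `U` only. -/
theorem OppositeModels.isRegularFn_coord (h : OppositeModels r r') {U : Scheme.{u}}
    {e : B.obj (op U)} (he : IsEtaleChart e) (i : Fin (n + 1)) :
    IsRegularFn ((r.app _ e).coord i) := by
  refine isRegularFn_of_flat_comp fun p => ?_
  obtain ⟨N, hN, hp, Y, Y', h1, -⟩ := h (ptOf (r.app _ e).pt p)
  obtain ⟨V, g, q, hg, rfl, hV⟩ := exists_restrict r hN p hp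
  obtain ⟨z, hz⟩ := hV e rfl
  obtain ⟨T, l, s, hl, rfl, -, M, j, hj⟩ := h1.exists_factor z q
  obtain ⟨P, a, b, hb, -, hab, hlift⟩ := he.exists_pullback M.m.1
  have hj' : B.map (l ≫ g).op e = B.map j.op M.m.1 := by
    have := congrArg Subtype.val hj
    rw [op_comp, B.map_comp_apply, ← hz]
    exact this
  obtain ⟨c, hc, hc'⟩ := hlift T (l ≫ g) j hj'
  refine ⟨T, P, c, a, s, hc ▸ inferInstance, ?_, ?_⟩
  · rw [← Scheme.Hom.comp_apply, hc]
    rfl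
  · rw [← coord_map, hab, coord_map]
    have := M.coord_eq i
    change (r.app _ M.m.1).coord i = _ at this
    rw [this]
    exact (isRegularFn_specFn_id (M.isModel.t_mem i)).pullFn b

/-- Étale locally `y` factors through the `k`-th model for the equations `x`, `y`. By
`ModelEqns.reverse` this maps to the `(n - k)`-th model for `y`, `x`, which has a point in `B'`. -/
theorem OppositeModels.exists_reverse (h : OppositeModels r r') {T : Scheme.{u}}
    (y : B.obj (op T)) (p : T) : ∃ (T' : Scheme.{u}) (g : T' ⟶ T) (q : T'), Etale g ∧ g q = p ∧
      ∃ y' : B'.obj (op T'), r'.app _ y' = (fib.reverse X f n).app _ (r.app _ (B.map g.op y)) := by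
  obtain ⟨N, hN, hp, Y, Y', h1, h2⟩ := h (ptOf (r.app _ y).pt p)
  obtain ⟨V, g, q, hg, rfl, hV⟩ := exists_restrict r hN p hp
  obtain ⟨z, hz⟩ := hV y rfl
  obtain ⟨T', l, s, hl, rfl, -, M, j, hj⟩ := h1.exists_factor z q
  have hgood : IsProductChart f Y' Y M.w.1 M.y M.x := IsProductChart.symm M.good
  obtain ⟨S', _, str', t', a', b', hm'⟩ := IsModel.exists_model hgood.mul_mem hgood.radicalRegular
    n (n - M.k) (Nat.sub_le _ _)
  obtain ⟨m', hm1, hm2⟩ := h2.exists_point (w := M.w) hgood hm'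
  obtain ⟨φ, hφ, hφt, -, -⟩ := hm'.exists_hom M.str _ _ _ (M.isModel.eqns.reverse M.isModel.le)
  refine ⟨T', l ≫ g, s, inferInstance, rfl,
    B'.map (j ≫ Spec.map (CommRingCat.ofHom φ)).op m'.1, ?_⟩
  have hj' : B.map (l ≫ g).op y = B.map j.op M.m.1 := by
    have := congrArg Subtype.val hj
    rw [op_comp, B.map_comp_apply, ← hz]
    exact this
  rw [hj']
  have hm1' : (r'.app _ m'.1).pt = X.map (Spec.map (CommRingCat.ofHom str')).op M.w.1 :=
    congrArg Subtype.val hm1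
  have hM : (r.app _ M.m.1).pt = X.map (Spec.map (CommRingCat.ofHom M.str)).op M.w.1 :=
    congrArg Subtype.val M.pt_eq
  refine FibPt.ext ?_ (funext fun i => ?_)
  · have hcomp : φ.comp str' = M.str := RingHom.ext hφ
    change _ = (r.app _ (B.map j.op M.m.1)).pt
    rw [pt_map, pt_map, hm1', hM, ← X.map_comp_apply, ← op_comp, ← X.map_comp_apply, ← op_comp,
      Category.assoc, ← Spec.map_comp, ← CommRingCat.ofHom_comp, hcomp]
  · change _ = (r.app _ (B.map j.op M.m.1)).coord i.rev
    have h3 : (r'.app _ m'.1).coord i = specFn (𝟙 _) (t' i) := hm2 i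
    have h4 : (r.app _ M.m.1).coord i.rev = specFn (𝟙 _) (M.t i.rev) := M.coord_eq i.rev
    rw [coord_map, coord_map, h3, h4, ← specFn_eq_pullFn, ← specFn_eq_pullFn, specFn_comp_map, hφt]

/-- `y'` is étale locally the pullback of a section on a chart of `B` lifting the reversal. -/
def IsReversal (r : B ⟶ fib X f n) (r' : B' ⟶ fib X f n) {T : Scheme.{u}} (y : B.obj (op T))
    (y' : B'.obj (op T)) : Prop :=
  ∀ p : T, ∃ (T' : Scheme.{u}) (g : T' ⟶ T) (q : T'), Etale g ∧ g q = p ∧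
    ∃ (U : Scheme.{u}) (e : B.obj (op U)) (e' : B'.obj (op U)) (c : T' ⟶ U), IsEtaleChart e ∧
      r'.app _ e' = (fib.reverse X f n).app _ (r.app _ e) ∧ B.map g.op y = B.map c.op e ∧
      B'.map g.op y' = B'.map c.op e'

theorem IsReversal.app_eq (hX : IsAlgebraicSpace X) {T : Scheme.{u}} {y : B.obj (op T)}
    {y' : B'.obj (op T)} (h : IsReversal r r' y y') :
    r'.app _ y' = (fib.reverse X f n).app _ (r.app _ y) := by
  have key (p : T) : ∃ (T' : Scheme.{u}) (g : T' ⟶ T) (q : T'), Etale g ∧ g q = p ∧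
      (fib X f n).map g.op (r'.app _ y') =
        (fib X f n).map g.op ((fib.reverse X f n).app _ (r.app _ y)) := by
    obtain ⟨T', g, q, hg, hq, U, e, e', c, -, he', h1, h2⟩ := h p
    refine ⟨T', g, q, hg, hq, ?_⟩
    rw [← app_map, ← app_map, ← app_map, h1, h2, app_map, app_map, app_map, he']
  refine FibPt.ext (eq_of_etale_local hX.isSheaf fun p => ?_) (funext fun i =>
    eq_of_flat_local fun p => ?_)
  · obtain ⟨T', g, q, hg, hq, h⟩ := key p
    exact ⟨T', g, q, hg, hq, congrArg FibPt.pt h⟩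
  · obtain ⟨T', g, q, hg, hq, h⟩ := key p
    exact ⟨T', g, q, inferInstance, hq, congrArg (FibPt.coord · i) h⟩

theorem IsReversal.map {T S : Scheme.{u}} {y : B.obj (op T)} {y' : B'.obj (op T)}
    (h : IsReversal r r' y y') (l : S ⟶ T) : IsReversal r r' (B.map l.op y) (B'.map l.op y') := by
  intro p
  obtain ⟨T', g, q, hg, hq, U, e, e', c, he, he', h1, h2⟩ := h (l p)
  obtain ⟨s, hs, hs'⟩ := Scheme.Pullback.exists_preimage_pullback (f := l) (g := g) p q hq.symm
  refine ⟨pullback l g, pullback.fst _ _, s, inferInstance, hs, U, e, e', pullback.snd _ _ ≫ c, he,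
    he', ?_, ?_⟩
  · rw [← B.map_comp_apply, ← op_comp, pullback.condition, op_comp, B.map_comp_apply, h1, op_comp,
      B.map_comp_apply]
  · rw [← B'.map_comp_apply, ← op_comp, pullback.condition, op_comp, B'.map_comp_apply, h2, op_comp,
      B'.map_comp_apply]

theorem IsReversal.of_local {T : Scheme.{u}} {y : B.obj (op T)} {y' : B'.obj (op T)}
    (h : ∀ p : T, ∃ (T' : Scheme.{u}) (g : T' ⟶ T) (q : T'), Etale g ∧ g q = p ∧
      IsReversal r r' (B.map g.op y) (B'.map g.op y')) : IsReversal r r' y y' := by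
  intro p
  obtain ⟨T', g, q, hg, rfl, h⟩ := h p
  obtain ⟨T₂, g₂, q, hg₂, rfl, U, e, e', c, he, he', h1, h2⟩ := h q
  refine ⟨T₂, g₂ ≫ g, q, inferInstance, rfl, U, e, e', c, he, he', ?_, ?_⟩
  · rw [← h1, op_comp, B.map_comp_apply]
  · rw [← h2, op_comp, B'.map_comp_apply]

/-- On the fibre product of two étale charts of `B` the coordinates are regular, so the two lifts
agree there and hence after pullback. Over a general `T` the uniqueness argument is not available,
which is why `IsReversal` refers to étale charts. -/
theorem OppositeModels.reversal_unique (h : OppositeModels r r') (hB' : IsAlgebraicSpace B')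
    {T : Scheme.{u}} {y : B.obj (op T)} {y₁ y₂ : B'.obj (op T)} (h₁ : IsReversal r r' y y₁)
    (h₂ : IsReversal r r' y y₂) : y₁ = y₂ := by
  refine eq_of_etale_local hB'.isSheaf fun p => ?_
  obtain ⟨T₁, g₁, q₁, hg₁, rfl, U₁, e₁, e₁', c₁, he₁, he₁', h1, h1'⟩ := h₁ p
  obtain ⟨T₂, g₂, q₂, hg₂, hq₂, U₂, e₂, e₂', c₂, he₂, he₂', h2, h2'⟩ := h₂ (g₁ q₁)
  obtain ⟨s, hs, -⟩ := Scheme.Pullback.exists_preimage_pullback (f := g₁) (g := g₂) q₁ q₂ hq₂.symm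
  obtain ⟨P, a, b, hb, hb', hab, hlift⟩ := he₁.exists_pullback e₂
  have := hb' he₂
  obtain ⟨l, hl, hl'⟩ := hlift (pullback g₁ g₂) (pullback.fst _ _ ≫ c₁) (pullback.snd _ _ ≫ c₂) (by
    rw [op_comp, B.map_comp_apply, ← h1, op_comp, B.map_comp_apply, ← h2, ← B.map_comp_apply,
      ← op_comp, ← B.map_comp_apply, ← op_comp, pullback.condition])
  have key : B'.map a.op e₁' = B'.map b.op e₂' := by
    refine h.symm.ext hB' ?_ fun i => ?_
    · rw [app_map, app_map, he₁', he₂', ← app_map, ← app_map, ← app_map, ← app_map, hab]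
    · rw [coord_map, he₁']
      exact (h.isRegularFn_coord he₁ i.rev).pullFn a
  refine ⟨pullback g₁ g₂, pullback.fst _ _ ≫ g₁, s, inferInstance, by simp [hs], ?_⟩
  have e1 : B'.map (pullback.fst g₁ g₂ ≫ g₁).op y₁ = B'.map l.op (B'.map a.op e₁') := by
    rw [op_comp, B'.map_comp_apply, h1', ← B'.map_comp_apply, ← op_comp, ← hl, op_comp,
      B'.map_comp_apply]
  have e2 : B'.map (pullback.fst g₁ g₂ ≫ g₁).op y₂ = B'.map l.op (B'.map b.op e₂') := by
    rw [pullback.condition, op_comp, B'.map_comp_apply, h2', ← B'.map_comp_apply, ← op_comp, ← hl',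
      op_comp, B'.map_comp_apply]
  rw [e1, e2, key]

theorem OppositeModels.exists_hom (h : OppositeModels r r') (hX : IsAlgebraicSpace X)
    (hB : IsAlgebraicSpace B) (hB' : IsAlgebraicSpace B') :
    ∃ φ : B ⟶ B', φ ≫ r' = r ≫ fib.reverse X f n := by
  obtain ⟨φ, hφ⟩ := exists_natTrans hB'.isSheaf (fun {T} => IsReversal r r')
    (fun g _ _ h => h.map g) (fun _ _ _ h₁ h₂ => h.reversal_unique hB' h₁ h₂)
    (fun _ _ h => .of_local h) (fun {T} y p => by
      obtain ⟨T', g, q, U, e, c, hg, rfl, -, he, hc⟩ := hB.exists_chart y p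
      obtain ⟨U', l, u, hl, hu, e', he'⟩ := h.exists_reverse e (c q)
      obtain ⟨s, hs, -⟩ := Scheme.Pullback.exists_preimage_pullback (f := c) (g := l) q u hu.symm
      refine ⟨pullback c l, pullback.fst _ _ ≫ g, s, inferInstance, by simp [hs],
        B'.map (pullback.snd _ _).op e', fun p => ⟨_, 𝟙 _, p, inferInstance, rfl, U',
          B.map l.op e, e', pullback.snd _ _, he.map l, he', ?_, by simp⟩⟩
      rw [op_id, B.map_id_apply, op_comp, B.map_comp_apply, ← hc, ← B.map_comp_apply, ← op_comp,
        pullback.condition, op_comp, B.map_comp_apply])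
  refine ⟨φ, NatTrans.ext (funext fun T => ConcreteCategory.hom_ext _ _ fun y => ?_)⟩
  exact (hφ (T := T.unop) y).app_eq hX

theorem reverse_reverse : fib.reverse X f n ≫ fib.reverse X f n = 𝟙 _ := by
  refine NatTrans.ext (funext fun T => ConcreteCategory.hom_ext _ _ fun y => ?_)
  refine FibPt.ext rfl (funext fun i => ?_)
  exact congrArg (FibPt.coord y) (Fin.rev_rev i)

/-- It suffices to compare on étale charts, where regular coordinates make sections unique. -/
theorem OppositeModels.eq_id (h : OppositeModels r r') (hB : IsAlgebraicSpace B) {χ : B ⟶ B}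
    (hχ : χ ≫ r = r) : χ = 𝟙 B := by
  refine NatTrans.ext (funext fun T => ConcreteCategory.hom_ext _ _ fun y => ?_)
  refine eq_of_etale_local (T := T.unop) hB.isSheaf fun p => ?_
  obtain ⟨T', g, q, U, e, c, hg, hq, -, he, hc⟩ := hB.exists_chart (T := T.unop) y p
  have key : χ.app _ e = e := by
    have h1 : r.app _ (χ.app _ e) = r.app _ e := congrArg (fun α => α.app (op U) e) hχ
    exact h.ext hB h1 fun i => by
      rw [h1]
      exact h.isRegularFn_coord he i
  refine ⟨T', g, q, hg, hq, ?_⟩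
  change B.map g.op (χ.app _ y) = B.map g.op y
  rw [← hc, ← app_map χ g, ← hc, app_map, key]

/-- Both composites of the two reversals lie over the identity, since reversing twice does nothing,
and are therefore identities. -/
theorem OppositeModels.exists_iso (h : OppositeModels r r') (hX : IsAlgebraicSpace X)
    (hB : IsAlgebraicSpace B) (hB' : IsAlgebraicSpace B') :
    ∃ φ : B ≅ B', φ.hom ≫ r' = r ≫ fib.reverse X f n := by
  obtain ⟨φ, hφ⟩ := h.exists_hom hX hB hB'
  obtain ⟨ψ, hψ⟩ := h.symm.exists_hom hX hB' hB
  refine ⟨⟨φ, ψ, h.eq_id hB ?_, h.symm.eq_id hB' ?_⟩, hφ⟩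
  · rw [Category.assoc, hψ, ← Category.assoc, hφ, Category.assoc, reverse_reverse, Category.comp_id]
  · rw [Category.assoc, hφ, ← Category.assoc, hψ, Category.assoc, reverse_reverse, Category.comp_id]

end ExpDeg

end

/-! ### Equivariance under the torus, and the theorem. -/

noncomputable section

namespace ExpDeg

/-- A point of the torus over a scheme over an affine scheme `U` comes from a flat scheme
over `U`. -/
theorem exists_flat_torus {n : ℕ} {T U : Scheme.{u}} [IsAffine U] (c : T ⟶ U) (σ : torus n T) :
    ∃ (V : Scheme.{u}) (v : V ⟶ U) (l : T ⟶ V) (τ : torus n V), Flat v ∧ l ≫ v = c ∧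
      torus.map l τ = σ := by
  let A := Γ(U, ⊤)
  let G := Γ(T, ⊤)ˣ
  let := (pullFn c).toAlgebra
  -- In the group algebra of the units of `T`, which is free over `A`, every unit of `T` has a
  -- universal counterpart; evaluation at the actual units recovers `σ`, and relations such as `∏
  -- σ_i = 1` are kept.
  let S := MonoidAlgebra A G
  let lam : S →ₐ[A] Γ(T, ⊤) := MonoidAlgebra.lift A Γ(T, ⊤) G (Units.coeHom Γ(T, ⊤))
  let θ : G →* Γ(Spec (.of S), ⊤)ˣ :=
    (Units.map ((specFn (𝟙 (Spec (.of S)))).toMonoidHom.comp (MonoidAlgebra.of A G))).comp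
      toUnits.toMonoidHom
  have hσ : ∏ i, σ.1 i = 1 := σ.2
  refine ⟨Spec (.of S), Spec.map (CommRingCat.ofHom (algebraMap A S)) ≫ U.isoSpec.inv,
    specHom lam.toRingHom, ⟨fun i => θ (σ.1 i), ?_⟩, ?_, ?_, ?_⟩
  · change ∏ i, θ (σ.1 i) = 1
    rw [← map_prod, hσ, map_one]
  · have : Flat (Spec.map (CommRingCat.ofHom (algebraMap A S))) := by
      rw [HasRingHomProperty.Spec_iff (P := @Flat)]
      exact RingHom.flat_algebraMap_iff.2 inferInstance
    infer_instance
  · have h1 : lam.toRingHom.comp (algebraMap A S) = pullFn c := lam.comp_algebraMap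
    rw [specHom, Category.assoc, ← Category.assoc (Spec.map _) (Spec.map _), ← Spec.map_comp,
      ← CommRingCat.ofHom_comp, h1]
    have h2 := Scheme.toSpecΓ_naturality c
    rw [← Category.assoc]
    refine (congrArg (· ≫ U.isoSpec.inv) h2.symm).trans ?_
    rw [Category.assoc]
    change c ≫ U.isoSpec.hom ≫ U.isoSpec.inv = c
    rw [Iso.hom_inv_id, Category.comp_id]
  · refine Subtype.ext (funext fun i => Units.ext ?_)
    change pullFn _ (specFn (𝟙 _) (MonoidAlgebra.of A G (σ.1 i))) = (σ.1 i : Γ(T, ⊤))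
    rw [← specFn_eq_pullFn, specFn_specHom]
    exact MonoidAlgebra.lift_of _ _

variable {X B B' : Space.{u}} {f : X ⟶ A1} {n : ℕ} {r : B ⟶ fib X f n} {r' : B' ⟶ fib X f n}

theorem reverse_map {S T : Scheme.{u}} (g : S ⟶ T) (σ : torus n T) :
    torus.reverse (torus.map g σ) = torus.map g (torus.reverse σ) := rfl

/-- Both sides have the same image in `X ×_{𝔸¹} 𝔸ⁿ⁺¹`, which decides only if the coordinates are
regular. Étale locally the pair `(σ, b)` is pulled back from a scheme flat over an étale chart of
`B`, where they are. -/
theorem OppositeModels.hom_act (h : OppositeModels r r') (hB : IsAlgebraicSpace B)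
    (hB' : IsAlgebraicSpace B') {ρ : TorusAction n B} {ρ' : TorusAction n B'}
    (hρ : ∀ {T : Scheme.{u}} (σ : torus n T) (b : B.obj (op T)),
      r.app _ (ρ.act σ b) = fib.smul σ (r.app _ b))
    (hρ' : ∀ {T : Scheme.{u}} (σ : torus n T) (b : B'.obj (op T)),
      r'.app _ (ρ'.act σ b) = fib.smul σ (r'.app _ b)) {φ : B ⟶ B'}
    (hφ : φ ≫ r' = r ≫ fib.reverse X f n) {T : Scheme.{u}} (σ : torus n T) (b : B.obj (op T)) :
    φ.app _ (ρ.act σ b) = ρ'.act (torus.reverse σ) (φ.app _ b) := by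
  have hφ' {S : Scheme.{u}} (y : B.obj (op S)) :
      r'.app _ (φ.app _ y) = (fib.reverse X f n).app _ (r.app _ y) :=
    congrArg (fun α => α.app (op S) y) hφ
  refine eq_of_etale_local hB'.isSheaf fun p => ?_
  obtain ⟨T', g, q, U, e, c, hg, hq, hU, he, hc⟩ := hB.exists_chart b p
  obtain ⟨V, v, l, τ, hv, rfl, hτ⟩ := exists_flat_torus c (torus.map g σ)
  have key : φ.app _ (ρ.act τ (B.map v.op e)) =
      ρ'.act (torus.reverse τ) (φ.app _ (B.map v.op e)) := by
    refine h.symm.ext hB' ?_ fun i => ?_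
    · rw [hφ', hρ, hρ', hφ']
      rfl
    · rw [hφ', hρ]
      change IsRegularFn ((τ.1 i.rev : Γ(V, ⊤)) * (r.app _ (B.map v.op e)).coord i.rev)
      refine (isRegularFn_of_isUnit (τ.1 i.rev).isUnit).mul ?_
      rw [coord_map]
      exact (h.isRegularFn_coord he i.rev).pullFn v
  refine ⟨T', g, q, hg, hq, ?_⟩
  have hc' : B.map g.op b = B.map l.op (B.map v.op e) := by
    rw [← hc, op_comp, B.map_comp_apply]
  rw [← app_map φ, ρ.map_act, ρ'.map_act, ← app_map φ, hc', ← hτ, ← ρ.map_act, app_map φ, key,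
    ρ'.map_act, ← reverse_map, hτ, app_map φ l, reverse_map]

end ExpDeg

end

theorem proposition2 {k : Type u} [Field k] [IsAlgClosed k] [CharZero k]
    (C : Scheme.{u}) [C.Over (Spec (.of k))] (t : Γ(C, ⊤)) (c₀ : C)
    (ht : Etale (AffineSpace.homOfVector (C ↘ Spec (.of k)) (fun _ : PUnit.{u + 1} => t)))
    (hc₀ : ∀ c : C, c ∉ C.basicOpen t ↔ c = c₀)
    (X : Space.{u}) (π : X ⟶ yoneda.obj C) (hπ : IsStrictSimpleDegeneration k c₀ π)
    (o : Orientation k c₀ π) (n : ℕ)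
    (E : ExpandedDegeneration t o n) (E' : ExpandedDegeneration t o.reverse n) :
    ∃ φ : E.space ≅ E'.space,
      φ.hom ≫ E'.toBase = E.toBase ≫ fib.reverse (yoneda.obj C) (fnOf t) n ∧
      ∀ (T : Scheme.{u}) (σ : torus n T) (b : E.space.obj (op T)),
        φ.hom.app (op T) (E.action.act σ b) =
          E'.action.act (torus.reverse σ) (φ.hom.app (op T) b) := by
  have h : OppositeModels E.res E'.res := exists_hasModels hπ hc₀ ht E E'
  obtain ⟨φ, hφ⟩ := h.exists_iso hπ.isAlgebraicSpace E.isAlgebraicSpace E'.isAlgebraicSpace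
  refine ⟨φ, ?_, fun T σ b => h.hom_act E.isAlgebraicSpace E'.isAlgebraicSpace E.res_act E'.res_act
    hφ σ b⟩
  -- Reversing the coordinates commutes with the projection to `C[n]`.
  rw [ExpandedDegeneration.toBase, ExpandedDegeneration.toBase, ← Category.assoc, hφ]
  rfl
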